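/- **Setting.** For two linear codes $U,V\subseteq\mathbb F_q^N$ let $(U\mid U+V)=\{(u\mid u+v): u\in U,\ v\in V\}\subseteq\mathbb F_q^{2N}$. An iterated $(U\mid U+V)$-code of depth $\ell$ with constituent codes $U_x\subseteq\mathbb F_q^n$ ($x\in\{0,1\}^\ell$) is the code $U_\epsilon$ of length $2^\ell n$ (here $\epsilon$ is the empty word) obtained from $U_x=(U_{x0}\mid U_{x0}+U_{x1})$ for all binary words $x$ of length $<\ell$. A Reed–Solomon code of length $n$ and dimension $k$ ($0\le k\le n\le q$) over $\mathbb F_q$ is $\{(f(a_1),\dots,f(a_n)) : f\in\mathbb F_q[X],\ \deg f<k\}$ with distinct $a_1,\dots,a_n\in\mathbb F_q$. The $q$-ary symmetric channel $q\text{-SC}_p$ is the memoryless channel over $\mathbb F_q$ which leaves a symbol unchanged with probability $1-p$ and replaces it by each of the $q-1$ other symbols with probability $p/(q-1)$. The iterated $(U\mid U+V)$-decoder is the following recursive decoder, fed with the vectors $\pi$ of a posteriori probabilities of the code symbols (for uniform inputs). At a node $(U\mid U+V)$, where the two halves of the word have a posteriori vectors $\pi_1(i),\pi_2(i)$ at position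 $i$, it first decodes $v\in V$ from the vectors $\alpha\mapsto\sum_\beta\pi_1(i)(\beta)\,\pi_2(i)(\alpha+\beta)$, then decodes $u\in U$ from the vectors $\alpha\mapsto \pi_1(i)(\alpha)\,\pi_2(i)(\alpha+v_i)\big/\sum_\beta \pi_1(i)(\beta)\,\pi_2(i)(\beta+v_i)$, and returns $(u\mid u+v)$. A constituent Reed–Solomon code of dimension $k$ is decoded by the Koetter–Vardy algorithm, with a parameter $s\in\mathbb N$ that may be chosen separately for each code of the family and each of its constituents: a multiplicity matrix $(m_{\alpha,j})$ is built from zero by $s$ times increasing by one an entry for which $\pi(j)(\alpha)/(m_{\alpha,j}+1)$ is largest; a non-zero $Q(X,Y)\in\mathbb F_q[X,Y]$ of least $(1,\max(k-1,0))$-weighted degree is computed which vanishes at each $(a_j,\alpha)$ with multiplicity at least $m_{\alpha,j}$; the list consists of the codewords given by the $f$ with $\deg f<k$ and $Y-f(X)\mid Q(X,Y)$; and a codeword $c$ of the list which maximises $\prod_j\pi(j)(c_j)$ is returned (ties are broken in a fixed way; decoding fails if the list is empty). The probability of error is the maximum over all codewords $c$ of the probability that the decoder does not return $c$ when $c$ is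 sent. **Proposition.** For real $p\in[0,1]$ define $$C^{\infty,(2)}(p)=\frac{Q(p)(1-p)^2}{4(p^2-2p+2)(3p-4)(2-p)^2},$$ $$C^{\infty,(3)}(p)=\frac{S(p)(1-p)^2}{8\,T_1(p)T_2(p)T_3(p)(3p^2-6p+4)(p^2-2p+2)^2(7p-8)(3p-4)^2(2-p)^4},$$ where $$Q(p)=3p^{11}-40p^{10}+243p^9-890p^8+2192p^7-3800p^6+4702p^5-4148p^4+2624p^3-1248p^2+480p-128,$$ $$T_1(p)=p^4-4p^3+6p^2-4p+2,\quad T_2(p)=7p^2-18p+12,\quad T_3(p)=5p^2-12p+8,$$ $$\begin{aligned}S(p)={}&6615p^{35}-269766p^{34}+5348715p^{33}-68697432p^{32}+642499307p^{31}-4663447618p^{30}+27338551153p^{29}\\ &-133009675740p^{28}+547673160274p^{27}-1936548054764p^{26}+5946432348816p^{25}-15994984917120p^{24}\\ &+37947048851166p^{23}-79831430926900p^{22}+149553041935846p^{21}-250287141028584p^{20}+375085789739404p^{19}\\ &-504157479736392p^{18}+608316727420536p^{17}-659027903954592p^{16}+640716590979968p^{15}-558310438932224p^{14}\\ &+435164216863552p^{13}-302519286136704p^{12}+186871196449024p^{11}-102093104278528p^{10}+49062052366336p^9\\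 &-20617356455936p^8+7534906109952p^7-2386429566976p^6+655237726208p^5-156569829376p^4\\ &+32471121920p^3-5628755968p^2+723517440p-50331648.\end{aligned}$$ Let $p\in[0,1]$ and let $R$ be a real number with $R<C^{\infty,(2)}(p)$ (resp. $R<C^{\infty,(3)}(p)$). Then there exists an infinite family of iterated $(U\mid U+V)$-codes of depth $2$ (resp. of depth $3$) with Reed–Solomon constituent codes, of rate $\ge R$, whose lengths and alphabet sizes $q$ are strictly increasing, and whose probability of error on the $q\text{-SC}_p$, with the iterated $(U\mid U+V)$-decoder based on the Koetter–Vardy algorithm, tends to $0$ as $q\to\infty$. -/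

import Mathlib

open Filter Topology

namespace UVKV

/-! ### Reed-Solomon codes and iterated `(U | U + V)` codes -/

section Codes

variable {F : Type} [Field F] {n : ℕ}

/-- Evaluation of a polynomial at the points `pts 0, …, pts (n - 1)`. -/
noncomputable def evalAt (pts : Fin n ↪ F) : Polynomial F →ₗ[F] (Fin n → F) :=
  LinearMap.pi fun j => Polynomial.leval (pts j)

/-- The Reed-Solomon code of length `n` with evaluation points `pts`: the evaluation vectors of the
polynomials of degree less than `k`. It has dimension `k` when `k ≤ n`. -/
noncomputable def rsCode (pts : Fin n ↪ F) (k : ℕ) : Submodule F (Fin n → F) :=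
  (Polynomial.degreeLT F k).map (evalAt pts)

/-- The positions of a word of length `2 ^ d * n`, organised by `d` successive halvings. -/
def BlockIdx (n : ℕ) : ℕ → Type
  | 0 => Fin n
  | d + 1 => BlockIdx n d ⊕ BlockIdx n d

noncomputable instance instFintypeBlockIdx (n : ℕ) : (d : ℕ) → Fintype (BlockIdx n d)
  | 0 => inferInstanceAs (Fintype (Fin n))
  | d + 1 =>
    letI := instFintypeBlockIdx n d
    inferInstanceAs (Fintype (BlockIdx n d ⊕ BlockIdx n d))

theorem card_blockIdx (n d : ℕ) : Fintype.card (BlockIdx n d) = 2 ^ d * n := by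
  induction d with
  | zero =>
    have h : Fintype.card (BlockIdx n 0) = n := Fintype.card_fin n
    rw [h]; ring
  | succ d ih =>
    have h : Fintype.card (BlockIdx n (d + 1)) =
        Fintype.card (BlockIdx n d) + Fintype.card (BlockIdx n d) := Fintype.card_sum
    rw [h, ih]; ring

/-- The linear map `(u, v) ↦ (u | u + v)`. -/
def uvMap (ι : Type) : (ι → F) × (ι → F) →ₗ[F] (ι ⊕ ι → F) where
  toFun w := Sum.elim w.1 (w.1 + w.2)
  map_add' w w' := by
    funext i; cases i <;> simp [add_add_add_comm]
  map_smul' a w := by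
    funext i; cases i <;> simp [mul_add]

/-- The code `(U | U + V) = {(u | u + v) : u ∈ U, v ∈ V}`. -/
def uvCode {ι : Type} (U V : Submodule F (ι → F)) : Submodule F (ι ⊕ ι → F) :=
  (U.prod V).map (uvMap ι)

/-- The node `U_x` of an iterated construction, `d` levels above the constituent codes:
`U_x = (U_{x0} | U_{x0} + U_{x1})`. The iterated code of depth `ℓ` is `iteratedUV C ℓ []`; its
constituent codes are the `C x` with `x` a binary word of length `ℓ` (`false` is the bit `0`,
`true` is the bit `1`). -/
def iteratedUV (C : List Bool → Submodule F (Fin n → F)) :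
    (d : ℕ) → List Bool → Submodule F (BlockIdx n d → F)
  | 0, x => C x
  | d + 1, x => uvCode (iteratedUV C d (x ++ [false])) (iteratedUV C d (x ++ [true]))

/-- The rate (dimension divided by length) of a linear code. -/
noncomputable def rate {ι : Type} [Fintype ι] (C : Submodule F (ι → F)) : ℝ :=
  (Module.finrank F C : ℝ) / (Fintype.card ι : ℝ)

end Codes

/-! ### The Koetter-Vardy decoder of a Reed-Solomon code

A reliability matrix is given as `Pi : Fin n → F → ℝ`, where `Pi j a` is the a posteriori
probability that the `j`-th symbol of the codeword is `a`. -/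

section KoetterVardy

variable {F : Type} [Field F] {n : ℕ}

open Classical in
/-- The multiplicity matrix with sum of entries `s`: starting from the zero matrix, `s` times in
succession, increase by one an entry `m` at which `Pi / (m + 1)` is largest. -/
noncomputable def kvMultiplicity (Pi : Fin n → F → ℝ) : ℕ → Fin n × F → ℕ
  | 0 => 0
  | s + 1 =>
    if h : ∃ z : Fin n × F, ∀ w : Fin n × F,
        Pi w.1 w.2 / ((kvMultiplicity Pi s w : ℝ) + 1) ≤
          Pi z.1 z.2 / ((kvMultiplicity Pi s z : ℝ) + 1) then
      fun w => if w = h.choose then kvMultiplicity Pi s w + 1 else kvMultiplicity Pi s w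
    else kvMultiplicity Pi s

/-- `Q(X, Y)` (a polynomial in `Y` over `F[X]`) vanishes at `(a, b)` with multiplicity at least `m`:
the polynomial `Q(X + a, Y + b)` has no monomial of total degree less than `m`. -/
def VanishesToOrder (Q : Polynomial (Polynomial F)) (a b : F) (m : ℕ) : Prop :=
  ∀ i j : ℕ, i + j < m →
    (((Q.map (Polynomial.compRingHom (Polynomial.X + Polynomial.C a))).comp
      (Polynomial.X + Polynomial.C (Polynomial.C b))).coeff j).coeff i = 0

/-- The `(1, w)`-weighted degree of `Q(X, Y)`: the maximum of `i + w * j` over the monomials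
`X ^ i * Y ^ j` of `Q`. -/
noncomputable def weightedDegree (w : ℕ) (Q : Polynomial (Polynomial F)) : ℕ :=
  Q.support.sup fun j => (Q.coeff j).natDegree + w * j

/-- `Q` is a non-zero polynomial satisfying the interpolation constraints of the multiplicity
matrix `M`. -/
def IsInterpolating (pts : Fin n ↪ F) (M : Fin n × F → ℕ) (Q : Polynomial (Polynomial F)) : Prop :=
  Q ≠ 0 ∧ ∀ (j : Fin n) (a : F), VanishesToOrder Q (pts j) a (M (j, a))

open Classical in
/-- The soft interpolation step: an interpolating polynomial of least `(1, k - 1)`-weighted degree.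
(Such a polynomial always exists over a finite field; the last branch is never used there.) -/
noncomputable def kvPolynomial (pts : Fin n ↪ F) (k : ℕ) (M : Fin n × F → ℕ) :
    Polynomial (Polynomial F) :=
  if h : ∃ Q, IsInterpolating pts M Q ∧
      ∀ Q', IsInterpolating pts M Q' → weightedDegree (k - 1) Q ≤ weightedDegree (k - 1) Q' then
    h.choose
  else 1

/-- The list of the Koetter-Vardy decoder with parameter `s`: the codewords given by the polynomials
`f` of degree less than `k` for which `Y - f(X)` divides the interpolation polynomial. -/
def kvList (pts : Fin n ↪ F) (k s : ℕ) (Pi : Fin n → F → ℝ) : Set (Fin n → F) :=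
  {c | ∃ f ∈ Polynomial.degreeLT F k, evalAt pts f = c ∧
    (Polynomial.X - Polynomial.C f) ∣ kvPolynomial pts k (kvMultiplicity Pi s)}

/-- The likelihood of a word according to a reliability matrix. -/
def likelihood (Pi : Fin n → F → ℝ) (c : Fin n → F) : ℝ := ∏ j, Pi j (c j)

open Classical in
/-- The output of the Koetter-Vardy decoder: a most likely codeword of its list, or `none`
(a decoding failure) if the list is empty. -/
noncomputable def kvDecode (pts : Fin n ↪ F) (k s : ℕ) (Pi : Fin n → F → ℝ) :
    Option (Fin n → F) :=
  if h : ∃ c ∈ kvList pts k s Pi, ∀ c' ∈ kvList pts k s Pi,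
      likelihood Pi c' ≤ likelihood Pi c then
    some h.choose
  else none

end KoetterVardy

/-! ### The iterated `(U | U + V)` decoder -/

section Decoder

variable {F : Type} [Field F] [Fintype F] {n : ℕ}

/-- The reliability matrix of the `V`-decoder: the law of `x₂ - x₁` when `x₁`, `x₂` are independent
with laws given by the two halves of `Pi`. -/
def reliabilityV {ι : Type} (Pi : ι ⊕ ι → F → ℝ) : ι → F → ℝ :=
  fun i a => ∑ b : F, Pi (Sum.inl i) b * Pi (Sum.inr i) (a + b)

/-- The reliability matrix of the `U`-decoder once `v` is known. -/
noncomputable def reliabilityU {ι : Type} (Pi : ι ⊕ ι → F → ℝ) (v : ι → F) : ι → F → ℝ :=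
  fun i a => Pi (Sum.inl i) a * Pi (Sum.inr i) (a + v i) /
    ∑ b : F, Pi (Sum.inl i) b * Pi (Sum.inr i) (b + v i)

/-- The recursive decoder of the node `U_x`, `d` levels above the constituent codes `rsCode pts (k x)`,
which are decoded by the Koetter-Vardy decoder with parameter `s x`. At an inner node
`(U | U + V)` one first decodes `v`, then decodes `u` with the help of the decoded `v`, and
outputs `(u | u + v)`. -/
noncomputable def uvDecode (pts : Fin n ↪ F) (k s : List Bool → ℕ) :
    (d : ℕ) → List Bool → (BlockIdx n d → F → ℝ) → Option (BlockIdx n d → F)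
  | 0, x, Pi => kvDecode pts (k x) (s x) Pi
  | d + 1, x, Pi =>
    (uvDecode pts k s d (x ++ [true]) (reliabilityV Pi)).bind fun v =>
      (uvDecode pts k s d (x ++ [false]) (reliabilityU Pi v)).map fun u => Sum.elim u (u + v)

open Classical in
/-- The `q`-ary symmetric channel with crossover probability `p` and alphabet `F`:
`qSC p x y` is the probability of receiving `y` when `x` is sent. -/
noncomputable def qSC (p : ℝ) (x y : F) : ℝ :=
  if y = x then 1 - p else p / ((Fintype.card F : ℝ) - 1)

/-- The a posteriori probabilities of the sent symbols given the received word `y`, for uniformly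
distributed symbols sent over the `q`-ary symmetric channel. -/
noncomputable def channelReliability {ι : Type} (p : ℝ) (y : ι → F) : ι → F → ℝ :=
  fun i a => qSC p a (y i) / ∑ b : F, qSC p b (y i)

open Classical in
/-- The probability that the word decoded from the output of the (memoryless) `q`-ary symmetric
channel is not the codeword `c` that was sent. -/
noncomputable def errorProbOf (p : ℝ) (pts : Fin n ↪ F) (k s : List Bool → ℕ) (l : ℕ)
    (c : BlockIdx n l → F) : ℝ :=
  ∑ y : BlockIdx n l → F,
    if uvDecode pts k s l [] (channelReliability p y) = some c then 0
    else ∏ i, qSC p (c i) (y i)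

/-- The probability of error after decoding of the iterated `(U | U + V)` code of depth `l` with
constituent codes `rsCode pts (k x)`, for the worst codeword. -/
noncomputable def errorProb (p : ℝ) (pts : Fin n ↪ F) (k s : List Bool → ℕ) (l : ℕ) : ℝ :=
  ⨆ c : iteratedUV (fun x => rsCode pts (k x)) l [], errorProbOf p pts k s l c

end Decoder

/-- There is an infinite family of iterated `(U | U + V)` codes of depth `l` with Reed-Solomon
constituent codes, of rate at least `R`, whose lengths and alphabet sizes increase, and whose
probability of error on the `q`-ary symmetric channel with crossover probability `p`, with the
iterated decoder based on the Koetter-Vardy decoder, tends to `0`. -/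
def Achievable (l : ℕ) (p R : ℝ) : Prop :=
  ∃ (F : ℕ → Type) (_ : ∀ m, Field (F m)) (_ : ∀ m, Fintype (F m)) (n : ℕ → ℕ)
    (pts : ∀ m, Fin (n m) ↪ F m) (k s : ℕ → List Bool → ℕ),
    StrictMono n ∧ StrictMono (fun m => Fintype.card (F m)) ∧
    (∀ m x, x.length = l → k m x ≤ n m) ∧
    (∀ m, R ≤ rate (iteratedUV (fun x => rsCode (pts m) (k m x)) l [])) ∧
    Tendsto (fun m => errorProb p (pts m) (k m) (s m) l) atTop (𝓝 0)

/-! ### The two rational functions -/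

def polyQ (p : ℝ) : ℝ :=
  3 * p ^ 11 - 40 * p ^ 10 + 243 * p ^ 9 - 890 * p ^ 8 + 2192 * p ^ 7 - 3800 * p ^ 6
  + 4702 * p ^ 5 - 4148 * p ^ 4 + 2624 * p ^ 3 - 1248 * p ^ 2 + 480 * p - 128

noncomputable def capacityDepth2 (p : ℝ) : ℝ :=
  polyQ p * (1 - p) ^ 2 / (4 * (p ^ 2 - 2 * p + 2) * (3 * p - 4) * (2 - p) ^ 2)

def polyT1 (p : ℝ) : ℝ := p ^ 4 - 4 * p ^ 3 + 6 * p ^ 2 - 4 * p + 2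

def polyT2 (p : ℝ) : ℝ := 7 * p ^ 2 - 18 * p + 12

def polyT3 (p : ℝ) : ℝ := 5 * p ^ 2 - 12 * p + 8

def polyS (p : ℝ) : ℝ :=
  6615 * p ^ 35 - 269766 * p ^ 34 + 5348715 * p ^ 33 - 68697432 * p ^ 32 + 642499307 * p ^ 31
  - 4663447618 * p ^ 30 + 27338551153 * p ^ 29 - 133009675740 * p ^ 28 + 547673160274 * p ^ 27
  - 1936548054764 * p ^ 26 + 5946432348816 * p ^ 25 - 15994984917120 * p ^ 24
  + 37947048851166 * p ^ 23 - 79831430926900 * p ^ 22 + 149553041935846 * p ^ 21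
  - 250287141028584 * p ^ 20 + 375085789739404 * p ^ 19 - 504157479736392 * p ^ 18
  + 608316727420536 * p ^ 17 - 659027903954592 * p ^ 16 + 640716590979968 * p ^ 15
  - 558310438932224 * p ^ 14 + 435164216863552 * p ^ 13 - 302519286136704 * p ^ 12
  + 186871196449024 * p ^ 11 - 102093104278528 * p ^ 10 + 49062052366336 * p ^ 9
  - 20617356455936 * p ^ 8 + 7534906109952 * p ^ 7 - 2386429566976 * p ^ 6
  + 655237726208 * p ^ 5 - 156569829376 * p ^ 4 + 32471121920 * p ^ 3 - 5628755968 * p ^ 2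
  + 723517440 * p - 50331648

noncomputable def capacityDepth3 (p : ℝ) : ℝ :=
  polyS p * (1 - p) ^ 2 /
    (8 * polyT1 p * polyT2 p * polyT3 p * (3 * p ^ 2 - 6 * p + 4) * (p ^ 2 - 2 * p + 2) ^ 2 *
      (7 * p - 8) * (3 * p - 4) ^ 2 * (2 - p) ^ 4)

end UVKV

/-! For a fixed length `n` and a field that is very large compared with `n`, a Reed–Solomon code
decoded by the Koetter–Vardy algorithm can be used at any rate below the mean `m` of the a
posteriori probability of the symbol sent. Indeed, as the parameter `s` grows, the multiplicities
become proportional to the reliability matrix `π`, and the count of monomials against linear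
constraints puts `c` on the list as soon as `(k - 1) ∑ π² < (∑ π_j(c_j))²` (`eventually_score`,
`dvd_of_isInterpolating`). A posteriori probabilities are calibrated, so `∑_a π(a)²` and `π(sent
symbol)` have the same mean `m` (`Chan.sum_sq_fst`). By Chebyshev both sums are close to `n m`, and
the condition becomes `k < n m`.

The decoder returns the most likely word of its list, so `c` must also beat every other codeword.
The mean total likelihood of the wrong codewords is of order `q^{-(n-k)}`, whereas the likelihood of
`c` is with high probability at least of order `q^{-(n-k-1)}`. The remaining factor `1/q` beats all
constants depending on `n` (`sum_prod_codewords_le`, `le_prod_of_large_sum`, `union_bound_le`).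

The iterated decoder fails only if some leaf decoder fails while all previously decoded words are
correct. By linearity and symmetry each leaf then sees a memoryless channel, obtained from the
symmetric one by `V`-steps and `U`-steps (`Chan.V`, `Chan.U`, `errorProb_le`). It remains to bound
the mean `m` of each leaf channel from below as `q → ∞`.

The exact a posteriori vectors are awkward to follow, so each outcome also carries an estimator `g`
supported on a bounded number of candidate symbols. From `|π - g|² ≥ 0` and calibration, `m ≥ 2 E
g(sent) - E |g|²` (`Chan.le_mean`). Over a large field, coincidences between wrong candidates, or
between differences of candidates, are rare by dilation invariance (`Chan.prob_collide_le`). Outside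
of them, the total weight and the sum of squares of the weights of `g` follow a finite recursion
that does not depend on `q` (`Law`, `Approach`). Its limiting means, summed over the leaves, give `2
^ 2` and `2 ^ 3` times the two rational functions (`leafSum_depthTwo`, `leafSum_depthThree`). -/

namespace UVKV

/-! ### Soft interpolation: a large score puts a codeword on the list. -/

section Interpolation

variable {F : Type} [Field F] {n : ℕ}

/-- The bivariate polynomial with coefficient `c z` at the monomial with exponents `e z`. -/
noncomputable def ofCoeffs {ι : Type} [Fintype ι] (e : ι → ℕ × ℕ) (c : ι → F) :
    Polynomial (Polynomial F) :=
  ∑ z, Polynomial.monomial (e z).2 (Polynomial.monomial (e z).1 (c z))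

theorem ofCoeffs_add {ι : Type} [Fintype ι] (e : ι → ℕ × ℕ) (c c' : ι → F) :
    ofCoeffs e (c + c') = ofCoeffs e c + ofCoeffs e c' := by
  simp [ofCoeffs, Finset.sum_add_distrib]

theorem ofCoeffs_smul {ι : Type} [Fintype ι] (e : ι → ℕ × ℕ) (a : F) (c : ι → F) :
    ofCoeffs e (a • c) = Polynomial.C (Polynomial.C a) * ofCoeffs e c := by
  simp [ofCoeffs, Finset.mul_sum, Polynomial.C_mul_monomial]

theorem coeff_ofCoeffs {ι : Type} [Fintype ι] (e : ι → ℕ × ℕ) (c : ι → F) (i j : ℕ) :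
    ((ofCoeffs e c).coeff j).coeff i = ∑ z, if e z = (i, j) then c z else 0 := by
  classical
  simp only [ofCoeffs, Polynomial.finsetSum_coeff, Polynomial.coeff_monomial]
  refine Finset.sum_congr rfl fun z _ => ?_
  by_cases h2 : (e z).2 = j <;> by_cases h1 : (e z).1 = i <;>
    simp [h1, h2, Prod.ext_iff, Polynomial.coeff_monomial]

/-- The coefficients of `Q(X + a, Y + b)`. -/
noncomputable def shiftCoeff (a b : F) (i j : ℕ) (Q : Polynomial (Polynomial F)) : F :=
  (((Q.map (Polynomial.compRingHom (Polynomial.X + Polynomial.C a))).comp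
      (Polynomial.X + Polynomial.C (Polynomial.C b))).coeff j).coeff i

theorem shiftCoeff_add (a b : F) (i j : ℕ) (Q Q' : Polynomial (Polynomial F)) :
    shiftCoeff a b i j (Q + Q') = shiftCoeff a b i j Q + shiftCoeff a b i j Q' := by
  simp [shiftCoeff]

theorem shiftCoeff_smul (a b : F) (i j : ℕ) (r : F) (Q : Polynomial (Polynomial F)) :
    shiftCoeff a b i j (Polynomial.C (Polynomial.C r) * Q) = r * shiftCoeff a b i j Q := by
  simp [shiftCoeff]

/-- If there are more monomials than linear constraints, then there is an interpolating polynomial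
supported on these monomials. -/
theorem exists_isInterpolating [Fintype F] {ι : Type} [Fintype ι] (e : ι → ℕ × ℕ)
    (he : Function.Injective e) (pts : Fin n ↪ F) (M : Fin n × F → ℕ)
    (h : ∑ w, M w * (M w + 1) < 2 * Fintype.card ι) :
    ∃ Q, IsInterpolating pts M Q ∧ ∀ i j, (Q.coeff j).coeff i ≠ 0 → (i, j) ∈ Set.range e := by
  classical
  -- One constraint for each entry `w` and each monomial of degree `t < M w`, the latter given by
  -- its `X`-exponent at most `t`: this makes `M w (M w + 1) / 2` constraints at `w`.
  let K := Σ w : Fin n × F, Σ t : Fin (M w), Fin (t.1 + 1)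
  let L : (ι → F) →ₗ[F] (K → F) :=
    { toFun := fun c κ =>
        shiftCoeff (pts κ.1.1) κ.1.2 κ.2.2.1 (κ.2.1.1 - κ.2.2.1) (ofCoeffs e c)
      map_add' := fun c c' => by
        funext κ; simp [ofCoeffs_add, shiftCoeff_add]
      map_smul' := fun a c => by
        funext κ; simp [ofCoeffs_smul, shiftCoeff_smul] }
  have hK : 2 * Fintype.card K = ∑ w, M w * (M w + 1) := by
    simp only [K, Fintype.card_sigma, Fintype.card_fin, Finset.mul_sum]
    refine Finset.sum_congr rfl fun w _ => ?_
    rw [← Finset.mul_sum, Fin.sum_univ_eq_sum_range (fun t => t + 1) (M w)]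
    induction M w with
    | zero => simp
    | succ m ih => rw [Finset.sum_range_succ, mul_add, ih]; ring
  have hlt : Module.finrank F (K → F) < Module.finrank F (ι → F) := by
    simp only [Module.finrank_fintype_fun_eq_card]; omega
  obtain ⟨c, hc, hc0⟩ := (Submodule.ne_bot_iff _).1 (LinearMap.ker_ne_bot_of_finrank_lt
    (f := L) hlt)
  refine ⟨ofCoeffs e c, ⟨?_, ?_⟩, ?_⟩
  · intro h0
    apply hc0
    funext z
    have := coeff_ofCoeffs e c (e z).1 (e z).2
    rw [h0, Finset.sum_eq_single z] at this
    · simpa using this.symm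
    · intro z' _ hz'
      rw [if_neg]
      exact fun hh => hz' (he hh)
    · simp
  · intro j a i k hik
    have := congrFun (LinearMap.mem_ker.1 hc) ⟨(j, a), ⟨i + k, hik⟩, ⟨i, by simp⟩⟩
    simpa [L, shiftCoeff] using this
  · intro i j hij
    rw [coeff_ofCoeffs] at hij
    obtain ⟨z, _, hz⟩ := Finset.exists_ne_zero_of_sum_ne_zero hij
    exact ⟨z, by by_contra hne; simp [hne] at hz⟩

/-- A polynomial vanishing at `(a, f(a))` with multiplicity `m` yields an `m`-fold zero of
`Q(X, f(X))` at `a`. -/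
theorem VanishesToOrder.pow_dvd_eval {Q : Polynomial (Polynomial F)} {a : F} {f : Polynomial F}
    {m : ℕ} (h : VanishesToOrder Q a (f.eval a) m) :
    (Polynomial.X - Polynomial.C a) ^ m ∣ Q.eval f := by
  set P := (Q.map (Polynomial.compRingHom (Polynomial.X + Polynomial.C a))).comp
      (Polynomial.X + Polynomial.C (Polynomial.C (f.eval a))) with hP
  set g := f.comp (Polynomial.X + Polynomial.C a) - Polynomial.C (f.eval a) with hg
  have h1 : P.eval g = (Q.eval f).comp (Polynomial.X + Polynomial.C a) := by
    rw [hP, Polynomial.eval_comp]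
    have : Polynomial.eval g (Polynomial.X + Polynomial.C (Polynomial.C (f.eval a))) =
        Polynomial.compRingHom (Polynomial.X + Polynomial.C a) f := by
      simp [hg]
    rw [this, Polynomial.eval_map, Polynomial.eval₂_hom]
    rfl
  have hXg : Polynomial.X ∣ g := by
    rw [Polynomial.X_dvd_iff]
    simp [hg, Polynomial.coeff_zero_eq_eval_zero, Polynomial.eval_comp]
  have h2 : Polynomial.X ^ m ∣ P.eval g := by
    rw [Polynomial.eval_eq_sum, Polynomial.sum]
    refine Finset.dvd_sum fun j _ => ?_
    have h3 : Polynomial.X ^ (m - j) ∣ P.coeff j := by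
      rw [Polynomial.X_pow_dvd_iff]
      intro i hi
      exact h i j (by omega)
    have h4 := mul_dvd_mul h3 (pow_dvd_pow_of_dvd hXg j)
    rw [← pow_add] at h4
    exact (pow_dvd_pow _ (by omega)).trans h4
  rw [h1] at h2
  obtain ⟨r, hr⟩ := h2
  refine ⟨r.comp (Polynomial.X - Polynomial.C a), ?_⟩
  have := congrArg (fun u => Polynomial.comp u (Polynomial.X - Polynomial.C a)) hr
  simpa [Polynomial.comp_assoc] using this

/-- `Q(X, f(X))` has degree at most the weighted degree of `Q`, and it is divisible by pairwise
coprime powers of the `X - pts j` whose total degree is the score of `f`. A larger score forces it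
to vanish. -/
theorem dvd_of_isInterpolating {pts : Fin n ↪ F} {M : Fin n × F → ℕ}
    {Q : Polynomial (Polynomial F)} (hQ : IsInterpolating pts M Q) {w : ℕ} {f : Polynomial F}
    (hf : f.natDegree ≤ w) (hD : weightedDegree w Q < ∑ j, M (j, f.eval (pts j))) :
    (Polynomial.X - Polynomial.C f) ∣ Q := by
  rw [Polynomial.dvd_iff_isRoot, Polynomial.IsRoot.def]
  by_contra hne
  have hdeg : (Q.eval f).natDegree ≤ weightedDegree w Q := by
    rw [Polynomial.eval_eq_sum, Polynomial.sum]
    refine Polynomial.natDegree_sum_le_of_forall_le _ _ fun j hj => ?_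
    calc (Q.coeff j * f ^ j).natDegree ≤ (Q.coeff j).natDegree + (f ^ j).natDegree :=
          Polynomial.natDegree_mul_le
      _ ≤ (Q.coeff j).natDegree + w * j := by
          have := Polynomial.natDegree_pow_le (p := f) (n := j)
          nlinarith [Nat.mul_le_mul_left j hf]
      _ ≤ _ := Finset.le_sup (f := fun j => (Q.coeff j).natDegree + w * j) hj
  have hdvd : (∏ j, (Polynomial.X - Polynomial.C (pts j)) ^ M (j, f.eval (pts j))) ∣ Q.eval f := by
    refine Finset.prod_dvd_of_coprime ?_ fun j _ => (hQ.2 j _).pow_dvd_eval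
    intro i _ j _ hij
    exact (Polynomial.pairwise_coprime_X_sub_C pts.injective hij).pow
  have h1 := Polynomial.natDegree_le_of_dvd hdvd hne
  rw [Polynomial.natDegree_prod_of_monic _ _
    fun j _ => (Polynomial.monic_X_sub_C _).pow _] at h1
  simp only [(Polynomial.monic_X_sub_C _).natDegree_pow, Polynomial.natDegree_X_sub_C,
    mul_one] at h1
  omega

theorem dvd_kvPolynomial {pts : Fin n ↪ F} {M : Fin n × F → ℕ} {k : ℕ} {f : Polynomial F}
    (hf : f ∈ Polynomial.degreeLT F k)
    (h : ∃ Q, IsInterpolating pts M Q ∧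
      weightedDegree (k - 1) Q < ∑ j, M (j, f.eval (pts j))) :
    (Polynomial.X - Polynomial.C f) ∣ kvPolynomial pts k M := by
  classical
  obtain ⟨Q₀, hQ₀, hD⟩ := h
  have hex : ∃ Q, IsInterpolating pts M Q ∧
      ∀ Q', IsInterpolating pts M Q' → weightedDegree (k - 1) Q ≤ weightedDegree (k - 1) Q' := by
    let S : Set (Polynomial (Polynomial F)) := {Q | IsInterpolating pts M Q}
    have hS : S.Nonempty := ⟨Q₀, hQ₀⟩
    refine ⟨Function.argminOn (weightedDegree (k - 1)) S hS,
      Function.argminOn_mem _ S hS, fun Q' hQ' => Function.argminOn_le _ S hQ'⟩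
  rw [kvPolynomial, dif_pos hex]
  have hspec := hex.choose_spec
  have hf' : f.natDegree ≤ k - 1 := by
    rw [Polynomial.mem_degreeLT] at hf
    by_cases h0 : f = 0
    · simp [h0]
    · rw [Polynomial.degree_eq_natDegree h0] at hf
      have : f.natDegree < k := by exact_mod_cast hf
      omega
  exact dvd_of_isInterpolating hspec.1 hf' ((hspec.2 Q₀ hQ₀).trans_lt hD)

theorem weightedDegree_lt {w D : ℕ} {Q : Polynomial (Polynomial F)} (hD : 0 < D)
    (h : ∀ i j, (Q.coeff j).coeff i ≠ 0 → i + w * j < D) : weightedDegree w Q < D := by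
  rw [weightedDegree, Finset.sup_lt_iff hD]
  intro j hj
  refine h _ j ?_
  rw [Polynomial.mem_support_iff] at hj
  exact Polynomial.leadingCoeff_ne_zero.2 hj

/-- A count of the monomials `X ^ i * Y ^ j` with `i + w * j < S`. Removing the row `j = 0` replaces
`S` by `S - w`, and `(r + w)² ≤ r² + 2 w (r + w)`. -/
theorem sq_le_two_mul_sum_sub {w : ℕ} (hw : 1 ≤ w) (N : ℕ) :
    ∀ S, S ≤ N → S ^ 2 ≤ 2 * w * ∑ j ∈ Finset.range N, (S - w * j) := by
  induction N with
  | zero => intro S hS; simp [Nat.le_zero.1 hS]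
  | succ N ih =>
    intro S hS
    have h := ih (S - w) (by omega)
    rw [Finset.sum_range_succ']
    have h2 : ∑ j ∈ Finset.range N, (S - w * (j + 1)) =
        ∑ j ∈ Finset.range N, (S - w - w * j) := by
      refine Finset.sum_congr rfl fun j _ => ?_
      rw [mul_add, mul_one]; omega
    rw [h2, mul_zero, Nat.sub_zero]
    rcases le_total S w with hSw | hSw
    · have : S ^ 2 ≤ 2 * w * S := by nlinarith
      nlinarith [Nat.zero_le (2 * w * ∑ j ∈ Finset.range N, (S - w - w * j))]
    · obtain ⟨r, rfl⟩ := Nat.exists_eq_add_of_le hSw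
      rw [Nat.add_sub_cancel_left] at *
      nlinarith

theorem exists_isInterpolating_weightedDegree_lt [Fintype F] (pts : Fin n ↪ F)
    (M : Fin n × F → ℕ) {w S : ℕ} (hS : 0 < S)
    (h : w * ∑ z, M z * (M z + 1) < S ^ 2) :
    ∃ Q, IsInterpolating pts M Q ∧ weightedDegree w Q < S := by
  rcases Nat.eq_zero_or_pos w with rfl | hw
  -- For `w = 0`, that is `k ≤ 1`, all powers of `Y` have weighted degree `0`, so there are as many
  -- monomials as needed.
  · obtain ⟨Q, hQ, hQ'⟩ := exists_isInterpolating
      (ι := Fin (∑ z, M z * (M z + 1) + 1)) (fun l => (0, l.1))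
      (fun a b hab => Fin.ext (Prod.ext_iff.1 hab).2) pts M (by simp; omega)
    refine ⟨Q, hQ, weightedDegree_lt hS fun i j hij => ?_⟩
    obtain ⟨l, hl⟩ := hQ' i j hij
    have : i = 0 := (Prod.ext_iff.1 hl).1.symm
    simpa [this] using hS
  · obtain ⟨Q, hQ, hQ'⟩ := exists_isInterpolating
      (ι := Σ j : Fin S, Fin (S - w * j.1)) (fun z => (z.2.1, z.1.1))
      (by
        rintro ⟨⟨j, hj⟩, ⟨i, hi⟩⟩ ⟨⟨j', hj'⟩, ⟨i', hi'⟩⟩ hab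
        obtain ⟨h1, h2⟩ := Prod.ext_iff.1 hab
        simp only at h1 h2
        subst h1 h2
        rfl) pts M (by
        have h3 := sq_le_two_mul_sum_sub hw S S le_rfl
        simp only [Fintype.card_sigma, Fintype.card_fin]
        rw [Fin.sum_univ_eq_sum_range (fun j => S - w * j) S]
        have h4 := h.trans_le h3
        rw [mul_comm 2 w, mul_assoc] at h4
        exact Nat.lt_of_mul_lt_mul_left h4)
    refine ⟨Q, hQ, weightedDegree_lt hS fun i j hij => ?_⟩
    obtain ⟨⟨⟨j', hj'⟩, ⟨i', hi'⟩⟩, hl⟩ := hQ' i j hij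
    obtain ⟨h1, h2⟩ := Prod.ext_iff.1 hl
    simp only at h1 h2 hi'
    subst h1 h2
    omega

end Interpolation

/-! ### The greedy multiplicity matrix for a large parameter. -/

section Multiplicity

variable {F : Type} [Fintype F] {n : ℕ}

theorem kvMultiplicity_succ [Nonempty (Fin n × F)] (Pi : Fin n → F → ℝ) (s : ℕ) :
    ∃ z : Fin n × F, (∀ w : Fin n × F,
        Pi w.1 w.2 / ((kvMultiplicity Pi s w : ℝ) + 1) ≤
          Pi z.1 z.2 / ((kvMultiplicity Pi s z : ℝ) + 1)) ∧
      (kvMultiplicity Pi (s + 1) z = kvMultiplicity Pi s z + 1) ∧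
      ∀ w, w ≠ z → kvMultiplicity Pi (s + 1) w = kvMultiplicity Pi s w := by
  classical
  have h : ∃ z : Fin n × F, ∀ w : Fin n × F,
        Pi w.1 w.2 / ((kvMultiplicity Pi s w : ℝ) + 1) ≤
          Pi z.1 z.2 / ((kvMultiplicity Pi s z : ℝ) + 1) := Finite.exists_max _
  refine ⟨h.choose, h.choose_spec, ?_, ?_⟩
  · rw [kvMultiplicity, dif_pos h]; simp
  · intro w hw
    rw [kvMultiplicity, dif_pos h]; exact if_neg hw

theorem sum_kvMultiplicity [Nonempty (Fin n × F)] (Pi : Fin n → F → ℝ) (s : ℕ) :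
    ∑ z, kvMultiplicity Pi s z = s := by
  classical
  induction s with
  | zero => simp [kvMultiplicity]
  | succ s ih =>
    obtain ⟨z, _, h1, h2⟩ := kvMultiplicity_succ Pi s
    have h3 : ∑ w ∈ Finset.univ.erase z, kvMultiplicity Pi (s + 1) w =
        ∑ w ∈ Finset.univ.erase z, kvMultiplicity Pi s w :=
      Finset.sum_congr rfl fun w hw => h2 w (Finset.ne_of_mem_erase hw)
    rw [← Finset.add_sum_erase _ _ (Finset.mem_univ z)] at ih ⊢
    rw [h1, h3]
    omega

/-- At the last increment of `z` the right-hand quotient was the largest of all quotients, and since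
the entries of `Pi` are nonnegative the other quotients can only have decreased afterwards. -/
theorem kvMultiplicity_balanced [Nonempty (Fin n × F)] {Pi : Fin n → F → ℝ}
    (hPi : ∀ j a, 0 ≤ Pi j a) (s : ℕ) (w z : Fin n × F) (hz : 0 < kvMultiplicity Pi s z) :
    Pi w.1 w.2 / ((kvMultiplicity Pi s w : ℝ) + 1) ≤ Pi z.1 z.2 / (kvMultiplicity Pi s z : ℝ) := by
  induction s with
  | zero => simp [kvMultiplicity] at hz
  | succ s ih =>
    obtain ⟨u, hu, h1, h2⟩ := kvMultiplicity_succ Pi s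
    have hmono : Pi w.1 w.2 / ((kvMultiplicity Pi (s + 1) w : ℝ) + 1) ≤
        Pi w.1 w.2 / ((kvMultiplicity Pi s w : ℝ) + 1) := by
      refine div_le_div_of_nonneg_left (hPi _ _) (by positivity) ?_
      have : kvMultiplicity Pi s w ≤ kvMultiplicity Pi (s + 1) w := by
        by_cases hw : w = u
        · rw [hw, h1]; omega
        · rw [h2 w hw]
      have : (kvMultiplicity Pi s w : ℝ) ≤ kvMultiplicity Pi (s + 1) w := by exact_mod_cast this
      linarith
    by_cases hzu : z = u
    · subst hzu
      rw [h1]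
      push_cast
      exact hmono.trans (hu w)
    · rw [h2 z hzu] at hz ⊢
      exact hmono.trans (ih hz)

/-- The multiplicity matrix is, up to rounding, a multiple of the reliability matrix. -/
theorem exists_scale_kvMultiplicity {Pi : Fin n → F → ℝ} (hPi : ∀ j a, 0 ≤ Pi j a)
    (h0 : ∃ j a, 0 < Pi j a) (s : ℕ) :
    ∃ r : ℝ, 0 < r ∧ (∀ z : Fin n × F, (kvMultiplicity Pi s z : ℝ) ≤ r * Pi z.1 z.2) ∧
      (∀ z : Fin n × F, r * Pi z.1 z.2 ≤ kvMultiplicity Pi s z + 1) ∧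
      (s : ℝ) ≤ r * ∑ z : Fin n × F, Pi z.1 z.2 := by
  obtain ⟨j₀, a₀, hpos⟩ := h0
  have : Nonempty (Fin n × F) := ⟨(j₀, a₀)⟩
  obtain ⟨u, hu, -⟩ := kvMultiplicity_succ Pi s
  -- `t` is the quotient that the next increment would select, and the scale is `t⁻¹`. Its
  -- maximality bounds the multiplicities from below, `kvMultiplicity_balanced` bounds them from
  -- above.
  set t := Pi u.1 u.2 / ((kvMultiplicity Pi s u : ℝ) + 1) with ht
  have htpos : 0 < t := lt_of_lt_of_le (by positivity) (hu (j₀, a₀))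
  have hle : ∀ z : Fin n × F, (kvMultiplicity Pi s z : ℝ) ≤ t⁻¹ * Pi z.1 z.2 := by
    intro z
    rcases Nat.eq_zero_or_pos (kvMultiplicity Pi s z) with h | h
    · rw [h]
      have := hPi z.1 z.2
      push_cast; positivity
    · have h1 := kvMultiplicity_balanced hPi s u z h
      have h2 : (0 : ℝ) < kvMultiplicity Pi s z := by exact_mod_cast h
      rw [← ht, le_div_iff₀ h2] at h1
      rw [inv_mul_eq_div, le_div_iff₀ htpos]
      linarith
  refine ⟨t⁻¹, by positivity, hle, ?_, ?_⟩
  · intro z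
    have h1 := hu z
    rw [div_le_iff₀ (by positivity)] at h1
    rw [inv_mul_eq_div, div_le_iff₀ htpos]
    linarith
  · rw [Finset.mul_sum, ← Nat.cast_inj (R := ℝ).2 (sum_kvMultiplicity Pi s)]
    push_cast
    exact Finset.sum_le_sum fun z _ => hle z

/-- For large `s`, the interpolation constraints are beaten by the score of `c`. -/
theorem eventually_score {Pi : Fin n → F → ℝ} (hPi : ∀ j a, 0 ≤ Pi j a) (c : Fin n → F) (w : ℕ)
    (h : (w : ℝ) * ∑ z : Fin n × F, Pi z.1 z.2 ^ 2 < (∑ j, Pi j (c j)) ^ 2) :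
    ∀ᶠ s in atTop, 0 < ∑ j, kvMultiplicity Pi s (j, c j) ∧
      w * ∑ z, kvMultiplicity Pi s z * (kvMultiplicity Pi s z + 1) <
        (∑ j, kvMultiplicity Pi s (j, c j)) ^ 2 := by
  set A := ∑ j, Pi j (c j) with hA
  set B := ∑ z : Fin n × F, Pi z.1 z.2 ^ 2 with hB
  set T := ∑ z : Fin n × F, Pi z.1 z.2 with hT
  have hA0 : 0 ≤ A := Finset.sum_nonneg fun j _ => hPi _ _
  have hB0 : 0 ≤ B := Finset.sum_nonneg fun j _ => sq_nonneg _
  have hT0 : 0 ≤ T := Finset.sum_nonneg fun j _ => hPi _ _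
  have hApos : 0 < A := by
    rcases hA0.lt_or_eq with h' | h'
    · exact h'
    · rw [← h'] at h
      have : (0 : ℝ) ≤ w * B := by positivity
      norm_num at h; linarith
  have h0 : ∃ j a, 0 < Pi j a := by
    obtain ⟨j, -, hj⟩ := Finset.exists_lt_of_sum_lt
      (s := Finset.univ) (f := fun _ : Fin n => (0 : ℝ)) (g := fun j => Pi j (c j)) (by simpa)
    exact ⟨j, _, hj⟩
  set Δ := A ^ 2 - w * B with hΔ
  have hΔ0 : 0 < Δ := by rw [hΔ]; linarith
  -- Rounding costs at most `n` in the score and `r * T` in the cost. The first summand ensures `(r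
  -- * A - n)² > w * (r² * B + r * T)`, the second ensures `r * A > n + 1`, so that the lower bound
  -- for the score may be squared.
  set r₀ := (2 * n * A + w * T) / Δ + (n + 1) / A with hr₀
  have hev : ∀ᶠ s : ℕ in atTop, T * r₀ < s :=
    tendsto_natCast_atTop_atTop.eventually_gt_atTop _
  filter_upwards [hev] with s hs
  obtain ⟨r, hr, h1, h2, h3⟩ := exists_scale_kvMultiplicity hPi h0 s
  have hTpos : 0 < T := by
    rcases hT0.lt_or_eq with h' | h'
    · exact h'
    · rw [← hT, ← h'] at h3
      rw [← h'] at hs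
      linarith
  have hrr : r₀ < r := by
    have : T * r₀ < T * r := by rw [← hT] at h3; linarith
    exact lt_of_mul_lt_mul_left this hT0
  have hq1 : 0 ≤ (2 * n * A + w * T) / Δ := by positivity
  have hq2 : 0 ≤ (n + 1) / A := by positivity
  have hr1 : (2 * n * A + w * T) < r * Δ := by
    rw [← div_lt_iff₀ hΔ0]; linarith
  have hr2 : (n + 1 : ℝ) < r * A := by
    rw [← div_lt_iff₀ hApos]; linarith
  set S := ∑ j, kvMultiplicity Pi s (j, c j) with hS
  have hSge : r * A - n ≤ (S : ℝ) := by
    have : r * A ≤ ∑ j : Fin n, ((kvMultiplicity Pi s (j, c j) : ℝ) + 1) := by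
      rw [hA, Finset.mul_sum]
      exact Finset.sum_le_sum fun j _ => h2 (j, c j)
    rw [Finset.sum_add_distrib] at this
    simp at this
    rw [hS]; push_cast; linarith
  refine ⟨?_, ?_⟩
  · have : (0 : ℝ) < S := by linarith
    exact_mod_cast this
  · have hC : (∑ z, (kvMultiplicity Pi s z : ℝ) * (kvMultiplicity Pi s z + 1)) ≤
        r ^ 2 * B + r * T := by
      rw [hB, hT, Finset.mul_sum, Finset.mul_sum, ← Finset.sum_add_distrib]
      refine Finset.sum_le_sum fun z _ => ?_
      have ha := h1 z
      have hb := hPi z.1 z.2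
      have hc : (0 : ℝ) ≤ kvMultiplicity Pi s z := by positivity
      nlinarith
    have hfin : (w : ℝ) * ∑ z, (kvMultiplicity Pi s z : ℝ) * (kvMultiplicity Pi s z + 1) <
        (S : ℝ) ^ 2 := by
      have e1 : (w : ℝ) * ∑ z, (kvMultiplicity Pi s z : ℝ) * (kvMultiplicity Pi s z + 1) ≤
          w * (r ^ 2 * B + r * T) := mul_le_mul_of_nonneg_left hC (by positivity)
      have e2 : (r * A - n) ^ 2 ≤ (S : ℝ) ^ 2 := pow_le_pow_left₀ (by linarith) hSge 2
      have e3 : r * (2 * n * A + w * T) < r * (r * Δ) := mul_lt_mul_of_pos_left hr1 hr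
      rw [hΔ] at e3
      nlinarith [sq_nonneg (n : ℝ)]
    exact_mod_cast hfin

/-- A sufficient condition for the Koetter-Vardy decoder to return `c`, for all large values of its
parameter. -/
theorem eventually_kvDecode [Field F] {Pi : Fin n → F → ℝ} (hPi : ∀ j a, 0 ≤ Pi j a) {pts : Fin n ↪ F}
    {k : ℕ} {c : Fin n → F} (hc : c ∈ rsCode pts k)
    (h : ((k - 1 : ℕ) : ℝ) * ∑ z : Fin n × F, Pi z.1 z.2 ^ 2 < (∑ j, Pi j (c j)) ^ 2)
    (hmax : ∀ c' ∈ rsCode pts k, c' ≠ c → likelihood Pi c' < likelihood Pi c) :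
    ∀ᶠ s in atTop, kvDecode pts k s Pi = some c := by
  filter_upwards [eventually_score hPi c (k - 1) h] with s hs
  obtain ⟨f, hf, rfl⟩ := hc
  have heval : ∀ j, evalAt pts f j = f.eval (pts j) := fun j => rfl
  have hmem : evalAt pts f ∈ kvList pts k s Pi := by
    refine ⟨f, hf, rfl, dvd_kvPolynomial hf ?_⟩
    have := exists_isInterpolating_weightedDegree_lt pts (kvMultiplicity Pi s) hs.1 hs.2
    simpa only [heval] using this
  have hsub : ∀ c' ∈ kvList pts k s Pi, c' ∈ rsCode pts k := by
    rintro c' ⟨g, hg, rfl, -⟩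
    exact ⟨g, hg, rfl⟩
  have hex : ∃ c ∈ kvList pts k s Pi, ∀ c' ∈ kvList pts k s Pi,
      likelihood Pi c' ≤ likelihood Pi c := by
    refine ⟨_, hmem, fun c' hc' => ?_⟩
    by_cases hcc : c' = evalAt pts f
    · rw [hcc]
    · exact (hmax c' (hsub c' hc') hcc).le
  rw [kvDecode, dif_pos hex]
  have hspec := hex.choose_spec
  -- `c` is strictly more likely than every other codeword, so the arbitrary choice of a most likely
  -- word of the list can only be `c`.
  by_contra hne
  have := hmax _ (hsub _ hspec.1) fun hcc => hne (congrArg some hcc)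
  exact absurd (hspec.2 _ hmem) (not_le.2 this)

end Multiplicity

/-! ### The two decoding steps acting on pairs (a posteriori probability, estimator). -/

section Estimators

variable {F : Type} [Fintype F]

/-- The set of symbols which are candidates for both of two estimators. -/
def agree (g₁ g₂ : F → ℝ) : Set F := {b | 0 < g₁ b ∧ 0 < g₂ b}

open Classical in
/-- The combination of two estimators of the same symbol: a common candidate is believed if it is
unique; without a common candidate, the two estimators are mixed. -/
noncomputable def mix (g₁ g₂ : F → ℝ) (a : F) : ℝ :=
  if agree g₁ g₂ = ∅ then
    -- If two lists contain the symbol independently, with probabilities equal to their total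
    -- weights, this is its conditional law given that the lists do not both contain it.
    (g₁ a * (1 - ∑ b, g₂ b) + g₂ a * (1 - ∑ b, g₁ b)) / (1 - (∑ b, g₁ b) * ∑ b, g₂ b)
  else if agree g₁ g₂ = {a} then 1 else 0

/-- Translations and dilations of `F` are both bijections of the alphabet, so this one equivariance
serves for calibration and for dilation invariance. -/
theorem mix_comp (σ : F ≃ F) (g₁ g₂ : F → ℝ) (a : F) :
    mix (fun b => g₁ (σ b)) (fun b => g₂ (σ b)) a = mix g₁ g₂ (σ a) := by
  have h1 : agree (fun b => g₁ (σ b)) (fun b => g₂ (σ b)) = σ ⁻¹' agree g₁ g₂ := rfl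
  have h2 : σ ⁻¹' agree g₁ g₂ = ∅ ↔ agree g₁ g₂ = ∅ := by
    simpa using Set.preimage_eq_preimage (s := agree g₁ g₂) (t := ∅) σ.surjective
  have h3 : σ ⁻¹' agree g₁ g₂ = {a} ↔ agree g₁ g₂ = {σ a} := by
    have : σ ⁻¹' {σ a} = {a} := by ext; simp
    rw [← this, Set.preimage_eq_preimage σ.surjective]
  simp only [mix, h1, h2, h3, Equiv.sum_comp σ g₁, Equiv.sum_comp σ g₂]

theorem mix_nonneg {g₁ g₂ : F → ℝ} (h₁ : ∀ a, 0 ≤ g₁ a) (h₂ : ∀ a, 0 ≤ g₂ a)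
    (hs₁ : ∑ a, g₁ a ≤ 1) (hs₂ : ∑ a, g₂ a ≤ 1) (a : F) : 0 ≤ mix g₁ g₂ a := by
  have e1 : 0 ≤ ∑ a, g₁ a := Finset.sum_nonneg fun a _ => h₁ a
  have e2 : 0 ≤ ∑ a, g₂ a := Finset.sum_nonneg fun a _ => h₂ a
  rw [mix]
  split_ifs
  · refine div_nonneg (add_nonneg (mul_nonneg (h₁ a) (by linarith))
      (mul_nonneg (h₂ a) (by linarith))) ?_
    nlinarith
  · exact zero_le_one
  · exact le_rfl

theorem sum_mix_of_agree_eq_empty {g₁ g₂ : F → ℝ} (h : agree g₁ g₂ = ∅) :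
    ∑ a, mix g₁ g₂ a = ((∑ a, g₁ a) + (∑ a, g₂ a) - 2 * (∑ a, g₁ a) * ∑ a, g₂ a) /
      (1 - (∑ a, g₁ a) * ∑ a, g₂ a) := by
  simp only [mix, if_pos h]
  rw [← Finset.sum_div, Finset.sum_add_distrib, ← Finset.sum_mul, ← Finset.sum_mul]
  congr 1
  ring

theorem sum_mix_le {g₁ g₂ : F → ℝ} (h₁ : ∀ a, 0 ≤ g₁ a) (h₂ : ∀ a, 0 ≤ g₂ a)
    (hs₁ : ∑ a, g₁ a ≤ 1) (hs₂ : ∑ a, g₂ a ≤ 1) : ∑ a, mix g₁ g₂ a ≤ 1 := by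
  classical
  have e1 : 0 ≤ ∑ a, g₁ a := Finset.sum_nonneg fun a _ => h₁ a
  have e2 : 0 ≤ ∑ a, g₂ a := Finset.sum_nonneg fun a _ => h₂ a
  by_cases h : agree g₁ g₂ = ∅
  · rw [sum_mix_of_agree_eq_empty h]
    refine div_le_one_of_le₀ ?_ ?_ <;> nlinarith
  · by_cases h' : ∃ b, agree g₁ g₂ = {b}
    · obtain ⟨b, hb⟩ := h'
      simp [mix, hb]
    · simp only [mix, if_neg h]
      rw [Finset.sum_eq_zero]
      · exact zero_le_one
      · intro b _
        rw [if_neg fun hb => h' ⟨b, hb⟩]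

/-- The effect of the `U`-step on pairs (a posteriori probability, estimator). -/
noncomputable def opU (x₁ x₂ : F → ℝ × ℝ) : F → ℝ × ℝ := fun a =>
  ((x₁ a).1 * (x₂ a).1 / ∑ b, (x₁ b).1 * (x₂ b).1,
    mix (fun b => (x₁ b).2) (fun b => (x₂ b).2) a)

theorem opU_comp (σ : F ≃ F) (x₁ x₂ : F → ℝ × ℝ) :
    opU (fun a => x₁ (σ a)) (fun a => x₂ (σ a)) = fun a => opU x₁ x₂ (σ a) := by
  funext a
  simp only [opU]
  rw [Equiv.sum_comp σ fun b => (x₁ b).1 * (x₂ b).1,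
    mix_comp σ (fun b => (x₁ b).2) fun b => (x₂ b).2]

/-- The convention for division by zero is harmless here: if the normaliser, a sum of nonnegative
products, vanishes, then so does each product. -/
theorem opU_fst_mul (x₁ x₂ : F → ℝ × ℝ) (h₁ : ∀ a, 0 ≤ (x₁ a).1) (h₂ : ∀ a, 0 ≤ (x₂ a).1) (c : F) :
    (∑ b, (x₁ b).1 * (x₂ b).1) * (opU x₁ x₂ c).1 = (x₁ c).1 * (x₂ c).1 := by
  by_cases h : ∑ b, (x₁ b).1 * (x₂ b).1 = 0
  · rw [h, zero_mul]
    exact ((Finset.sum_eq_zero_iff_of_nonneg fun b _ => mul_nonneg (h₁ b) (h₂ b)).1 h c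
      (Finset.mem_univ c)).symm
  · simp only [opU]
    rw [mul_div_cancel₀ _ h]

end Estimators

section Operations

variable {F : Type} [Field F]

/-- The translate of a vector indexed by `F`. -/
def sh (b : F) (x : F → ℝ × ℝ) : F → ℝ × ℝ := fun a => x (a + b)

theorem sh_sh (b d : F) (x : F → ℝ × ℝ) : sh b (sh d x) = sh (b + d) x := by
  funext a; simp [sh, add_assoc]

variable [Fintype F]

/-- The effect of the `V`-step on pairs (a posteriori probability, estimator). -/
def opV (x₁ x₂ : F → ℝ × ℝ) : F → ℝ × ℝ := fun a =>
  (∑ b, (x₁ b).1 * (x₂ (a + b)).1, ∑ b, (x₁ b).2 * (x₂ (a + b)).2)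

theorem opV_sh (b₁ b₂ : F) (x₁ x₂ : F → ℝ × ℝ) :
    opV (sh b₁ x₁) (sh b₂ x₂) = sh (b₂ - b₁) (opV x₁ x₂) := by
  funext a
  simp only [opV, sh]
  congr 1
  · refine Fintype.sum_equiv (Equiv.addRight b₁) _ _ fun b => ?_
    simp only [Equiv.coe_addRight]
    congr 3; ring
  · refine Fintype.sum_equiv (Equiv.addRight b₁) _ _ fun b => ?_
    simp only [Equiv.coe_addRight]
    congr 3; ring

theorem opV_scale {γ : F} (hγ : γ ≠ 0) (x₁ x₂ : F → ℝ × ℝ) :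
    opV (fun a => x₁ (γ * a)) (fun a => x₂ (γ * a)) = fun a => opV x₁ x₂ (γ * a) := by
  funext a
  simp only [opV, mul_add]
  congr 1
  · exact Fintype.sum_equiv (Equiv.mulLeft₀ γ hγ) _ _ fun b => rfl
  · exact Fintype.sum_equiv (Equiv.mulLeft₀ γ hγ) _ _ fun b => rfl

theorem opU_sh (b : F) (x₁ x₂ : F → ℝ × ℝ) :
    opU (sh b x₁) (sh b x₂) = sh b (opU x₁ x₂) :=
  opU_comp (Equiv.addRight b) x₁ x₂

theorem sum_sum_corr (u v : F → ℝ) :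
    ∑ a, ∑ b, u b * v (a + b) = (∑ a, u a) * ∑ a, v a := by
  rw [Finset.sum_comm, Finset.sum_mul]
  refine Finset.sum_congr rfl fun b _ => ?_
  rw [← Finset.mul_sum, Equiv.sum_comp (Equiv.addRight b) v |>.symm]
  rfl

end Operations

/-! ### Calibrated, dilation-invariant channels and their `U` and `V` transforms. -/

/-- A channel with input alphabet `F`, described in the situation where `0` is sent: a finite
probability space, together with the vector of a posteriori probabilities of the symbols and the
vector given by an estimator. The law of the pair is invariant under dilations, and the a posteriori
probabilities are those of the position of the symbol sent. -/
structure Chan (F : Type) [Field F] [Fintype F] where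
  A : Type
  inst : Fintype A
  μ : A → ℝ
  vec : A → F → ℝ × ℝ
  μ_nonneg : ∀ ω, 0 ≤ μ ω
  sum_μ : ∑ ω, μ ω = 1
  fst_nonneg : ∀ ω a, 0 ≤ (vec ω a).1
  snd_nonneg : ∀ ω a, 0 ≤ (vec ω a).2
  sum_fst_le : ∀ ω, ∑ a, (vec ω a).1 ≤ 1
  sum_snd_le : ∀ ω, ∑ a, (vec ω a).2 ≤ 1
  calibrated : ∀ H : (F → ℝ × ℝ) → ℝ,
    ∑ ω, μ ω * H (vec ω) = ∑ ω, μ ω * ∑ b, (vec ω b).1 * H (sh b (vec ω))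
  dilation : ∀ (H : (F → ℝ × ℝ) → ℝ) (γ : F), γ ≠ 0 →
    ∑ ω, μ ω * H (vec ω) = ∑ ω, μ ω * H (fun a => vec ω (γ * a))

namespace Chan

variable {F : Type} [Field F] [Fintype F] (C : Chan F)

attribute [instance] Chan.inst

theorem sum_prod_eq (f : C.A × C.A → ℝ) :
    ∑ ω : C.A × C.A, C.μ ω.1 * C.μ ω.2 * f ω =
      ∑ ω₁, C.μ ω₁ * ∑ ω₂, C.μ ω₂ * f (ω₁, ω₂) := by
  rw [Fintype.sum_prod_type]
  simp only [Finset.mul_sum, mul_assoc]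

theorem sum_prod_μ : ∑ ω : C.A × C.A, C.μ ω.1 * C.μ ω.2 = 1 := by
  have := C.sum_prod_eq fun _ => 1
  simpa [C.sum_μ] using this

theorem sum_prod_comm (f : C.A → C.A → ℝ) :
    ∑ ω₁, C.μ ω₁ * ∑ ω₂, C.μ ω₂ * f ω₁ ω₂ = ∑ ω₂, C.μ ω₂ * ∑ ω₁, C.μ ω₁ * f ω₁ ω₂ := by
  simp only [Finset.mul_sum]
  rw [Finset.sum_comm]
  refine Finset.sum_congr rfl fun _ _ => Finset.sum_congr rfl fun _ _ => by ring

theorem calibrated_prod (G : (F → ℝ × ℝ) → (F → ℝ × ℝ) → ℝ) :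
    ∑ ω : C.A × C.A, C.μ ω.1 * C.μ ω.2 * G (C.vec ω.1) (C.vec ω.2) =
      ∑ ω : C.A × C.A, C.μ ω.1 * C.μ ω.2 * ∑ b₁, ∑ b₂, (C.vec ω.1 b₁).1 * (C.vec ω.2 b₂).1 *
        G (sh b₁ (C.vec ω.1)) (sh b₂ (C.vec ω.2)) := by
  rw [C.sum_prod_eq fun ω => G (C.vec ω.1) (C.vec ω.2), C.sum_prod_eq]
  have h1 : ∀ ω₁, ∑ ω₂, C.μ ω₂ * G (C.vec ω₁) (C.vec ω₂) =
      ∑ ω₂, C.μ ω₂ * ∑ b₂, (C.vec ω₂ b₂).1 * G (C.vec ω₁) (sh b₂ (C.vec ω₂)) :=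
    fun ω₁ => C.calibrated fun y => G (C.vec ω₁) y
  simp only [h1]
  rw [C.sum_prod_comm]
  have h2 : ∀ ω₂, ∑ ω₁, C.μ ω₁ * ∑ b₂, (C.vec ω₂ b₂).1 * G (C.vec ω₁) (sh b₂ (C.vec ω₂)) =
      ∑ ω₁, C.μ ω₁ * ∑ b₁, (C.vec ω₁ b₁).1 *
        ∑ b₂, (C.vec ω₂ b₂).1 * G (sh b₁ (C.vec ω₁)) (sh b₂ (C.vec ω₂)) :=
    fun ω₂ => C.calibrated fun y => ∑ b₂, (C.vec ω₂ b₂).1 * G y (sh b₂ (C.vec ω₂))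
  simp only [h2]
  rw [C.sum_prod_comm]
  simp only [Finset.mul_sum, mul_assoc]

theorem dilation_prod (G : (F → ℝ × ℝ) → (F → ℝ × ℝ) → ℝ) {γ : F} (hγ : γ ≠ 0) :
    ∑ ω : C.A × C.A, C.μ ω.1 * C.μ ω.2 * G (C.vec ω.1) (C.vec ω.2) =
      ∑ ω : C.A × C.A, C.μ ω.1 * C.μ ω.2 *
        G (fun a => C.vec ω.1 (γ * a)) (fun a => C.vec ω.2 (γ * a)) := by
  rw [C.sum_prod_eq fun ω => G (C.vec ω.1) (C.vec ω.2), C.sum_prod_eq]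
  have h1 : ∀ ω₁, ∑ ω₂, C.μ ω₂ * G (C.vec ω₁) (C.vec ω₂) =
      ∑ ω₂, C.μ ω₂ * G (C.vec ω₁) (fun a => C.vec ω₂ (γ * a)) :=
    fun ω₁ => C.dilation (fun y => G (C.vec ω₁) y) γ hγ
  simp only [h1]
  rw [C.sum_prod_comm]
  have h2 : ∀ ω₂, ∑ ω₁, C.μ ω₁ * G (C.vec ω₁) (fun a => C.vec ω₂ (γ * a)) =
      ∑ ω₁, C.μ ω₁ * G (fun a => C.vec ω₁ (γ * a)) (fun a => C.vec ω₂ (γ * a)) :=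
    fun ω₂ => C.dilation (fun y => G y (fun a => C.vec ω₂ (γ * a))) γ hγ
  simp only [h2]
  rw [C.sum_prod_comm]

/-- The channel seen by the `V`-decoder. -/
def V : Chan F where
  A := C.A × C.A
  inst := inferInstance
  μ ω := C.μ ω.1 * C.μ ω.2
  vec ω := opV (C.vec ω.1) (C.vec ω.2)
  μ_nonneg ω := mul_nonneg (C.μ_nonneg _) (C.μ_nonneg _)
  sum_μ := C.sum_prod_μ
  fst_nonneg ω a := Finset.sum_nonneg fun b _ => mul_nonneg (C.fst_nonneg _ _) (C.fst_nonneg _ _)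
  snd_nonneg ω a := Finset.sum_nonneg fun b _ => mul_nonneg (C.snd_nonneg _ _) (C.snd_nonneg _ _)
  sum_fst_le ω := by
    simp only [opV]
    rw [sum_sum_corr (fun b => (C.vec ω.1 b).1) fun b => (C.vec ω.2 b).1]
    exact mul_le_one₀ (C.sum_fst_le _) (Finset.sum_nonneg fun b _ => C.fst_nonneg _ _)
      (C.sum_fst_le _)
  sum_snd_le ω := by
    simp only [opV]
    rw [sum_sum_corr (fun b => (C.vec ω.1 b).2) fun b => (C.vec ω.2 b).2]
    exact mul_le_one₀ (C.sum_snd_le _) (Finset.sum_nonneg fun b _ => C.snd_nonneg _ _)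
      (C.sum_snd_le _)
  calibrated H := by
    rw [C.calibrated_prod fun x y => H (opV x y)]
    refine Finset.sum_congr rfl fun ω _ => congrArg _ ?_
    simp only [opV_sh]
    simp only [opV, Finset.sum_mul]
    conv_rhs => rw [Finset.sum_comm]
    refine Finset.sum_congr rfl fun b₁ _ => ?_
    refine Fintype.sum_equiv (Equiv.subRight b₁) _ _ fun b₂ => ?_
    simp
  dilation H γ hγ := by
    rw [C.dilation_prod (fun x y => H (opV x y)) hγ]
    simp only [opV_scale hγ]

/-- Put `b₂ = b + d` with `b = b₁`. For fixed `d` the weights `(x₁ b).1 * (x₂ (b + d)).1` are the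
normaliser times the first component of `opU x₁ (sh d x₂)`, so averaging over `b` already is
averaging over the new a posteriori law. Averaging once more changes nothing, because the inner
average is invariant under translation. -/
theorem sum_sum_opU (x₁ x₂ : F → ℝ × ℝ) (h₁ : ∀ a, 0 ≤ (x₁ a).1) (h₂ : ∀ a, 0 ≤ (x₂ a).1)
    (H : (F → ℝ × ℝ) → ℝ) :
    ∑ b₁, ∑ b₂, (x₁ b₁).1 * (x₂ b₂).1 * H (opU (sh b₁ x₁) (sh b₂ x₂)) =
      ∑ b₁, ∑ b₂, (x₁ b₁).1 * (x₂ b₂).1 * ∑ c, (opU (sh b₁ x₁) (sh b₂ x₂) c).1 *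
        H (sh c (opU (sh b₁ x₁) (sh b₂ x₂))) := by
  have key : ∀ K : (F → ℝ × ℝ) → ℝ,
      ∑ b₁, ∑ b₂, (x₁ b₁).1 * (x₂ b₂).1 * K (opU (sh b₁ x₁) (sh b₂ x₂)) =
      ∑ d, ∑ b, (x₁ b).1 * (sh d x₂ b).1 * K (sh b (opU x₁ (sh d x₂))) := by
    intro K
    rw [Finset.sum_comm (γ := F) (f := fun d b =>
      (x₁ b).1 * (sh d x₂ b).1 * K (sh b (opU x₁ (sh d x₂))))]
    refine Finset.sum_congr rfl fun b _ => ?_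
    refine Fintype.sum_equiv (Equiv.subRight b) _ _ fun b₂ => ?_
    rw [← opU_sh, sh_sh]
    simp [sh]
  rw [key H, key fun y => ∑ c, (y c).1 * H (sh c y)]
  refine Finset.sum_congr rfl fun d _ => ?_
  have h3 : ∀ b, ∑ c, (sh b (opU x₁ (sh d x₂)) c).1 * H (sh c (sh b (opU x₁ (sh d x₂)))) =
      ∑ c, (opU x₁ (sh d x₂) c).1 * H (sh c (opU x₁ (sh d x₂))) := by
    intro b
    refine Fintype.sum_equiv (Equiv.addRight b) _ _ fun c => ?_
    rw [sh_sh]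
    rfl
  simp only [h3]
  rw [← Finset.sum_mul, Finset.mul_sum]
  refine Finset.sum_congr rfl fun c _ => ?_
  rw [← mul_assoc, opU_fst_mul x₁ (sh d x₂) h₁ fun a => h₂ _]

/-- The channel seen by the `U`-decoder. -/
noncomputable def U : Chan F where
  A := C.A × C.A
  inst := inferInstance
  μ ω := C.μ ω.1 * C.μ ω.2
  vec ω := opU (C.vec ω.1) (C.vec ω.2)
  μ_nonneg ω := mul_nonneg (C.μ_nonneg _) (C.μ_nonneg _)
  sum_μ := C.sum_prod_μ
  fst_nonneg ω a := div_nonneg (mul_nonneg (C.fst_nonneg _ _) (C.fst_nonneg _ _))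
    (Finset.sum_nonneg fun b _ => mul_nonneg (C.fst_nonneg _ _) (C.fst_nonneg _ _))
  snd_nonneg ω a := mix_nonneg (fun b => C.snd_nonneg _ _) (fun b => C.snd_nonneg _ _)
    (C.sum_snd_le _) (C.sum_snd_le _) a
  sum_fst_le ω := by
    simp only [opU]
    rw [← Finset.sum_div]
    -- The sum is `0` rather than `1` when the normaliser vanishes, which is why a channel is only
    -- required to satisfy an inequality.
    exact div_self_le_one _
  sum_snd_le ω := sum_mix_le (fun b => C.snd_nonneg _ _) (fun b => C.snd_nonneg _ _)
    (C.sum_snd_le _) (C.sum_snd_le _)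
  calibrated H := by
    rw [C.calibrated_prod fun x y => H (opU x y), C.calibrated_prod fun x y =>
      ∑ c, (opU x y c).1 * H (sh c (opU x y))]
    refine Finset.sum_congr rfl fun ω _ => congrArg _ ?_
    exact sum_sum_opU _ _ (C.fst_nonneg _) (C.fst_nonneg _) H
  dilation H γ hγ := by
    rw [C.dilation_prod (fun x y => H (opU x y)) hγ]
    have h : ∀ x y : F → ℝ × ℝ, opU (fun a => x (γ * a)) (fun a => y (γ * a)) =
        fun a => opU x y (γ * a) := opU_comp (Equiv.mulLeft₀ γ hγ)
    simp only [h]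

/-- The channel obtained by a step of the construction: `V` for the bit `1`, `U` for `0`. -/
noncomputable def step (b : Bool) : Chan F := if b then C.V else C.U

/-- The channel obtained by successive steps of the construction. -/
noncomputable def steps (l : List Bool) : Chan F := l.foldl step C

end Chan

/-! ### The `q`-ary symmetric channel as a calibrated channel. -/

section Symmetric

variable {F : Type} [Field F] [Fintype F]

open Classical in
/-- The law of the noise of the `q`-ary symmetric channel. -/
noncomputable def noise (p : ℝ) (z : F) : ℝ :=
  if z = 0 then 1 - p else p / ((Fintype.card F : ℝ) - 1)

theorem sum_noise (p : ℝ) : ∑ z : F, noise p z = 1 := by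
  classical
  have hq : (1 : ℝ) < Fintype.card F := by exact_mod_cast Fintype.one_lt_card
  rw [← Finset.add_sum_erase _ _ (Finset.mem_univ (0 : F)),
    Finset.sum_congr rfl (g := fun _ => p / ((Fintype.card F : ℝ) - 1))]
  · rw [Finset.sum_const, Finset.card_erase_of_mem (Finset.mem_univ _), Finset.card_univ,
      nsmul_eq_mul, Nat.cast_sub Fintype.card_pos, noise, if_pos rfl]
    have : (Fintype.card F : ℝ) - 1 ≠ 0 := by linarith
    push_cast
    field_simp
    ring
  · intro z hz
    rw [noise, if_neg (Finset.ne_of_mem_erase hz)]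

theorem noise_nonneg {p : ℝ} (hp : p ∈ Set.Icc (0 : ℝ) 1) (z : F) : 0 ≤ noise p z := by
  have hq : (1 : ℝ) < Fintype.card F := by exact_mod_cast Fintype.one_lt_card
  rw [noise]
  split_ifs
  · linarith [hp.2]
  · exact div_nonneg hp.1 (by linarith)

theorem noise_mul {γ : F} (hγ : γ ≠ 0) (p : ℝ) (z : F) : noise p (γ * z) = noise p z := by
  by_cases hz : z = 0 <;> simp [noise, hz, hγ]

open Classical in
/-- The `q`-ary symmetric channel, with the estimator whose only candidate is the received
symbol. -/
noncomputable def symChan (F : Type) [Field F] [Fintype F] (p : ℝ) (hp : p ∈ Set.Icc (0 : ℝ) 1) :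
    Chan F where
  A := F
  inst := inferInstance
  μ := noise p
  vec y a := (noise p (y - a), if y - a = 0 then 1 - p else 0)
  μ_nonneg := noise_nonneg hp
  sum_μ := sum_noise p
  fst_nonneg y a := noise_nonneg hp _
  snd_nonneg y a := by
    have := hp.2
    dsimp only
    split_ifs <;> linarith
  sum_fst_le y := by
    exact ((Equiv.sum_comp (Equiv.subLeft y) (noise p)).trans (sum_noise p)).le
  sum_snd_le y := by
    simp only [sub_eq_zero]
    simp [hp.1]
  calibrated H := by
    simp only [Finset.mul_sum]
    rw [Finset.sum_comm]
    have h : ∀ b : F, ∑ y, noise p y * (noise p (y - b) * H (sh b fun a =>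
        (noise p (y - a), if y - a = 0 then 1 - p else 0))) =
        ∑ y, noise p (y + b) * (noise p y * H fun a =>
        (noise p (y - a), if y - a = 0 then 1 - p else 0)) := by
      intro b
      refine Fintype.sum_equiv (Equiv.subRight b) _ _ fun y => ?_
      simp only [Equiv.subRight_apply, sub_add_cancel]
      congr 3
      funext a
      simp only [sh]
      rw [show y - (a + b) = y - b - a by ring]
    simp only [h]
    rw [Finset.sum_comm]
    refine Finset.sum_congr rfl fun y _ => ?_
    have h1 : ∑ b, noise p (y + b) = 1 :=
      (Equiv.sum_comp (Equiv.addLeft y) (noise p)).trans (sum_noise p)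
    rw [← Finset.sum_mul, h1, one_mul]
  dilation H γ hγ := by
    symm
    refine Fintype.sum_equiv (Equiv.mulLeft₀ γ⁻¹ (inv_ne_zero hγ)) _ _ fun y => ?_
    change _ = noise p (γ⁻¹ * y) * H fun a =>
      (noise p (γ⁻¹ * y - a), if γ⁻¹ * y - a = 0 then 1 - p else 0)
    rw [noise_mul (inv_ne_zero hγ)]
    congr 2
    funext a
    rw [show y - γ * a = γ * (γ⁻¹ * y - a) by field_simp, noise_mul hγ]
    simp only [mul_eq_zero, hγ, false_or]

end Symmetric

/-! ### From the recursive decoder to the leaf channels. -/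

section Reduction

variable {F : Type} [Field F] [Fintype F] {n : ℕ}

/-- The reliability matrix seen when the word `c` is sent over a channel and the noise is `e`. -/
def Chan.reliability (C : Chan F) {ι : Type} (c : ι → F) (e : ι → C.A) : ι → F → ℝ :=
  fun i a => (C.vec (e i) (a - c i)).1

open Classical in
/-- The probability of failure of the decoder of a node, when `c` is sent over the channel `C`. -/
noncomputable def nodeFail (pts : Fin n ↪ F) (k s : List Bool → ℕ) (d : ℕ) (x : List Bool)
    (C : Chan F) (c : BlockIdx n d → F) : ℝ :=
  ∑ e : BlockIdx n d → C.A,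
    if uvDecode pts k s d x (C.reliability c e) = some c then 0 else ∏ i, C.μ (e i)

open Classical in
/-- The probability of failure of the Koetter-Vardy decoder, when `c` is sent over the
channel `C`. -/
noncomputable def leafFail (pts : Fin n ↪ F) (k s : ℕ) (C : Chan F) (c : Fin n → F) : ℝ :=
  ∑ e : Fin n → C.A,
    if kvDecode pts k s (C.reliability c e) = some c then 0 else ∏ i, C.μ (e i)

theorem nodeFail_zero (pts : Fin n ↪ F) (k s : List Bool → ℕ) (x : List Bool)
    (C : Chan F) (c : BlockIdx n 0 → F) :
    nodeFail pts k s 0 x C c = leafFail pts (k x) (s x) C c := by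
  classical
  have key : (∑ e : BlockIdx n 0 → C.A,
      if uvDecode pts k s 0 x (C.reliability c e) = some c then 0 else ∏ i, C.μ (e i)) =
      ∑ e : Fin n → C.A, if kvDecode pts (k x) (s x) (C.reliability (ι := Fin n) c e) = some c
        then 0 else ∏ i, C.μ (e i) := by
    refine Fintype.sum_equiv (ι := BlockIdx n 0 → C.A) (κ := Fin n → C.A) (Equiv.refl _)
      _ _ fun e => ?_
    by_cases h : kvDecode pts (k x) (s x) (C.reliability (ι := Fin n) c e) = some c
    · exact (if_pos h).trans (if_pos h).symm
    · exact (if_neg h).trans (if_neg h).symm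
  unfold nodeFail leafFail
  convert key
  exact Iff.rfl

theorem reliabilityV_reliability (C : Chan F) {ι : Type} (u v : ι → F) (e : ι ⊕ ι → C.A) :
    reliabilityV (C.reliability (Sum.elim u (u + v)) e) =
      C.V.reliability v fun i => (e (Sum.inl i), e (Sum.inr i)) := by
  funext i a
  simp only [reliabilityV, Chan.reliability, Chan.V, opV, Sum.elim_inl, Sum.elim_inr, Pi.add_apply]
  refine Fintype.sum_equiv (Equiv.subRight (u i)) _ _ fun b => ?_
  simp only [Equiv.subRight_apply]
  congr 3
  ring

theorem reliabilityU_reliability (C : Chan F) {ι : Type} (u v : ι → F) (e : ι ⊕ ι → C.A) :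
    reliabilityU (C.reliability (Sum.elim u (u + v)) e) v =
      C.U.reliability u fun i => (e (Sum.inl i), e (Sum.inr i)) := by
  funext i a
  have h : ∀ b, b + v i - (u i + v i) = b - u i := fun b => by ring
  simp only [reliabilityU, Chan.reliability, Chan.U, opU, Sum.elim_inl, Sum.elim_inr,
    Pi.add_apply, h]
  congr 1
  exact Fintype.sum_equiv (Equiv.subRight (u i)) _ _ fun b => rfl

/-- Pairing of the two halves of a word. -/
def pairHalves (ι A : Type) : (ι ⊕ ι → A) ≃ (ι → A × A) where
  toFun e i := (e (Sum.inl i), e (Sum.inr i))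
  invFun e := Sum.elim (fun i => (e i).1) fun i => (e i).2
  left_inv e := by funext i; cases i <;> rfl
  right_inv e := rfl

theorem sum_pairHalves (n d : ℕ) (A : Type) [Fintype A] [DecidableEq (BlockIdx n d)]
    [DecidableEq (BlockIdx n (d + 1))] (f : (BlockIdx n d → A × A) → ℝ) :
    ∑ e : BlockIdx n (d + 1) → A, f (pairHalves (BlockIdx n d) A e) = ∑ e, f e :=
  Equiv.sum_comp (ι := BlockIdx n (d + 1) → A) (pairHalves (BlockIdx n d) A) f

theorem uvDecode_succ (pts : Fin n ↪ F) (k s : List Bool → ℕ) (d : ℕ) (x : List Bool)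
    (C : Chan F) (u v : BlockIdx n d → F) (e : BlockIdx n d ⊕ BlockIdx n d → C.A)
    (hV : uvDecode pts k s d (x ++ [true])
      (C.V.reliability v (pairHalves (BlockIdx n d) C.A e)) = some v)
    (hU : uvDecode pts k s d (x ++ [false])
      (C.U.reliability u (pairHalves (BlockIdx n d) C.A e)) = some u) :
    uvDecode pts k s (d + 1) x (C.reliability (Sum.elim u (u + v)) e) =
      some (Sum.elim u (u + v)) := by
  have e1 : reliabilityV (C.reliability (Sum.elim u (u + v)) e) =
    C.V.reliability v (pairHalves (BlockIdx n d) C.A e) := reliabilityV_reliability C u v e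
  have e2 : reliabilityU (C.reliability (Sum.elim u (u + v)) e) v =
    C.U.reliability u (pairHalves (BlockIdx n d) C.A e) := reliabilityU_reliability C u v e
  exact Option.bind_eq_some_iff.2 ⟨v, (congrArg _ e1).trans hV,
    Option.map_eq_some_iff.2 ⟨u, (congrArg _ e2).trans hU, rfl⟩⟩

/-- Union bound. If `v` is decoded correctly, the `U`-decoder receives exactly the reliabilities of
the channel `C.U`. Hence a failure of the node is a failure of the `V`-decoder or a failure of the
`U`-decoder supplied with the true `v`. -/
theorem nodeFail_succ_le (pts : Fin n ↪ F) (k s : List Bool → ℕ) (d : ℕ) (x : List Bool)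
    (C : Chan F) (u v : BlockIdx n d → F) :
    nodeFail pts k s (d + 1) x C (Sum.elim u (u + v)) ≤
      nodeFail pts k s d (x ++ [true]) C.V v + nodeFail pts k s d (x ++ [false]) C.U u := by
  classical
  let fV : (BlockIdx n d → C.A × C.A) → ℝ := fun e =>
    if uvDecode pts k s d (x ++ [true]) (C.V.reliability v e) = some v then 0
    else ∏ i, C.V.μ (e i)
  let fU : (BlockIdx n d → C.A × C.A) → ℝ := fun e =>
    if uvDecode pts k s d (x ++ [false]) (C.U.reliability u e) = some u then 0
    else ∏ i, C.U.μ (e i)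
  have h1 : nodeFail pts k s d (x ++ [true]) C.V v = ∑ e, fV e := rfl
  have h2 : nodeFail pts k s d (x ++ [false]) C.U u = ∑ e, fU e := rfl
  rw [h1, h2, ← Finset.sum_add_distrib, ← sum_pairHalves n d C.A fun e => fV e + fU e]
  refine Finset.sum_le_sum fun e _ => ?_
  have hprod : ∏ i, C.μ (e i) =
      ∏ i : BlockIdx n d, C.μ (e (Sum.inl i)) * C.μ (e (Sum.inr i)) := by
    rw [Finset.prod_mul_distrib]
    exact Fintype.prod_sum_type fun i : BlockIdx n d ⊕ BlockIdx n d => C.μ (e i)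
  have hnn : 0 ≤ ∏ i : BlockIdx n d, C.μ (e (Sum.inl i)) * C.μ (e (Sum.inr i)) :=
    Finset.prod_nonneg fun i _ => mul_nonneg (C.μ_nonneg _) (C.μ_nonneg _)
  have hV0 : 0 ≤ fV (pairHalves (BlockIdx n d) C.A e) := by
    simp only [fV]; split_ifs
    · exact le_rfl
    · exact hnn
  have hU0 : 0 ≤ fU (pairHalves (BlockIdx n d) C.A e) := by
    simp only [fU]; split_ifs
    · exact le_rfl
    · exact hnn
  rw [hprod]
  by_cases hV : uvDecode pts k s d (x ++ [true])
      (C.V.reliability v (pairHalves (BlockIdx n d) C.A e)) = some v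
  · by_cases hU : uvDecode pts k s d (x ++ [false])
        (C.U.reliability u (pairHalves (BlockIdx n d) C.A e)) = some u
    · exact (if_pos (uvDecode_succ pts k s d x C u v e hV hU)).trans_le (add_nonneg hV0 hU0)
    · refine le_add_of_nonneg_of_le hV0 ?_
      simp only [fU, if_neg hU]
      split_ifs
      · exact hnn
      · exact le_rfl
  · refine le_add_of_le_of_nonneg ?_ hU0
    simp only [fV, if_neg hV]
    split_ifs
    · exact hnn
    · exact le_rfl

/-- There are `2 ^ d` leaves, and the bits leading from the node to a leaf are the steps applied to
the channel on the way. -/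
theorem nodeFail_le (pts : Fin n ↪ F) (k s : List Bool → ℕ) {ε : ℝ} (d : ℕ) :
    ∀ (x : List Bool) (C : Chan F),
    (∀ l : List Bool, l.length = d → ∀ c ∈ rsCode pts (k (x ++ l)),
      leafFail pts (k (x ++ l)) (s (x ++ l)) (C.steps l) c ≤ ε) →
    ∀ c ∈ iteratedUV (fun x => rsCode pts (k x)) d x, nodeFail pts k s d x C c ≤ 2 ^ d * ε := by
  induction d with
  | zero =>
    intro x C h c hc
    have := h [] rfl c (by rw [List.append_nil]; exact hc)
    simpa [nodeFail_zero, Chan.steps] using this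
  | succ d ih =>
    intro x C h c hc
    obtain ⟨⟨u, v⟩, ⟨hu, hv⟩, rfl⟩ := hc
    have key : ∀ b : Bool, ∀ w ∈ iteratedUV (fun x => rsCode pts (k x)) d (x ++ [b]),
        nodeFail pts k s d (x ++ [b]) (C.step b) w ≤ 2 ^ d * ε := by
      intro b w hw
      refine ih (x ++ [b]) (C.step b) (fun l hl c hc => ?_) w hw
      have := h (b :: l) (by simp [hl]) c (by simpa using hc)
      simpa [Chan.steps] using this
    have h1 := key true v hv
    have h2 := key false u hu
    refine (nodeFail_succ_le pts k s d x C u v).trans ?_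
    have e1 : C.step true = C.V := rfl
    have e2 : C.step false = C.U := rfl
    rw [e1] at h1
    rw [e2] at h2
    rw [pow_succ]
    linarith

theorem qSC_eq_noise (p : ℝ) (x y : F) : qSC p x y = noise p (y - x) := by
  by_cases h : y = x <;> simp [qSC, noise, sub_eq_zero, h]

/-- The received word is replaced by the noise `y - c`. The normaliser of the a posteriori
probabilities equals `1`, being a sum of `noise` over the whole alphabet. -/
theorem errorProbOf_eq {p : ℝ} (hp : p ∈ Set.Icc (0 : ℝ) 1) (pts : Fin n ↪ F)
    (k s : List Bool → ℕ) (l : ℕ) (c : BlockIdx n l → F) :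
    errorProbOf p pts k s l c = nodeFail pts k s l [] (symChan F p hp) c := by
  classical
  unfold errorProbOf nodeFail
  refine Fintype.sum_equiv (Equiv.subRight c) _ _ fun y => ?_
  have h1 : channelReliability p y = (symChan F p hp).reliability c (Equiv.subRight c y) := by
    funext i a
    simp only [channelReliability, qSC_eq_noise]
    have : ∑ b, noise p (y i - b) = 1 :=
      (Equiv.sum_comp (Equiv.subLeft (y i)) (noise p)).trans (sum_noise p)
    rw [this, div_one]
    change _ = noise p (y i - c i - (a - c i))
    congr 1
    ring
  rw [h1]
  simp only [qSC_eq_noise]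
  rfl

theorem errorProb_nonneg {p : ℝ} (hp : p ∈ Set.Icc (0 : ℝ) 1) (pts : Fin n ↪ F)
    (k s : List Bool → ℕ) (l : ℕ) : 0 ≤ errorProb p pts k s l := by
  classical
  refine Real.iSup_nonneg fun c => Finset.sum_nonneg fun y _ => ?_
  split_ifs
  · exact le_rfl
  · refine Finset.prod_nonneg fun i _ => ?_
    rw [qSC_eq_noise]
    exact noise_nonneg hp _

/-- The probability of error of the iterated code is controlled by that of its leaves. -/
theorem errorProb_le {p : ℝ} (hp : p ∈ Set.Icc (0 : ℝ) 1) (pts : Fin n ↪ F)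
    (k s : List Bool → ℕ) (d : ℕ) {ε : ℝ}
    (h : ∀ l : List Bool, l.length = d → ∀ c ∈ rsCode pts (k l),
      leafFail pts (k l) (s l) ((symChan F p hp).steps l) c ≤ ε) :
    errorProb p pts k s d ≤ 2 ^ d * ε := by
  refine ciSup_le fun c => ?_
  rw [errorProbOf_eq hp]
  exact nodeFail_le pts k s d [] _ (by simpa using h) c c.2

end Reduction

/-! ### Dimension and rate of the iterated code. -/

section Rate

variable {F : Type} [Field F] {n : ℕ}

theorem uvMap_injective (ι : Type) : Function.Injective (uvMap (F := F) ι) := by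
  rintro ⟨u, v⟩ ⟨u', v'⟩ h
  have h1 : u = u' := funext fun i => congrFun h (Sum.inl i)
  have h2 : u + v = u' + v' := funext fun i => congrFun h (Sum.inr i)
  subst h1
  rw [add_left_cancel h2]

theorem finrank_uvCode {ι : Type} [Finite ι] (U V : Submodule F (ι → F)) :
    Module.finrank F (uvCode U V) = Module.finrank F U + Module.finrank F V := by
  have h1 : uvCode U V = LinearMap.range ((uvMap ι).comp (U.subtype.prodMap V.subtype)) := by
    rw [LinearMap.range_comp, LinearMap.range_prodMap, Submodule.range_subtype,
      Submodule.range_subtype, uvCode]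
  rw [h1, LinearMap.finrank_range_of_inj, Module.finrank_prod]
  rw [LinearMap.coe_comp]
  exact (uvMap_injective ι).comp
    (Prod.map_injective.2 ⟨U.injective_subtype, V.injective_subtype⟩)

theorem evalAt_injOn (pts : Fin n ↪ F) {k : ℕ} (hk : k ≤ n) {f : Polynomial F}
    (hf : f ∈ Polynomial.degreeLT F k) (h : evalAt pts f = 0) : f = 0 := by
  refine Polynomial.eq_zero_of_degree_lt_of_eval_finset_eq_zero (Finset.univ.map pts) ?_ ?_
  · rw [Polynomial.mem_degreeLT] at hf
    simp only [Finset.card_map, Finset.card_univ, Fintype.card_fin]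
    exact hf.trans_le (by exact_mod_cast hk)
  · intro x hx
    obtain ⟨j, -, rfl⟩ := Finset.mem_map.1 hx
    exact congrFun h j

theorem finrank_rsCode (pts : Fin n ↪ F) {k : ℕ} (hk : k ≤ n) :
    Module.finrank F (rsCode pts k) = k := by
  rw [rsCode, ← LinearMap.range_domRestrict, LinearMap.finrank_range_of_inj,
    (Polynomial.degreeLTEquiv F k).finrank_eq, Module.finrank_fin_fun]
  rw [← LinearMap.ker_eq_bot, LinearMap.ker_eq_bot']
  rintro ⟨f, hf⟩ h
  exact Subtype.ext (evalAt_injOn pts hk hf h)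

/-- The sum of a function over the leaves below a node of the binary tree. -/
def leafSum (f : List Bool → ℝ) : ℕ → List Bool → ℝ
  | 0, x => f x
  | d + 1, x => leafSum f d (x ++ [false]) + leafSum f d (x ++ [true])

theorem leafSum_le {f g : List Bool → ℝ} (d : ℕ) : ∀ x : List Bool,
    (∀ l : List Bool, l.length = d → f (x ++ l) ≤ g (x ++ l)) → leafSum f d x ≤ leafSum g d x := by
  induction d with
  | zero => intro x h; simpa [leafSum] using h [] rfl
  | succ d ih =>
    intro x h
    refine add_le_add (ih _ fun l hl => ?_) (ih _ fun l hl => ?_)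
    · simpa using h (false :: l) (by simp [hl])
    · simpa using h (true :: l) (by simp [hl])

theorem leafSum_mul_sub (f : List Bool → ℝ) (a b : ℝ) (d : ℕ) : ∀ x : List Bool,
    leafSum (fun l => f l * a - b) d x = leafSum f d x * a - 2 ^ d * b := by
  induction d with
  | zero => intro x; simp [leafSum]
  | succ d ih => intro x; simp only [leafSum, ih, pow_succ]; ring

theorem finrank_iteratedUV (pts : Fin n ↪ F) (k : List Bool → ℕ) (d : ℕ) :
    ∀ x : List Bool, (∀ l : List Bool, l.length = d → k (x ++ l) ≤ n) →
    (Module.finrank F (iteratedUV (fun x => rsCode pts (k x)) d x) : ℝ) =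
      leafSum (fun x => (k x : ℝ)) d x := by
  induction d with
  | zero =>
    intro x h
    have := finrank_rsCode pts (by simpa using h [] rfl : k x ≤ n)
    exact congrArg _ this
  | succ d ih =>
    intro x h
    have h1 := ih (x ++ [false]) fun l hl => by simpa using h (false :: l) (by simp [hl])
    have h2 := ih (x ++ [true]) fun l hl => by simpa using h (true :: l) (by simp [hl])
    rw [leafSum, ← h1, ← h2, ← Nat.cast_add]
    have : Finite (BlockIdx n d) := Finite.of_fintype _
    exact congrArg _ (finrank_uvCode _ _)

theorem rate_iteratedUV (pts : Fin n ↪ F) (k : List Bool → ℕ) (d : ℕ)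
    (h : ∀ l : List Bool, l.length = d → k l ≤ n) :
    rate (iteratedUV (fun x => rsCode pts (k x)) d []) =
      leafSum (fun x => (k x : ℝ)) d [] / (2 ^ d * n) := by
  rw [rate, finrank_iteratedUV pts k d [] (by simpa using h), card_blockIdx]
  push_cast
  rfl

end Rate

/-! ### Moments of sums of independent variables. -/

section ProductLaw

variable {A : Type} [Fintype A] {n : ℕ}

theorem sum_prod_apply (h : Fin n → A → ℝ) :
    ∑ e : Fin n → A, ∏ j, h j (e j) = ∏ j, ∑ ω, h j ω :=
  (Fintype.prod_sum h).symm

theorem sum_prod_mul_apply {μ : A → ℝ} (hμ : ∑ ω, μ ω = 1) (f : A → ℝ) (i : Fin n) :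
    ∑ e : Fin n → A, (∏ j, μ (e j)) * f (e i) = ∑ ω, μ ω * f ω := by
  have h := sum_prod_apply fun j ω => μ ω * if j = i then f ω else 1
  have h1 : ∀ e : Fin n → A, ∏ j, (μ (e j) * if j = i then f (e j) else 1) =
      (∏ j, μ (e j)) * f (e i) := by
    intro e
    rw [Finset.prod_mul_distrib]
    simp
  simp only [h1] at h
  rw [h, Finset.prod_eq_single i]
  · simp
  · intro j _ hj
    simp [hj, hμ]
  · simp

theorem sum_prod_mul_apply_mul_apply {μ : A → ℝ} (hμ : ∑ ω, μ ω = 1) (f : A → ℝ) {i i' : Fin n}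
    (hi : i ≠ i') :
    ∑ e : Fin n → A, (∏ j, μ (e j)) * (f (e i) * f (e i')) = (∑ ω, μ ω * f ω) ^ 2 := by
  have h := sum_prod_apply fun j ω =>
    μ ω * ((if j = i then f ω else 1) * if j = i' then f ω else 1)
  have h1 : ∀ e : Fin n → A, ∏ j, (μ (e j) * ((if j = i then f (e j) else 1) *
      if j = i' then f (e j) else 1)) = (∏ j, μ (e j)) * (f (e i) * f (e i')) := by
    intro e
    rw [Finset.prod_mul_distrib, Finset.prod_mul_distrib]
    simp
  simp only [h1] at h
  rw [h, ← Finset.mul_prod_erase _ _ (Finset.mem_univ i),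
    ← Finset.mul_prod_erase _ _ (Finset.mem_erase.2 ⟨hi.symm, Finset.mem_univ i'⟩),
    Finset.prod_eq_one]
  · simp [hi, hi.symm, sq]
  · intro j hj
    simp only [Finset.mem_erase] at hj
    simp [hj.1, hj.2.1, hμ]

/-- The variance of a sum of independent variables with values in `[0, 1]`. -/
theorem sum_prod_mul_sq_le {μ : A → ℝ} (hμ0 : ∀ ω, 0 ≤ μ ω) (hμ : ∑ ω, μ ω = 1) {f : A → ℝ}
    (h0 : ∀ ω, 0 ≤ f ω) (h1 : ∀ ω, f ω ≤ 1) :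
    ∑ e : Fin n → A, (∏ j, μ (e j)) * (∑ j, f (e j) - n * ∑ ω, μ ω * f ω) ^ 2 ≤ n := by
  set m := ∑ ω, μ ω * f ω with hm
  have hm0 : 0 ≤ m := Finset.sum_nonneg fun ω _ => mul_nonneg (hμ0 ω) (h0 ω)
  have hm1 : m ≤ 1 := by
    rw [← hμ]
    exact Finset.sum_le_sum fun ω _ => mul_le_of_le_one_right (hμ0 ω) (h1 ω)
  set g : A → ℝ := fun ω => f ω - m with hg
  have hgm : ∑ ω, μ ω * g ω = 0 := by
    simp only [hg, mul_sub, Finset.sum_sub_distrib, ← Finset.sum_mul, hμ]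
    rw [← hm]; ring
  have hexp : ∀ e : Fin n → A, (∏ j, μ (e j)) * (∑ j, f (e j) - n * m) ^ 2 =
      ∑ i, ∑ i', (∏ j, μ (e j)) * (g (e i) * g (e i')) := by
    intro e
    have : ∑ j, f (e j) - n * m = ∑ j, g (e j) := by
      simp [hg, Finset.sum_sub_distrib]
    rw [this, sq, Finset.sum_mul_sum, Finset.mul_sum]
    exact Finset.sum_congr rfl fun i _ => Finset.mul_sum _ _ _
  simp only [hexp]
  rw [Finset.sum_comm]
  have hi : ∀ i : Fin n, ∑ e : Fin n → A, ∑ i', (∏ j, μ (e j)) * (g (e i) * g (e i')) ≤ 1 := by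
    intro i
    rw [Finset.sum_comm, Finset.sum_eq_single i]
    · rw [sum_prod_mul_apply hμ (fun ω => g ω * g ω) i, ← hμ]
      refine Finset.sum_le_sum fun ω _ => mul_le_of_le_one_right (hμ0 ω) ?_
      have a0 := h0 ω
      have a1 := h1 ω
      simp only [hg]
      nlinarith
    · intro i' _ hii
      rw [sum_prod_mul_apply_mul_apply hμ g hii.symm, hgm]
      norm_num
    · simp
  calc _ ≤ ∑ _i : Fin n, (1 : ℝ) := Finset.sum_le_sum fun i _ => hi i
    _ = n := by simp

end ProductLaw

/-! ### Consequences of calibration and of dilation invariance. -/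

namespace Chan

variable {F : Type} [Field F] [Fintype F] (C : Chan F)

/-- The mean a posteriori probability of the symbol sent. -/
noncomputable def mean : ℝ := ∑ ω, C.μ ω * (C.vec ω 0).1

theorem fst_le_one (ω : C.A) (a : F) : (C.vec ω a).1 ≤ 1 :=
  (Finset.single_le_sum (f := fun b => (C.vec ω b).1) (fun b _ => C.fst_nonneg ω b)
    (Finset.mem_univ a)).trans (C.sum_fst_le ω)

theorem sum_sq_fst_le_one (ω : C.A) : ∑ b, (C.vec ω b).1 ^ 2 ≤ 1 := by
  refine (Finset.sum_le_sum fun b _ => ?_).trans (C.sum_fst_le ω)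
  have h0 := C.fst_nonneg ω b
  have h1 := C.fst_le_one ω b
  nlinarith

/-- Calibration applied to the a posteriori probability of the symbol sent. This identity turns the
quadratic condition of the Koetter–Vardy decoder into the rate threshold `C.mean`. -/
theorem sum_sq_fst : ∑ ω, C.μ ω * ∑ b, (C.vec ω b).1 ^ 2 = C.mean := by
  rw [mean, C.calibrated fun y => (y 0).1]
  simp [sh, sq]

-- By calibration the symbol sent is distributed according to the a posteriori law, and the symbols
-- of probability below `η / q` together have mass at most `q * (η / q)`.
open Classical in
theorem prob_fst_lt (η : ℝ) (hη : 0 ≤ η) :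
    ∑ ω, C.μ ω * (if (C.vec ω 0).1 < η / Fintype.card F then 1 else 0) ≤ η := by
  rw [C.calibrated fun y => if (y 0).1 < η / Fintype.card F then 1 else 0]
  calc _ ≤ ∑ ω, C.μ ω * η := by
        refine Finset.sum_le_sum fun ω _ => mul_le_mul_of_nonneg_left ?_ (C.μ_nonneg ω)
        calc _ ≤ ∑ _b : F, η / Fintype.card F := by
              refine Finset.sum_le_sum fun b _ => ?_
              simp only [sh, zero_add]
              split_ifs with h
              · rw [mul_one]; exact h.le
              · rw [mul_zero]; positivity
          _ = η := by
              have : (Fintype.card F : ℝ) ≠ 0 := by exact_mod_cast Fintype.card_ne_zero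
              simp
              field_simp
    _ = η := by rw [← Finset.sum_mul, C.sum_μ, one_mul]

/-- A nonnegative dilation-invariant functional takes at each nonzero symbol at most the share
`1 / (q - 1)` of its total. -/
theorem sum_apply_le {K : ℝ} (H : (F → ℝ × ℝ) → F → ℝ) (h0 : ∀ ω a, 0 ≤ H (C.vec ω) a)
    (hH : ∀ x γ, γ ≠ 0 → H (fun b => x (γ * b)) 1 = H x γ)
    (hK : ∀ ω, ∑ a, H (C.vec ω) a ≤ K) {a : F} (ha : a ≠ 0) :
    ∑ ω, C.μ ω * H (C.vec ω) a ≤ K / ((Fintype.card F : ℝ) - 1) := by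
  classical
  have hq : (1 : ℝ) < Fintype.card F := by exact_mod_cast Fintype.one_lt_card
  have hconst : ∀ γ : F, γ ≠ 0 → ∑ ω, C.μ ω * H (C.vec ω) γ = ∑ ω, C.μ ω * H (C.vec ω) 1 := by
    intro γ hγ
    rw [C.dilation (fun x => H x 1) γ hγ]
    simp only [hH _ γ hγ]
  rw [le_div_iff₀ (by linarith)]
  calc _ = ∑ γ ∈ Finset.univ.erase (0 : F), ∑ ω, C.μ ω * H (C.vec ω) γ := by
        rw [Finset.sum_congr rfl fun γ hγ => (hconst γ (Finset.ne_of_mem_erase hγ)).trans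
          (hconst a ha).symm, Finset.sum_const, Finset.card_erase_of_mem (Finset.mem_univ _),
          Finset.card_univ, nsmul_eq_mul, Nat.cast_sub Fintype.card_pos]
        push_cast
        ring
    _ = ∑ ω, C.μ ω * ∑ γ ∈ Finset.univ.erase (0 : F), H (C.vec ω) γ := by
        rw [Finset.sum_comm]
        simp only [Finset.mul_sum]
    _ ≤ ∑ ω, C.μ ω * K := by
        refine Finset.sum_le_sum fun ω _ => mul_le_mul_of_nonneg_left ?_ (C.μ_nonneg ω)
        exact (Finset.sum_le_sum_of_subset_of_nonneg (Finset.erase_subset _ _)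
          fun a _ _ => h0 ω a).trans (hK ω)
    _ = K := by rw [← Finset.sum_mul, C.sum_μ, one_mul]

theorem mean_fst_le {a : F} (ha : a ≠ 0) :
    ∑ ω, C.μ ω * (C.vec ω a).1 ≤ 1 / ((Fintype.card F : ℝ) - 1) :=
  C.sum_apply_le (fun x a => (x a).1) C.fst_nonneg (fun x γ _ => by simp) C.sum_fst_le ha

end Chan

/-! ### First moment bound for the wrong codewords. -/

section FirstMoment

variable {F : Type} [Field F] {n : ℕ}

theorem sum_biUnion_le {α β : Type} [DecidableEq α] [DecidableEq β] (P : Finset α)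
    (S : α → Finset β) {f : β → ℝ} (hf : ∀ b, 0 ≤ f b) :
    ∑ b ∈ P.biUnion S, f b ≤ ∑ a ∈ P, ∑ b ∈ S a, f b := by
  induction P using Finset.induction_on with
  | empty => simp
  | insert a P ha ih =>
    rw [Finset.biUnion_insert, Finset.sum_insert ha]
    have h1 := Finset.sum_union_inter (s₁ := S a) (s₂ := P.biUnion S) (f := f)
    have h2 : 0 ≤ ∑ b ∈ S a ∩ P.biUnion S, f b := Finset.sum_nonneg fun b _ => hf b
    linarith

theorem eq_of_eqOn {pts : Fin n ↪ F} {k : ℕ} {c c' : Fin n → F} (hc : c ∈ rsCode pts k)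
    (hc' : c' ∈ rsCode pts k) (I : Finset (Fin n)) (hI : k ≤ I.card) (h : ∀ j ∈ I, c j = c' j) :
    c = c' := by
  obtain ⟨f, hf, rfl⟩ := hc
  obtain ⟨g, hg, rfl⟩ := hc'
  have hfg : f - g = 0 := by
    refine Polynomial.eq_zero_of_degree_lt_of_eval_finset_eq_zero (I.map pts) ?_ ?_
    · have := Polynomial.mem_degreeLT.1 (Submodule.sub_mem _ hf hg)
      rw [Finset.card_map]
      exact this.trans_le (by exact_mod_cast hI)
    · intro x hx
      obtain ⟨j, hj, rfl⟩ := Finset.mem_map.1 hx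
      rw [Polynomial.eval_sub, sub_eq_zero]
      exact h j hj
  rw [sub_eq_zero.1 hfg]

variable [Fintype F]

open Classical in
/-- The weighted number of non-zero codewords of a Reed-Solomon code. -/
theorem sum_prod_codewords_le (pts : Fin n ↪ F) {k : ℕ} (hk : k ≤ n) :
    ∑ c ∈ Finset.univ.filter (fun c : Fin n → F => c ∈ rsCode pts k ∧ c ≠ 0),
      ∏ j, (if c j = 0 then (1 : ℝ) else 1 / ((Fintype.card F : ℝ) - 1)) ≤
    4 ^ n * (1 / ((Fintype.card F : ℝ) - 1)) ^ (n - k) := by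
  have hq : (1 : ℝ) < Fintype.card F := by exact_mod_cast Fintype.one_lt_card
  set r : ℝ := 1 / ((Fintype.card F : ℝ) - 1) with hr
  have hr0 : 0 ≤ r := by rw [hr]; exact div_nonneg zero_le_one (by linarith)
  set v : F → ℝ := fun a => if a = 0 then 1 else r with hv
  have hv0 : ∀ a, 0 ≤ v a := fun a => by simp only [hv]; split_ifs <;> [norm_num; exact hr0]
  have hvs : ∑ a, v a = 2 := by
    rw [← Finset.add_sum_erase _ _ (Finset.mem_univ (0 : F)),
      Finset.sum_congr rfl (g := fun _ => r)
        fun a ha => by simp [hv, Finset.ne_of_mem_erase ha],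
      Finset.sum_const, Finset.card_erase_of_mem (Finset.mem_univ _), Finset.card_univ,
      nsmul_eq_mul, Nat.cast_sub Fintype.card_pos, hr]
    have : (Fintype.card F : ℝ) - 1 ≠ 0 := by linarith
    simp [hv]
    field_simp
    norm_num
  let S : Finset (Fin n) → Finset (Fin n → F) := fun I =>
    Finset.univ.filter fun c => c ∈ rsCode pts k ∧ ∀ j, j ∉ I → c j ≠ 0
  -- A non-zero codeword has at most `k` zeros. The set of its zeros is enlarged to a set `I` of
  -- exactly `k` positions, outside of which all its symbols are non-zero and contribute a factor
  -- `r` each.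
  have hcover : Finset.univ.filter (fun c : Fin n → F => c ∈ rsCode pts k ∧ c ≠ 0) ⊆
      (Finset.univ.powersetCard k).biUnion S := by
    intro c hc
    simp only [Finset.mem_filter, Finset.mem_univ, true_and] at hc
    have hZ : (Finset.univ.filter fun j => c j = 0).card ≤ k := by
      by_contra hlt
      exact hc.2 (eq_of_eqOn hc.1 (Submodule.zero_mem _) _ (not_le.1 hlt).le
        fun j hj => by simpa using hj)
    obtain ⟨I, hI1, hI2, hI3⟩ := Finset.exists_subsuperset_card_eq
      (Finset.subset_univ (Finset.univ.filter fun j => c j = 0)) hZ (by simpa using hk)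
    rw [Finset.mem_biUnion]
    refine ⟨I, Finset.mem_powersetCard.2 ⟨hI2, hI3⟩, ?_⟩
    simp only [S, Finset.mem_filter, Finset.mem_univ, true_and]
    exact ⟨hc.1, fun j hj h0 => hj (hI1 (by simpa using h0))⟩
  have hS : ∀ I ∈ Finset.univ.powersetCard k, ∑ c ∈ S I, ∏ j, v (c j) ≤
      2 ^ n * r ^ (n - k) := by
    intro I hI
    have hIk := (Finset.mem_powersetCard.1 hI).2
    have h1 : ∀ c ∈ S I, ∏ j, v (c j) = (∏ i : I, v (c i)) * r ^ (n - k) := by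
      intro c hc
      simp only [S, Finset.mem_filter, Finset.mem_univ, true_and] at hc
      rw [← Finset.prod_mul_prod_compl I, ← Finset.prod_coe_sort I]
      congr 1
      rw [Finset.prod_congr rfl (g := fun _ => r), Finset.prod_const, Finset.card_compl,
        Fintype.card_fin, hIk]
      intro j hj
      simp [hv, hc.2 j (Finset.mem_compl.1 hj)]
    rw [Finset.sum_congr rfl h1, ← Finset.sum_mul]
    refine mul_le_mul_of_nonneg_right ?_ (pow_nonneg hr0 _)
    -- The `k` positions of `I` determine a codeword, so on `I` the sum is at most the sum over all
    -- words, namely `(∑ a, v a) ^ k = 2 ^ k`.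
    have hinj : Set.InjOn (fun (c : Fin n → F) (i : I) => c i) (S I) := by
      intro c hc c' hc' hcc
      simp only [S, Finset.coe_filter, Finset.mem_univ, true_and, Set.mem_ofPred_eq] at hc hc'
      exact eq_of_eqOn hc.1 hc'.1 I hIk.ge fun j hj => congrFun hcc ⟨j, hj⟩
    rw [← Finset.sum_image (f := fun x : I → F => ∏ i, v (x i)) hinj]
    calc _ ≤ ∑ x : I → F, ∏ i, v (x i) :=
          Finset.sum_le_sum_of_subset_of_nonneg (Finset.subset_univ _)
            fun x _ _ => Finset.prod_nonneg fun i _ => hv0 _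
      _ = 2 ^ k := by
          rw [← Fintype.prod_sum fun (_ : I) a => v a]
          simp [hvs, hIk]
      _ ≤ 2 ^ n := pow_le_pow_right₀ (by norm_num) hk
  calc _ ≤ ∑ c ∈ (Finset.univ.powersetCard k).biUnion S, ∏ j, v (c j) :=
        Finset.sum_le_sum_of_subset_of_nonneg hcover
          fun x _ _ => Finset.prod_nonneg fun i _ => hv0 _
    _ ≤ ∑ I ∈ Finset.univ.powersetCard k, ∑ c ∈ S I, ∏ j, v (c j) :=
        sum_biUnion_le _ _ fun x => Finset.prod_nonneg fun i _ => hv0 _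
    _ ≤ ∑ I ∈ (Finset.univ : Finset (Fin n)).powersetCard k, 2 ^ n * r ^ (n - k) :=
        Finset.sum_le_sum hS
    _ ≤ 4 ^ n * r ^ (n - k) := by
        rw [Finset.sum_const, nsmul_eq_mul, ← mul_assoc]
        refine mul_le_mul_of_nonneg_right ?_ (pow_nonneg hr0 _)
        rw [show (4 : ℝ) = 2 * 2 by norm_num, mul_pow]
        refine mul_le_mul_of_nonneg_right ?_ (by positivity)
        have : (Finset.powersetCard k (Finset.univ : Finset (Fin n))).card ≤ 2 ^ n := by
          rw [Finset.card_powersetCard, Finset.card_univ, Fintype.card_fin]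
          exact Nat.choose_le_two_pow n k
        exact_mod_cast this

end FirstMoment

section Estimates

variable {n : ℕ}

/-- Entries below `ε` contribute at most `ε * n` to the sum, so at least `k + 1` entries are at
least `ε`. Having `k + 1` of them, and not just `k`, is what later leaves a spare factor `1 / q`. -/
theorem le_prod_of_large_sum {π : Fin n → ℝ} {ε δ : ℝ} {k : ℕ} (hε : 0 < ε) (hε1 : ε ≤ 1)
    (hδ : 0 < δ) (hδ1 : δ ≤ 1) (h1 : ∀ j, π j ≤ 1) (hδπ : ∀ j, δ ≤ π j)
    (hsum : k + 1 + ε * n ≤ ∑ j, π j) :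
    ε ^ n * δ ^ (n - (k + 1)) ≤ ∏ j, π j := by
  classical
  set G := Finset.univ.filter fun j => ε ≤ π j with hG
  have hGcard : k + 1 ≤ G.card := by
    have : ∑ j, π j ≤ G.card + ε * n := by
      calc ∑ j, π j ≤ ∑ j, ((if ε ≤ π j then 1 else 0) + ε) := by
            refine Finset.sum_le_sum fun j _ => ?_
            split_ifs with h
            · linarith [h1 j]
            · linarith
        _ = _ := by
            rw [Finset.sum_add_distrib, Finset.sum_boole]
            simp [hG, mul_comm]
    have : (k + 1 : ℝ) ≤ G.card := by linarith
    exact_mod_cast this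
  rw [← Finset.prod_mul_prod_compl G]
  have e1 : ε ^ n ≤ ∏ j ∈ G, π j := by
    calc ε ^ n ≤ ε ^ G.card :=
          pow_le_pow_of_le_one hε.le hε1 (by simpa using Finset.card_le_univ G)
      _ = ∏ _j ∈ G, ε := by rw [Finset.prod_const]
      _ ≤ _ := Finset.prod_le_prod (fun _ _ => hε.le) fun j hj => (Finset.mem_filter.1 hj).2
  have e2 : δ ^ (n - (k + 1)) ≤ ∏ j ∈ Gᶜ, π j := by
    calc δ ^ (n - (k + 1)) ≤ δ ^ Gᶜ.card :=
          pow_le_pow_of_le_one hδ.le hδ1 (by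
            rw [Finset.card_compl, Fintype.card_fin]; omega)
      _ = ∏ _j ∈ Gᶜ, δ := by rw [Finset.prod_const]
      _ ≤ _ := Finset.prod_le_prod (fun _ _ => hδ.le) fun j _ => hδπ j
  exact mul_le_mul e1 e2 (pow_nonneg hδ.le _) ((pow_nonneg hε.le _).trans e1)

/-- The exponents `n - k` and `n - (k + 1)` differ by one, so one factor `1 / q` survives. All the
rest is a constant raised to the power `n`. -/
theorem union_bound_le {ε η q : ℝ} {k : ℕ} (hε : 0 < ε) (hη : 0 < η) (hη1 : η ≤ 1) (h2 : 2 ≤ q)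
    (hkn : k < n) : 4 ^ n * (1 / (q - 1)) ^ (n - k) ≤
      (8 / (ε * η)) ^ n / q * (ε ^ n * (η / q) ^ (n - (k + 1))) := by
  have hq0 : 0 < q := by linarith
  have hr : 1 / (q - 1) ≤ 2 / q := by
    rw [div_le_div_iff₀ (by linarith) (by linarith)]
    linarith
  have hr0 : 0 ≤ 1 / (q - 1) := div_nonneg zero_le_one (by linarith)
  obtain ⟨m, hm⟩ : ∃ m, n - k = m + 1 := ⟨n - k - 1, by omega⟩
  have hm' : n - (k + 1) = m := by omega
  have hηpow : η ^ n ≤ η ^ m := pow_le_pow_of_le_one hη.le hη1 (by omega)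
  calc 4 ^ n * (1 / (q - 1)) ^ (n - k) ≤ 4 ^ n * (2 / q) ^ (n - k) :=
        mul_le_mul_of_nonneg_left (pow_le_pow_left₀ hr0 hr _) (by positivity)
    _ ≤ 4 ^ n * (2 ^ n * (1 / q) ^ (n - k)) := by
        refine mul_le_mul_of_nonneg_left ?_ (by positivity)
        rw [show 2 / q = 2 * (1 / q) by ring, mul_pow]
        exact mul_le_mul_of_nonneg_right (pow_le_pow_right₀ (by norm_num) (by omega))
          (by positivity)
    _ = 8 ^ n * (1 / q) ^ (m + 1) := by
        rw [hm, ← mul_assoc, ← mul_pow]; norm_num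
    _ = (8 / (ε * η)) ^ n / q * (ε ^ n * (η ^ n * (1 / q) ^ m)) := by
        rw [div_pow 8, mul_pow ε, pow_succ (1 / q)]
        field_simp
    _ ≤ (8 / (ε * η)) ^ n / q * (ε ^ n * (η / q) ^ (n - (k + 1))) := by
        refine mul_le_mul_of_nonneg_left ?_ (by positivity)
        rw [hm', div_eq_mul_one_div η q, mul_pow]
        refine mul_le_mul_of_nonneg_left ?_ (by positivity)
        exact mul_le_mul_of_nonneg_right hηpow (by positivity)

end Estimates

/-! ### Failure probability of one constituent code. -/

section Leaf

variable {F : Type} [Field F] [Fintype F] {n : ℕ}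

variable (C : Chan F)

open Classical in
/-- The total likelihood of the wrong codewords, when the noise is `e`. -/
noncomputable def Chan.wrong (pts : Fin n ↪ F) (k : ℕ) (e : Fin n → C.A) : ℝ :=
  ∑ x ∈ Finset.univ.filter (fun x : Fin n → F => x ∈ rsCode pts k ∧ x ≠ 0),
    ∏ j, (C.vec (e j) (x j)).1

/-- The first two conditions on the noise give the interpolation inequality. The last two, together
with a large score, make `c` strictly more likely than the sum of all other codewords. For `k = 0`
there is no other codeword. -/
theorem eventually_kvDecode_reliability (pts : Fin n ↪ F) {k : ℕ} {ε η : ℝ} (hε : 0 < ε)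
    (hε1 : ε ≤ 1) (hη : 0 < η) (hη1 : η ≤ 1) (hn : 1 ≤ 2 * ε * n)
    (hk : k = 0 ∨ (k : ℝ) ≤ n * (C.mean - 4 * ε)) {c : Fin n → F} (hc : c ∈ rsCode pts k)
    (e : Fin n → C.A) (hA : n * C.mean - ε * n ≤ ∑ j, (C.vec (e j) 0).1)
    (hB : ∑ j, ∑ b, (C.vec (e j) b).1 ^ 2 ≤ n * C.mean + ε * n)
    (hpos : ∀ j, η / Fintype.card F ≤ (C.vec (e j) 0).1)
    (hS : C.wrong pts k e < ε ^ n * (η / Fintype.card F) ^ (n - (k + 1))) :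
    ∀ᶠ s in atTop, kvDecode pts k s (C.reliability c e) = some c := by
  classical
  have hq : (1 : ℝ) < Fintype.card F := by exact_mod_cast Fintype.one_lt_card
  have hn0 : (0 : ℝ) < n := by
    by_contra h
    have : (n : ℝ) = 0 := le_antisymm (not_lt.1 h) (Nat.cast_nonneg _)
    rw [this] at hn
    linarith
  have hδ : 0 < η / Fintype.card F := by positivity
  have hδ1 : η / Fintype.card F ≤ 1 := by
    rw [div_le_one (by linarith)]; linarith
  have hscore : ∑ j, C.reliability c e j (c j) = ∑ j, (C.vec (e j) 0).1 := by
    simp [Chan.reliability]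
  have hsq : ∑ z : Fin n × F, C.reliability c e z.1 z.2 ^ 2 =
      ∑ j, ∑ b, (C.vec (e j) b).1 ^ 2 := by
    rw [Fintype.sum_prod_type]
    exact Finset.sum_congr rfl fun j _ => Fintype.sum_equiv (Equiv.subRight (c j)) _ _ fun b => rfl
  have hlik : ∀ x : Fin n → F, likelihood (C.reliability c e) x =
      ∏ j, (C.vec (e j) ((x - c) j)).1 := fun x => rfl
  have hApos : 0 < ∑ j, (C.vec (e j) 0).1 := by
    have : ∑ _j : Fin n, η / (Fintype.card F : ℝ) ≤ ∑ j, (C.vec (e j) 0).1 :=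
      Finset.sum_le_sum fun j _ => hpos j
    simp only [Finset.sum_const, Finset.card_univ, Fintype.card_fin, nsmul_eq_mul] at this
    exact lt_of_lt_of_le (by positivity) this
  refine eventually_kvDecode (Pi := C.reliability c e) (fun j a => C.fst_nonneg _ _) hc ?_ ?_
  · rw [hscore, hsq]
    rcases hk with rfl | hk
    · simpa using pow_pos hApos 2
    · have hB0 : 0 ≤ ∑ j, ∑ b, (C.vec (e j) b).1 ^ 2 :=
        Finset.sum_nonneg fun j _ => Finset.sum_nonneg fun b _ => sq_nonneg _
      have hm : 4 * ε ≤ C.mean := by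
        have : 0 ≤ n * (C.mean - 4 * ε) := (Nat.cast_nonneg k).trans hk
        nlinarith [nonneg_of_mul_nonneg_right this hn0]
      have hk1 : ((k - 1 : ℕ) : ℝ) ≤ n * (C.mean - 4 * ε) :=
        (Nat.cast_le.2 (Nat.sub_le k 1)).trans hk
      have hA2 : (n * (C.mean - ε)) ^ 2 ≤ (∑ j, (C.vec (e j) 0).1) ^ 2 :=
        pow_le_pow_left₀ (mul_nonneg hn0.le (by linarith)) (by linarith) 2
      -- With `m = C.mean`, the right side exceeds the left by `n² (ε m + 5 ε²)`: the margin `4 ε`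
      -- in the dimension absorbs the two fluctuations of size `ε`.
      have hlt : (n * (C.mean - 4 * ε)) * (n * (C.mean + ε)) < (n * (C.mean - ε)) ^ 2 := by
        have : (C.mean - 4 * ε) * (C.mean + ε) < (C.mean - ε) ^ 2 := by nlinarith
        have h2 : 0 < (n : ℝ) ^ 2 := by positivity
        nlinarith
      calc _ ≤ (n * (C.mean - 4 * ε)) * (n * (C.mean + ε)) := by
            refine mul_le_mul hk1 (by linarith) hB0 (mul_nonneg hn0.le (by linarith))
        _ < _ := hlt
        _ ≤ _ := hA2
  · intro x hx hxc
    rw [hlik, hlik]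
    rcases hk with rfl | hk
    · exact absurd (eq_of_eqOn hx hc ∅ (Nat.zero_le _) (by simp)) hxc
    · have hmem : x - c ∈ Finset.univ.filter
          (fun x : Fin n → F => x ∈ rsCode pts k ∧ x ≠ 0) := by
        simp only [Finset.mem_filter, Finset.mem_univ, true_and]
        exact ⟨Submodule.sub_mem _ hx hc, sub_ne_zero.2 hxc⟩
      have h1 : ∏ j, (C.vec (e j) ((x - c) j)).1 ≤ C.wrong pts k e :=
        Finset.single_le_sum (f := fun x : Fin n → F => ∏ j, (C.vec (e j) (x j)).1)
          (fun x _ => Finset.prod_nonneg fun j _ => C.fst_nonneg _ _) hmem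
      refine (h1.trans_lt hS).trans_le ?_
      -- The score is at least `n * C.mean - ε * n ≥ k + 3 * ε * n ≥ k + 1 + ε * n`, by `1 ≤ 2 * ε *
      -- n`.
      have h2 := le_prod_of_large_sum (k := k) hε hε1 hδ hδ1 (fun j => C.fst_le_one (e j) 0) hpos
        (by nlinarith)
      simpa using h2

/-- By independence the mean likelihood of a word factors over the positions. A symbol `0`
contributes at most `1`, a non-zero symbol at most `1 / (q - 1)`. -/
theorem mean_wrong_le (pts : Fin n ↪ F) {k : ℕ} (hk : k ≤ n) :
    ∑ e : Fin n → C.A, (∏ j, C.μ (e j)) * C.wrong pts k e ≤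
      4 ^ n * (1 / ((Fintype.card F : ℝ) - 1)) ^ (n - k) := by
  classical
  have hq : (1 : ℝ) < Fintype.card F := by exact_mod_cast Fintype.one_lt_card
  refine le_trans ?_ (sum_prod_codewords_le pts hk)
  simp only [Chan.wrong, Finset.mul_sum]
  rw [Finset.sum_comm]
  refine Finset.sum_le_sum fun x _ => ?_
  simp only [← Finset.prod_mul_distrib]
  rw [sum_prod_apply fun j ω => C.μ ω * (C.vec ω (x j)).1]
  refine Finset.prod_le_prod (fun j _ => Finset.sum_nonneg fun ω _ =>
    mul_nonneg (C.μ_nonneg _) (C.fst_nonneg _ _)) fun j _ => ?_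
  split_ifs with h
  · rw [← C.sum_μ]
    exact Finset.sum_le_sum fun ω _ => mul_le_of_le_one_right (C.μ_nonneg ω) (C.fst_le_one _ _)
  · exact C.mean_fst_le h

theorem Chan.sum_mul_sq_dev_le : ∑ e : Fin n → C.A, (∏ j, C.μ (e j)) *
    (∑ j, (C.vec (e j) 0).1 - n * C.mean) ^ 2 ≤ n := by
  have h := sum_prod_mul_sq_le (n := n) C.μ_nonneg C.sum_μ (f := fun ω => (C.vec ω 0).1)
    (fun ω => C.fst_nonneg ω 0) fun ω => C.fst_le_one ω 0
  rwa [← Chan.mean] at h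

theorem Chan.sum_mul_sq_dev_sq_le : ∑ e : Fin n → C.A, (∏ j, C.μ (e j)) *
    (∑ j, ∑ b, (C.vec (e j) b).1 ^ 2 - n * C.mean) ^ 2 ≤ n := by
  have h := sum_prod_mul_sq_le (n := n) C.μ_nonneg C.sum_μ (f := fun ω => ∑ b, (C.vec ω b).1 ^ 2)
    (fun ω => Finset.sum_nonneg fun b _ => sq_nonneg _) C.sum_sq_fst_le_one
  rwa [C.sum_sq_fst] at h

/-- The probability of failure of a constituent code. -/
theorem eventually_leafFail_le (pts : Fin n ↪ F) {k : ℕ} {ε η : ℝ} (hε : 0 < ε)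
    (hε1 : ε ≤ 1) (hη : 0 < η) (hη1 : η ≤ 1) (hn : 1 ≤ 2 * ε * n) (hkn : k < n)
    (hk : k = 0 ∨ (k : ℝ) ≤ n * (C.mean - 4 * ε)) :
    ∀ᶠ s in atTop, ∀ c ∈ rsCode pts k, leafFail pts k s C c ≤
      2 / (ε ^ 2 * n) + n * η + (8 / (ε * η)) ^ n / Fintype.card F := by
  classical
  have hq : (1 : ℝ) < Fintype.card F := by exact_mod_cast Fintype.one_lt_card
  have hn0 : (0 : ℝ) < n := by exact_mod_cast (Nat.zero_le k).trans_lt hkn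
  set q : ℝ := (Fintype.card F : ℝ) with hqdef
  set t : ℝ := ε ^ n * (η / q) ^ (n - (k + 1)) with ht
  have ht0 : 0 < t := by positivity
  let good : (Fin n → C.A) → Prop := fun e =>
    n * C.mean - ε * n ≤ ∑ j, (C.vec (e j) 0).1 ∧
    ∑ j, ∑ b, (C.vec (e j) b).1 ^ 2 ≤ n * C.mean + ε * n ∧
    (∀ j, η / q ≤ (C.vec (e j) 0).1) ∧ C.wrong pts k e < t
  have hev : ∀ᶠ s in atTop, ∀ c : Fin n → F, ∀ e : Fin n → C.A, c ∈ rsCode pts k → good e →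
      kvDecode pts k s (C.reliability c e) = some c := by
    -- There are finitely many words and noise patterns, so one threshold for `s` serves them all.
    rw [eventually_all]
    intro c
    rw [eventually_all]
    intro e
    by_cases hc : c ∈ rsCode pts k
    · by_cases he : good e
      · filter_upwards [eventually_kvDecode_reliability C pts hε hε1 hη hη1 hn hk hc e he.1 he.2.1
          he.2.2.1 he.2.2.2] with s hs _ _ using hs
      · exact Eventually.of_forall fun s _ h => absurd h he
    · exact Eventually.of_forall fun s h => absurd h hc
  filter_upwards [hev] with s hs c hc
  obtain ⟨X₁, dX₁⟩ : ∃ X : (Fin n → C.A) → ℝ,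
      ∀ e, X e = (∑ j, (C.vec (e j) 0).1 - n * C.mean) ^ 2 := ⟨_, fun _ => rfl⟩
  obtain ⟨X₂, dX₂⟩ : ∃ X : (Fin n → C.A) → ℝ,
      ∀ e, X e = (∑ j, ∑ b, (C.vec (e j) b).1 ^ 2 - n * C.mean) ^ 2 := ⟨_, fun _ => rfl⟩
  obtain ⟨X₃, dX₃⟩ : ∃ X : (Fin n → C.A) → ℝ,
      ∀ e, X e = ∑ j, if (C.vec (e j) 0).1 < η / q then 1 else 0 := ⟨_, fun _ => rfl⟩
  obtain ⟨X₄, dX₄⟩ : ∃ X : (Fin n → C.A) → ℝ, ∀ e, X e = C.wrong pts k e := ⟨_, fun _ => rfl⟩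
  have hX₁ : ∀ e, 0 ≤ X₁ e := fun e => by rw [dX₁]; exact sq_nonneg _
  have hX₂ : ∀ e, 0 ≤ X₂ e := fun e => by rw [dX₂]; exact sq_nonneg _
  have hX₃ : ∀ e, 0 ≤ X₃ e := fun e => by
    rw [dX₃]
    exact Finset.sum_nonneg fun j _ => by split_ifs <;> norm_num
  have hX₄ : ∀ e, 0 ≤ X₄ e := fun e => by
    rw [dX₄]
    exact Finset.sum_nonneg fun x _ => Finset.prod_nonneg fun j _ => C.fst_nonneg _ _
  have hw : ∀ e : Fin n → C.A, 0 ≤ ∏ j, C.μ (e j) :=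
    fun e => Finset.prod_nonneg fun j _ => C.μ_nonneg _
  have hεn : 0 < (ε * n) ^ 2 := by positivity
  -- Each of the four ways of not being good makes one of the normalised statistics at least `1`, so
  -- the mean of their sum bounds the failure probability: Chebyshev for the first two, a union
  -- bound over positions for the third, Markov for the last.
  have hbad : ∀ e, ¬ good e → 1 ≤ X₁ e / (ε * n) ^ 2 + X₂ e / (ε * n) ^ 2 + X₃ e + X₄ e / t := by
    intro e he
    have p1 := div_nonneg (hX₁ e) hεn.le
    have p2 := div_nonneg (hX₂ e) hεn.le
    have p3 := hX₃ e
    have p4 := div_nonneg (hX₄ e) ht0.le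
    by_cases g1 : n * C.mean - ε * n ≤ ∑ j, (C.vec (e j) 0).1
    · by_cases g2 : ∑ j, ∑ b, (C.vec (e j) b).1 ^ 2 ≤ n * C.mean + ε * n
      · by_cases g3 : ∀ j, η / q ≤ (C.vec (e j) 0).1
        · have g4 : t ≤ X₄ e := not_lt.1 fun h => he ⟨g1, g2, g3, dX₄ e ▸ h⟩
          have : 1 ≤ X₄ e / t := (one_le_div ht0).2 g4
          linarith
        · push Not at g3
          obtain ⟨j, hj⟩ := g3
          have : 1 ≤ X₃ e := by
            have := Finset.single_le_sum
              (f := fun j => if (C.vec (e j) 0).1 < η / q then (1 : ℝ) else 0)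
              (fun j _ => by split_ifs <;> norm_num) (Finset.mem_univ j)
            rw [dX₃]
            rwa [if_pos hj] at this
          linarith
      · have : 1 ≤ X₂ e / (ε * n) ^ 2 := by
          rw [one_le_div hεn, dX₂]
          exact pow_le_pow_left₀ (by positivity) (by linarith) 2
        linarith
    · have : 1 ≤ X₁ e / (ε * n) ^ 2 := by
        rw [one_le_div hεn, dX₁, ← neg_sq (∑ j, (C.vec (e j) 0).1 - n * C.mean)]
        exact pow_le_pow_left₀ (by positivity) (by linarith) 2
      linarith
  have hpt : leafFail pts k s C c ≤ ∑ e : Fin n → C.A, (∏ j, C.μ (e j)) *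
      (X₁ e / (ε * n) ^ 2 + X₂ e / (ε * n) ^ 2 + X₃ e + X₄ e / t) := by
    unfold leafFail
    refine Finset.sum_le_sum fun e _ => ?_
    have p1 := div_nonneg (hX₁ e) hεn.le
    have p2 := div_nonneg (hX₂ e) hεn.le
    have p3 := hX₃ e
    have p4 := div_nonneg (hX₄ e) ht0.le
    by_cases he : good e
    · rw [if_pos (hs c e hc he)]
      exact mul_nonneg (hw e) (by linarith)
    · split_ifs
      · exact mul_nonneg (hw e) (by linarith)
      · exact le_mul_of_one_le_right (hw e) (hbad e he)
  refine hpt.trans ?_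
  have E1 : ∑ e : Fin n → C.A, (∏ j, C.μ (e j)) * X₁ e ≤ n := by
    simp only [dX₁]
    exact C.sum_mul_sq_dev_le
  have E2 : ∑ e : Fin n → C.A, (∏ j, C.μ (e j)) * X₂ e ≤ n := by
    simp only [dX₂]
    exact C.sum_mul_sq_dev_sq_le
  have E3 : ∑ e : Fin n → C.A, (∏ j, C.μ (e j)) * X₃ e ≤ n * η := by
    simp only [dX₃, Finset.mul_sum]
    rw [Finset.sum_comm]
    calc _ ≤ ∑ _j : Fin n, η := Finset.sum_le_sum fun j _ => by
          rw [sum_prod_mul_apply C.sum_μ (fun ω => if (C.vec ω 0).1 < η / q then 1 else 0) j]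
          exact C.prob_fst_lt η hη.le
      _ = n * η := by simp
  have E4 : (∑ e : Fin n → C.A, (∏ j, C.μ (e j)) * X₄ e) / t ≤ (8 / (ε * η)) ^ n / q := by
    have h1 := mean_wrong_le C pts hkn.le
    simp only [dX₄]
    rw [div_le_iff₀ ht0]
    exact h1.trans (union_bound_le hε hη hη1 (by
      have : 2 ≤ Fintype.card F := Fintype.one_lt_card
      exact_mod_cast this) hkn)
  have hsplit : ∑ e : Fin n → C.A, (∏ j, C.μ (e j)) *
      (X₁ e / (ε * n) ^ 2 + X₂ e / (ε * n) ^ 2 + X₃ e + X₄ e / t) =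
      (∑ e : Fin n → C.A, (∏ j, C.μ (e j)) * X₁ e) / (ε * n) ^ 2 +
      (∑ e : Fin n → C.A, (∏ j, C.μ (e j)) * X₂ e) / (ε * n) ^ 2 +
      (∑ e : Fin n → C.A, (∏ j, C.μ (e j)) * X₃ e) +
      (∑ e : Fin n → C.A, (∏ j, C.μ (e j)) * X₄ e) / t := by
    simp only [Finset.sum_div, ← Finset.sum_add_distrib]
    exact Finset.sum_congr rfl fun e _ => by ring
  rw [hsplit]
  have e1 := div_le_div_of_nonneg_right E1 hεn.le
  have e2 := div_le_div_of_nonneg_right E2 hεn.le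
  have e3 : (n : ℝ) / (ε * n) ^ 2 + n / (ε * n) ^ 2 = 2 / (ε ^ 2 * n) := by
    field_simp; norm_num
  linarith

end Leaf

/-! ### Candidate symbols and their collisions. -/

section Candidates

variable {F : Type}

open Classical in
/-- The indicator function of the set of candidates of an estimator. -/
noncomputable def cand (x : F → ℝ × ℝ) (a : F) : ℝ := if 0 < (x a).2 then 1 else 0

theorem cand_nonneg (x : F → ℝ × ℝ) (a : F) : 0 ≤ cand x a := by
  rw [cand]; split_ifs <;> norm_num

theorem cand_le_one (x : F → ℝ × ℝ) (a : F) : cand x a ≤ 1 := by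
  rw [cand]; split_ifs <;> norm_num

variable [Field F]

/-- The exceptional event for two estimators: they share a wrong candidate, or a difference of two
candidates. -/
def Collide (x₁ x₂ : F → ℝ × ℝ) : Prop :=
  ∃ a, a ≠ 0 ∧ (0 < (x₁ a).2 ∧ 0 < (x₂ a).2 ∨
    ∃ b b', (0 < (x₁ b).2 ∧ 0 < (x₁ (a + b)).2) ∧ 0 < (x₂ b').2 ∧ 0 < (x₂ (a + b')).2)

theorem agree_of_not_collide {x₁ x₂ : F → ℝ × ℝ} (h : ¬ Collide x₁ x₂) :
    agree (fun b => (x₁ b).2) (fun b => (x₂ b).2) ⊆ {0} := by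
  intro b hb
  by_contra hne
  exact h ⟨b, hne, Or.inl hb⟩

variable [Fintype F]

open Classical in
/-- The number of pairs of candidates with a given difference. -/
noncomputable def candPairs (x : F → ℝ × ℝ) (d : F) : ℝ := ∑ b, cand x b * cand x (d + b)

theorem candPairs_nonneg (x : F → ℝ × ℝ) (d : F) : 0 ≤ candPairs x d :=
  Finset.sum_nonneg fun _ _ => mul_nonneg (cand_nonneg _ _) (cand_nonneg _ _)

theorem one_le_candPairs {x : F → ℝ × ℝ} {d b : F} (h : 0 < (x b).2) (h' : 0 < (x (d + b)).2) :
    1 ≤ candPairs x d := by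
  have := Finset.single_le_sum (f := fun b => cand x b * cand x (d + b))
    (fun b _ => mul_nonneg (cand_nonneg _ _) (cand_nonneg _ _)) (Finset.mem_univ b)
  simpa [cand, candPairs, h, h'] using this

theorem sum_candPairs_le {x : F → ℝ × ℝ} {K : ℝ} (h : ∑ a, cand x a ≤ K) :
    ∑ d, candPairs x d ≤ K ^ 2 := by
  simp only [candPairs]
  rw [sum_sum_corr (cand x) (cand x), ← sq]
  exact pow_le_pow_left₀ (Finset.sum_nonneg fun _ _ => cand_nonneg _ _) h 2

open Classical in
theorem collide_le (x₁ x₂ : F → ℝ × ℝ) : (if Collide x₁ x₂ then (1 : ℝ) else 0) ≤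
    (∑ a ∈ Finset.univ.erase 0, cand x₁ a * cand x₂ a) +
      ∑ d ∈ Finset.univ.erase 0, candPairs x₁ d * candPairs x₂ d := by
  have n1 : ∀ a ∈ Finset.univ.erase (0 : F), 0 ≤ cand x₁ a * cand x₂ a :=
    fun a _ => mul_nonneg (cand_nonneg _ _) (cand_nonneg _ _)
  have n2 : ∀ a ∈ Finset.univ.erase (0 : F), 0 ≤ candPairs x₁ a * candPairs x₂ a :=
    fun a _ => mul_nonneg (candPairs_nonneg _ _) (candPairs_nonneg _ _)
  have s1 := Finset.sum_nonneg n1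
  have s2 := Finset.sum_nonneg n2
  split_ifs with h
  · obtain ⟨a, ha, ⟨h1, h2⟩ | ⟨b, b', ⟨h1, h2⟩, h3, h4⟩⟩ := h
    · have := Finset.single_le_sum n1 (Finset.mem_erase.2 ⟨ha, Finset.mem_univ a⟩)
      simp only [cand, h1, h2, if_true, mul_one] at this
      simp only [cand] at s2 ⊢
      linarith
    · have := Finset.single_le_sum n2 (Finset.mem_erase.2 ⟨ha, Finset.mem_univ a⟩)
      have h5 := one_le_candPairs h1 h2
      have h6 := one_le_candPairs h3 h4
      have h7 : 1 ≤ candPairs x₁ a * candPairs x₂ a := one_le_mul_of_one_le_of_one_le h5 h6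
      linarith
  · linarith

namespace Chan

variable (C : Chan F)

/-- With the first outcome fixed, independence allows averaging over the second, and by dilation
invariance each non-zero symbol then receives at most `K / (q - 1)`. -/
theorem sum_prod_overlap_le {K : ℝ} (hK0 : 0 ≤ K) (H : (F → ℝ × ℝ) → F → ℝ)
    (h0 : ∀ ω a, 0 ≤ H (C.vec ω) a)
    (hH : ∀ x γ, γ ≠ 0 → H (fun b => x (γ * b)) 1 = H x γ)
    (hK : ∀ ω, ∑ a, H (C.vec ω) a ≤ K) [DecidableEq F] :
    ∑ ω : C.A × C.A, C.μ ω.1 * C.μ ω.2 *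
      ∑ a ∈ Finset.univ.erase (0 : F), H (C.vec ω.1) a * H (C.vec ω.2) a ≤
      K ^ 2 / ((Fintype.card F : ℝ) - 1) := by
  have hq : (1 : ℝ) < Fintype.card F := by exact_mod_cast Fintype.one_lt_card
  have hr : 0 ≤ K / ((Fintype.card F : ℝ) - 1) := div_nonneg hK0 (by linarith)
  rw [C.sum_prod_eq]
  calc _ ≤ ∑ ω, C.μ ω * (K * (K / ((Fintype.card F : ℝ) - 1))) := by
        refine Finset.sum_le_sum fun ω₁ _ => mul_le_mul_of_nonneg_left ?_ (C.μ_nonneg _)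
        calc _ = ∑ a ∈ Finset.univ.erase (0 : F), H (C.vec ω₁) a *
              ∑ ω₂, C.μ ω₂ * H (C.vec ω₂) a := by
              simp only [Finset.mul_sum]
              rw [Finset.sum_comm]
              refine Finset.sum_congr rfl fun _ _ => Finset.sum_congr rfl fun _ _ => by ring
          _ ≤ ∑ a ∈ Finset.univ.erase (0 : F), H (C.vec ω₁) a *
              (K / ((Fintype.card F : ℝ) - 1)) :=
              Finset.sum_le_sum fun a ha => mul_le_mul_of_nonneg_left
                (C.sum_apply_le H h0 hH hK (Finset.ne_of_mem_erase ha)) (h0 _ _)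
          _ ≤ _ := by
              rw [← Finset.sum_mul]
              refine mul_le_mul_of_nonneg_right ?_ hr
              exact (Finset.sum_le_sum_of_subset_of_nonneg (Finset.erase_subset _ _)
                fun a _ _ => h0 _ a).trans (hK ω₁)
    _ = _ := by rw [← Finset.sum_mul, C.sum_μ]; ring

open Classical in
/-- Collisions are rare over a large field. -/
theorem prob_collide_le {K : ℝ} (hK0 : 0 ≤ K) (hK : ∀ ω, ∑ a, cand (C.vec ω) a ≤ K) :
    ∑ ω : C.A × C.A, C.μ ω.1 * C.μ ω.2 *
      (if Collide (C.vec ω.1) (C.vec ω.2) then 1 else 0) ≤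
      (K ^ 2 + K ^ 4) / ((Fintype.card F : ℝ) - 1) := by
  have e1 := C.sum_prod_overlap_le hK0 cand (fun _ _ => cand_nonneg _ _)
    (fun x γ _ => by simp [cand]) hK
  -- At most `K` candidates have at most `K ^ 2` ordered pairs, so differences are governed by the
  -- same estimate with `K ^ 2` in place of `K`.
  have e2 := C.sum_prod_overlap_le (K := K ^ 2) (by positivity) candPairs
    (fun _ _ => candPairs_nonneg _ _)
    (fun x γ hγ => by
      refine Fintype.sum_equiv (Equiv.mulLeft₀ γ hγ) _ _ fun b => ?_
      simp [cand, mul_add]) fun ω => sum_candPairs_le (hK ω)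
  calc _ ≤ ∑ ω : C.A × C.A, C.μ ω.1 * C.μ ω.2 *
        ((∑ a ∈ Finset.univ.erase 0, cand (C.vec ω.1) a * cand (C.vec ω.2) a) +
        ∑ d ∈ Finset.univ.erase 0, candPairs (C.vec ω.1) d * candPairs (C.vec ω.2) d) :=
        Finset.sum_le_sum fun ω _ => mul_le_mul_of_nonneg_left (collide_le _ _)
          (mul_nonneg (C.μ_nonneg _) (C.μ_nonneg _))
    _ ≤ _ := by
        simp only [mul_add, Finset.sum_add_distrib]
        refine (add_le_add e1 e2).trans_eq ?_
        ring

/-- The a posteriori probabilities are at least as good as the estimator. -/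
theorem le_mean : 2 * (∑ ω, C.μ ω * (C.vec ω 0).2) - ∑ ω, C.μ ω * ∑ a, (C.vec ω a).2 ^ 2 ≤
    C.mean := by
  -- By calibration the mean of the estimator at the symbol sent is the mean of its inner product
  -- with the a posteriori vector. The claim then follows from `0 ≤ ∑ (π - g)²`.
  rw [C.calibrated fun y => (y 0).2, ← C.sum_sq_fst, Finset.mul_sum, ← Finset.sum_sub_distrib]
  refine Finset.sum_le_sum fun ω _ => ?_
  have : 2 * (∑ b, (C.vec ω b).1 * (sh b (C.vec ω) 0).2) - ∑ a, (C.vec ω a).2 ^ 2 ≤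
      ∑ b, (C.vec ω b).1 ^ 2 := by
    rw [Finset.mul_sum, ← Finset.sum_sub_distrib]
    refine Finset.sum_le_sum fun b _ => ?_
    simp only [sh, zero_add]
    nlinarith [sq_nonneg ((C.vec ω b).1 - (C.vec ω b).2)]
  have h2 := mul_le_mul_of_nonneg_left this (C.μ_nonneg ω)
  linarith

theorem snd_le_one (ω : C.A) (a : F) : (C.vec ω a).2 ≤ 1 :=
  (Finset.single_le_sum (f := fun b => (C.vec ω b).2) (fun b _ => C.snd_nonneg ω b)
    (Finset.mem_univ a)).trans (C.sum_snd_le ω)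

theorem sum_sq_snd_le_one (ω : C.A) : ∑ b, (C.vec ω b).2 ^ 2 ≤ 1 := by
  refine (Finset.sum_le_sum fun b _ => ?_).trans (C.sum_snd_le ω)
  have h0 := C.snd_nonneg ω b
  have h1 := C.snd_le_one ω b
  nlinarith

end Chan

section Pair

variable {x₁ x₂ : F → ℝ × ℝ}

theorem opV_zero_of_not_collide (h₁ : ∀ a, 0 ≤ (x₁ a).2) (h₂ : ∀ a, 0 ≤ (x₂ a).2)
    (h : ¬ Collide x₁ x₂) :
    (opV x₁ x₂ 0).2 = (x₁ 0).2 * (x₂ 0).2 := by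
  simp only [opV, zero_add]
  refine Finset.sum_eq_single 0 (fun b _ hb => ?_) (by simp)
  by_contra hne
  refine h ⟨b, hb, Or.inl ⟨(h₁ b).lt_of_ne' (left_ne_zero_of_mul hne),
    (h₂ b).lt_of_ne' (right_ne_zero_of_mul hne)⟩⟩

/-- Two ways of writing `a` as a difference of candidates would yield a common non-zero difference
within both lists. Without collision each `a` arises at most once and the square of the sum has no
cross terms. -/
theorem sum_sq_opV_of_not_collide (h₁ : ∀ a, 0 ≤ (x₁ a).2) (h₂ : ∀ a, 0 ≤ (x₂ a).2)
    (h : ¬ Collide x₁ x₂) :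
    ∑ a, (opV x₁ x₂ a).2 ^ 2 = (∑ a, (x₁ a).2 ^ 2) * ∑ a, (x₂ a).2 ^ 2 := by
  rw [← sum_sum_corr]
  refine Finset.sum_congr rfl fun a _ => ?_
  simp only [opV, sq]
  rw [Finset.sum_mul_sum]
  refine Finset.sum_congr rfl fun b _ => ?_
  rw [Finset.sum_eq_single b]
  · ring
  · intro b' _ hb'
    by_contra hne
    have n1 := left_ne_zero_of_mul hne
    have n2 := right_ne_zero_of_mul hne
    refine h ⟨b' - b, sub_ne_zero.2 hb', Or.inr ⟨b, a + b, ⟨?_, ?_⟩, ?_, ?_⟩⟩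
    · exact (h₁ b).lt_of_ne' (left_ne_zero_of_mul n1)
    · rw [sub_add_cancel]
      exact (h₁ b').lt_of_ne' (left_ne_zero_of_mul n2)
    · exact (h₂ _).lt_of_ne' (right_ne_zero_of_mul n1)
    · rw [show b' - b + (a + b) = a + b' by ring]
      exact (h₂ _).lt_of_ne' (right_ne_zero_of_mul n2)
  · simp

/-- New candidates come only from old ones, here and in `cand_opU_le`. Their number therefore stays
bounded independently of the field, which is what makes collisions rare. -/
theorem cand_opV_le (h₁ : ∀ a, 0 ≤ (x₁ a).2) (h₂ : ∀ a, 0 ≤ (x₂ a).2)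
    (a : F) : cand (opV x₁ x₂) a ≤ ∑ b, cand x₁ b * cand x₂ (a + b) := by
  by_cases h : 0 < (opV x₁ x₂ a).2
  · obtain ⟨b, -, hb⟩ := Finset.exists_ne_zero_of_sum_ne_zero h.ne'
    have p1 := (h₁ b).lt_of_ne' (left_ne_zero_of_mul hb)
    have p2 := (h₂ (a + b)).lt_of_ne' (right_ne_zero_of_mul hb)
    have := Finset.single_le_sum (f := fun b => cand x₁ b * cand x₂ (a + b))
      (fun b _ => mul_nonneg (cand_nonneg _ _) (cand_nonneg _ _)) (Finset.mem_univ b)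
    refine le_trans ?_ this
    simp [cand, p1, p2, h]
  · rw [cand, if_neg h]
    exact Finset.sum_nonneg fun b _ => mul_nonneg (cand_nonneg _ _) (cand_nonneg _ _)

theorem cand_opU_le (h₁ : ∀ a, 0 ≤ (x₁ a).2) (h₂ : ∀ a, 0 ≤ (x₂ a).2)
    (a : F) : cand (opU x₁ x₂) a ≤ cand x₁ a + cand x₂ a := by
  have n1 := cand_nonneg x₁ a
  have n2 := cand_nonneg x₂ a
  by_cases h : 0 < (x₁ a).2
  · have : cand x₁ a = 1 := if_pos h
    linarith [cand_le_one (opU x₁ x₂) a]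
  by_cases h' : 0 < (x₂ a).2
  · have : cand x₂ a = 1 := if_pos h'
    linarith [cand_le_one (opU x₁ x₂) a]
  have z1 : (x₁ a).2 = 0 := le_antisymm (not_lt.1 h) (h₁ a)
  have z2 : (x₂ a).2 = 0 := le_antisymm (not_lt.1 h') (h₂ a)
  have : (opU x₁ x₂ a).2 = 0 := by
    simp only [opU, mix]
    split_ifs with i1 i2
    · simp [z1, z2]
    · have : a ∈ agree (fun b => (x₁ b).2) fun b => (x₂ b).2 := by rw [i2]; rfl
      exact absurd this.1 h
    · rfl
  rw [cand, this]
  simp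
  linarith

end Pair

end Candidates

/-! ### The recursion satisfied by the estimators in the limit of large fields. -/

/-- A finitely supported law of pairs (total weight, sum of the squares of the weights) of lists of
candidates. -/
structure Law where
  T : Type
  inst : Fintype T
  P : T → ℝ
  W : T → ℝ
  B : T → ℝ
  sum_P : ∑ t, P t = 1
  W_nonneg : ∀ t, 0 ≤ W t
  W_le_one : ∀ t, W t ≤ 1

attribute [instance] Law.inst

namespace Law

variable (L : Law)

theorem sum_prod_P : ∑ t : L.T × L.T, L.P t.1 * L.P t.2 = 1 := by
  rw [Fintype.sum_prod_type]
  simp [← Finset.mul_sum, L.sum_P]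

/-- The effect of the `V`-step. -/
def V : Law where
  T := L.T × L.T
  inst := inferInstance
  P t := L.P t.1 * L.P t.2
  W t := L.W t.1 * L.W t.2
  B t := L.B t.1 * L.B t.2
  sum_P := L.sum_prod_P
  W_nonneg _ := mul_nonneg (L.W_nonneg _) (L.W_nonneg _)
  W_le_one _ := mul_le_one₀ (L.W_le_one _) (L.W_nonneg _) (L.W_le_one _)

/-- The total weight after a mixture of two lists of candidates. -/
noncomputable def mixW (w w' : ℝ) : ℝ := (w + w' - 2 * w * w') / (1 - w * w')

/-- The sum of the squares of the weights after a mixture of two lists of candidates. -/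
noncomputable def mixB (w b w' b' : ℝ) : ℝ :=
  (b * (1 - w') ^ 2 + b' * (1 - w) ^ 2) / (1 - w * w') ^ 2

theorem mixW_nonneg {w w' : ℝ} (h0 : 0 ≤ w) (h1 : w ≤ 1) (h0' : 0 ≤ w') (h1' : w' ≤ 1) :
    0 ≤ mixW w w' :=
  div_nonneg (by nlinarith) (by nlinarith)

theorem mixW_le_one {w w' : ℝ} (h0 : 0 ≤ w) (h1 : w ≤ 1) (h1' : w' ≤ 1) :
    mixW w w' ≤ 1 :=
  div_le_one_of_le₀ (by nlinarith) (by nlinarith)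

/-- The effect of the `U`-step. -/
noncomputable def U : Law where
  T := (L.T × L.T) ⊕ (L.T × L.T)
  inst := inferInstance
  P := Sum.elim (fun t => L.P t.1 * L.P t.2 * (L.W t.1 * L.W t.2))
    fun t => L.P t.1 * L.P t.2 * (1 - L.W t.1 * L.W t.2)
  W := Sum.elim (fun _ => 1) fun t => mixW (L.W t.1) (L.W t.2)
  B := Sum.elim (fun _ => 1) fun t => mixB (L.W t.1) (L.B t.1) (L.W t.2) (L.B t.2)
  sum_P := by
    rw [Fintype.sum_sum_type, ← Finset.sum_add_distrib]
    refine Eq.trans ?_ L.sum_prod_P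
    refine Finset.sum_congr rfl fun t _ => ?_
    simp only [Sum.elim_inl, Sum.elim_inr]
    ring
  W_nonneg t := by
    rcases t with t | t
    · exact zero_le_one
    · exact mixW_nonneg (L.W_nonneg _) (L.W_le_one _) (L.W_nonneg _) (L.W_le_one _)
  W_le_one t := by
    rcases t with t | t
    · exact le_rfl
    · exact mixW_le_one (L.W_nonneg _) (L.W_le_one _) (L.W_le_one _)

noncomputable def step (b : Bool) : Law := if b then L.V else L.U

noncomputable def steps (l : List Bool) : Law := l.foldl step L

/-- The mean of a function of the two quantities. -/
def mean (φ : ℝ → ℝ → ℝ) : ℝ := ∑ t, L.P t * φ (L.W t) (L.B t)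

theorem mean_V (φ : ℝ → ℝ → ℝ) :
    L.V.mean φ = L.mean fun w b => L.mean fun w' b' => φ (w * w') (b * b') := by
  change ∑ t : L.T × L.T, L.P t.1 * L.P t.2 * φ (L.W t.1 * L.W t.2) (L.B t.1 * L.B t.2) = _
  rw [Fintype.sum_prod_type]
  simp only [mean, Finset.mul_sum, mul_assoc]

theorem mean_U (φ : ℝ → ℝ → ℝ) :
    L.U.mean φ = L.mean fun w b => L.mean fun w' b' =>
      w * w' * φ 1 1 + (1 - w * w') * φ (mixW w w') (mixB w b w' b') := by
  change ∑ t : (L.T × L.T) ⊕ (L.T × L.T), L.U.P t * φ (L.U.W t) (L.U.B t) = _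
  rw [Fintype.sum_sum_type, ← Finset.sum_add_distrib, Fintype.sum_prod_type]
  simp only [mean, Finset.mul_sum, U, Sum.elim_inl, Sum.elim_inr]
  refine Finset.sum_congr rfl fun _ _ => Finset.sum_congr rfl fun _ _ => ?_
  ring

end Law

open Classical in
/-- The restriction of a function to the outcomes of type `t`. -/
noncomputable def part {A T : Type} (tp : A → Option T) (t : T) (f : A → ℝ) (ω : A) : ℝ :=
  if tp ω = some t then f ω else 0

theorem part_nonneg {A T : Type} {tp : A → Option T} {t : T} {f : A → ℝ} (h : ∀ ω, 0 ≤ f ω)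
    (ω : A) : 0 ≤ part tp t f ω := by
  rw [part]; split_ifs <;> [exact h ω; exact le_rfl]

theorem part_le_one {A T : Type} {tp : A → Option T} {t : T} {f : A → ℝ} (h : ∀ ω, f ω ≤ 1)
    (ω : A) : part tp t f ω ≤ 1 := by
  rw [part]; split_ifs <;> [exact h ω; exact zero_le_one]

theorem part_pos {A T : Type} {tp : A → Option T} {t : T} {f : A → ℝ} {ω : A}
    (h : tp ω = some t) : part tp t f ω = f ω := if_pos h

theorem part_neg {A T : Type} {tp : A → Option T} {t : T} {f : A → ℝ} {ω : A}
    (h : ¬ tp ω = some t) : part tp t f ω = 0 := if_neg h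

theorem part_mul_part_eq_zero {A T : Type} {tp : A → Option T} {t₁ t₂ : T} {f₁ f₂ : A → ℝ}
    {ω₁ ω₂ : A} (h : ¬ (tp ω₁ = some t₁ ∧ tp ω₂ = some t₂)) :
    part tp t₁ f₁ ω₁ * part tp t₂ f₂ ω₂ = 0 := by
  rcases not_and_or.1 h with h | h
  · rw [part_neg h, zero_mul]
  · rw [part_neg h, mul_zero]

/-! ### Convergence of estimators to a limiting law. -/

section Approach

variable {F : ℕ → Type} [∀ m, Field (F m)] [∀ m, Fintype (F m)]

/-- Convergence of the estimators of a sequence of channels to a law: outside of events of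
probability tending to `0`, the outcomes are classified according to the value of the law. -/
structure Approach (C : ∀ m, Chan (F m)) (L : Law) where
  tp : ∀ m, (C m).A → Option L.T
  K : ℝ
  K_nonneg : 0 ≤ K
  cand_le : ∀ m ω, ∑ a, cand ((C m).vec ω) a ≤ K
  W_eq : ∀ m ω t, tp m ω = some t → ∑ a, ((C m).vec ω a).2 = L.W t
  B_eq : ∀ m ω t, tp m ω = some t → ∑ a, ((C m).vec ω a).2 ^ 2 = L.B t
  tendsto_one : ∀ t, Tendsto (fun m => ∑ ω, (C m).μ ω * part (tp m) t (fun _ => 1) ω) atTop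
    (𝓝 (L.P t))
  tendsto_cand : ∀ t, Tendsto (fun m => ∑ ω, (C m).μ ω *
    part (tp m) t (fun ω => cand ((C m).vec ω) 0) ω) atTop (𝓝 (L.P t * L.W t))
  tendsto_snd : ∀ t, Tendsto (fun m => ∑ ω, (C m).μ ω *
    part (tp m) t (fun ω => ((C m).vec ω 0).2) ω) atTop (𝓝 (L.P t * L.B t))

namespace Approach

variable {C : ∀ m, Chan (F m)} {L : Law} (S : Approach C L)
  (hF : Tendsto (fun m => Fintype.card (F m)) atTop atTop)

open Classical in
/-- Expectations over two independent outcomes, outside of collisions. -/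
noncomputable def pairMean (C : ∀ m, Chan (F m)) (m : ℕ) (f : (C m).A × (C m).A → ℝ) : ℝ :=
  ∑ ω : (C m).A × (C m).A, (C m).μ ω.1 * (C m).μ ω.2 *
    if Collide ((C m).vec ω.1) ((C m).vec ω.2) then 0 else f ω

/-- A statistic with values in `[0, 1]` whose mean converges. -/
structure IsStat (X : ∀ m, (C m).A → ℝ) (x : ℝ) : Prop where
  nonneg : ∀ m ω, 0 ≤ X m ω
  le_one : ∀ m ω, X m ω ≤ 1
  tendsto : Tendsto (fun m => ∑ ω, (C m).μ ω * X m ω) atTop (𝓝 x)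

/-- Independence gives the product of the means. Leaving out collisions changes it by at most their
probability, since the statistics have values in `[0, 1]`. -/
theorem tendsto_pairMean (S : Approach C L)
    (hF : Tendsto (fun m => Fintype.card (F m)) atTop atTop) {X Y : ∀ m, (C m).A → ℝ} {x y : ℝ}
    (hX : IsStat X x) (hY : IsStat Y y) :
    Tendsto (fun m => pairMean C m fun ω => X m ω.1 * Y m ω.2) atTop (𝓝 (x * y)) := by
  classical
  have hprod : Tendsto (fun m => ∑ ω : (C m).A × (C m).A, (C m).μ ω.1 * (C m).μ ω.2 *
      (X m ω.1 * Y m ω.2)) atTop (𝓝 (x * y)) := by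
    refine (hX.tendsto.mul hY.tendsto).congr fun m => ?_
    rw [Finset.sum_mul_sum, Fintype.sum_prod_type]
    refine Finset.sum_congr rfl fun _ _ => Finset.sum_congr rfl fun _ _ => by ring
  have hcol : Tendsto (fun m => (S.K ^ 2 + S.K ^ 4) / ((Fintype.card (F m) : ℝ) - 1)) atTop
      (𝓝 0) := by
    refine Tendsto.div_atTop tendsto_const_nhds ?_
    exact tendsto_atTop_add_const_right _ _ (tendsto_natCast_atTop_atTop.comp hF)
  have hdiff : Tendsto (fun m => ∑ ω : (C m).A × (C m).A, (C m).μ ω.1 * (C m).μ ω.2 *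
      (X m ω.1 * Y m ω.2) - pairMean C m fun ω => X m ω.1 * Y m ω.2) atTop (𝓝 0) := by
    refine squeeze_zero (fun m => ?_) (fun m => ?_) hcol
    · rw [pairMean, ← Finset.sum_sub_distrib]
      refine Finset.sum_nonneg fun ω _ => ?_
      have hw := mul_nonneg ((C m).μ_nonneg ω.1) ((C m).μ_nonneg ω.2)
      have hxy := mul_nonneg (hX.nonneg m ω.1) (hY.nonneg m ω.2)
      rw [← mul_sub]
      refine mul_nonneg hw ?_
      split_ifs <;> linarith
    · refine le_trans ?_ ((C m).prob_collide_le S.K_nonneg (S.cand_le m))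
      rw [pairMean, ← Finset.sum_sub_distrib]
      refine Finset.sum_le_sum fun ω _ => ?_
      have hw := mul_nonneg ((C m).μ_nonneg ω.1) ((C m).μ_nonneg ω.2)
      have hxy := mul_le_one₀ (hX.le_one m ω.1) (hY.nonneg m ω.2) (hY.le_one m ω.2)
      rw [← mul_sub]
      refine mul_le_mul_of_nonneg_left ?_ hw
      split_ifs <;> linarith
  simpa using hprod.sub hdiff

theorem pairMean_add (m : ℕ) (f g : (C m).A × (C m).A → ℝ) :
    pairMean C m (fun ω => f ω + g ω) = pairMean C m f + pairMean C m g := by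
  rw [pairMean, pairMean, pairMean, ← Finset.sum_add_distrib]
  refine Finset.sum_congr rfl fun ω _ => ?_
  split_ifs <;> ring

theorem pairMean_sub (m : ℕ) (f g : (C m).A × (C m).A → ℝ) :
    pairMean C m (fun ω => f ω - g ω) = pairMean C m f - pairMean C m g := by
  rw [pairMean, pairMean, pairMean, ← Finset.sum_sub_distrib]
  refine Finset.sum_congr rfl fun ω _ => ?_
  split_ifs <;> ring

theorem pairMean_const_mul (m : ℕ) (r : ℝ) (f : (C m).A × (C m).A → ℝ) :
    pairMean C m (fun ω => r * f ω) = r * pairMean C m f := by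
  rw [pairMean, pairMean, Finset.mul_sum]
  refine Finset.sum_congr rfl fun ω _ => ?_
  split_ifs <;> ring

/-- The mean of the a posteriori probability of the symbol sent is asymptotically at least that of
the law. -/
theorem eventually_le_mean (S : Approach C L) {δ : ℝ} (hδ : 0 < δ) :
    ∀ᶠ m in atTop, L.mean (fun _ b => b) - δ ≤ (C m).mean := by
  classical
  have h1 : Tendsto (fun m => ∑ t, ∑ ω, (C m).μ ω *
      part (S.tp m) t (fun ω => ((C m).vec ω 0).2) ω) atTop (𝓝 (∑ t, L.P t * L.B t)) :=
    tendsto_finsetSum _ fun t _ => S.tendsto_snd t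
  have h2 : Tendsto (fun m => ∑ t, (∑ ω, (C m).μ ω * part (S.tp m) t (fun _ => 1) ω) * L.B t)
      atTop (𝓝 (∑ t, L.P t * L.B t)) :=
    tendsto_finsetSum _ fun t _ => (S.tendsto_one t).mul_const _
  have h3 : Tendsto (fun m => ∑ t, ∑ ω, (C m).μ ω * part (S.tp m) t (fun _ => 1) ω)
      atTop (𝓝 (∑ t, L.P t)) :=
    tendsto_finsetSum _ fun t _ => S.tendsto_one t
  -- The limit of `2 E g(0) - E |g|²`, where the outcomes without a type contribute nothing to the
  -- first mean and at most their probability, which tends to `1 - ∑ P = 0`, to the second.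
  have h4 := ((h1.const_mul 2).sub h2).sub (h3.const_sub 1)
  rw [L.sum_P] at h4
  have h5 : 2 * (∑ t, L.P t * L.B t) - ∑ t, L.P t * L.B t - (1 - 1) = L.mean (fun _ b => b) := by
    rw [Law.mean]; ring
  rw [h5] at h4
  filter_upwards [h4.eventually (eventually_ge_nhds (sub_lt_self _ hδ))] with m hm
  refine hm.trans (le_trans ?_ (C m).le_mean)
  have hsum : ∀ (f : (C m).A → ℝ) (ω : (C m).A), ∑ t, part (S.tp m) t f ω =
      if (S.tp m ω).isSome then f ω else 0 := by
    intro f ω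
    rcases h : S.tp m ω with _ | t
    · simp [part, h]
    · simp [part, h]
  have e1 : ∑ t, ∑ ω, (C m).μ ω * part (S.tp m) t (fun ω => ((C m).vec ω 0).2) ω ≤
      ∑ ω, (C m).μ ω * ((C m).vec ω 0).2 := by
    rw [Finset.sum_comm]
    refine Finset.sum_le_sum fun ω _ => ?_
    rw [← Finset.mul_sum, hsum]
    refine mul_le_mul_of_nonneg_left ?_ ((C m).μ_nonneg ω)
    split_ifs <;> [exact le_rfl; exact (C m).snd_nonneg ω 0]
  have e2 : ∑ ω, (C m).μ ω * ∑ a, ((C m).vec ω a).2 ^ 2 ≤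
      (∑ t, (∑ ω, (C m).μ ω * part (S.tp m) t (fun _ => 1) ω) * L.B t) +
      ((∑ ω, (C m).μ ω) - ∑ t, ∑ ω, (C m).μ ω * part (S.tp m) t (fun _ => 1) ω) := by
    simp only [Finset.sum_mul]
    rw [Finset.sum_comm, Finset.sum_comm (γ := L.T) (f := fun t ω => (C m).μ ω * _),
      ← Finset.sum_sub_distrib, ← Finset.sum_add_distrib]
    refine Finset.sum_le_sum fun ω _ => ?_
    have h6 := (C m).μ_nonneg ω
    have h7 := (C m).sum_sq_snd_le_one ω
    simp only [mul_assoc]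
    rw [← Finset.mul_sum, ← Finset.mul_sum, hsum]
    rcases h : S.tp m ω with _ | t
    · simp [part, h]
      nlinarith
    · have : ∀ t', part (S.tp m) t' (fun _ => 1) ω * L.B t' = if t = t' then L.B t' else 0 := by
        intro t'
        simp [part, h]
      simp only [this, S.B_eq m ω t h]
      simp
  rw [(C m).sum_μ] at e2
  linarith

end Approach

end Approach

/-! ### Weights of the estimator after a step, in the absence of collisions. -/

section Cases

variable {F : Type} [Field F] [Fintype F] {x₁ x₂ : F → ℝ × ℝ}

theorem cand_opV_zero (h₁ : ∀ a, 0 ≤ (x₁ a).2) (h₂ : ∀ a, 0 ≤ (x₂ a).2) (h : ¬ Collide x₁ x₂) :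
    cand (opV x₁ x₂) 0 = cand x₁ 0 * cand x₂ 0 := by
  have h0 := opV_zero_of_not_collide h₁ h₂ h
  rcases (h₁ 0).eq_or_lt with e1 | e1
  · simp [cand, h0, ← e1]
  · rcases (h₂ 0).eq_or_lt with e2 | e2
    · simp [cand, h0, ← e2]
    · simp [cand, h0, e1, e2, mul_pos e1 e2]

theorem agree_eq_singleton (h : ¬ Collide x₁ x₂) (h₁ : 0 < (x₁ 0).2) (h₂ : 0 < (x₂ 0).2) :
    agree (fun b => (x₁ b).2) (fun b => (x₂ b).2) = {0} :=
  (agree_of_not_collide h).antisymm (Set.singleton_subset_iff.2 ⟨h₁, h₂⟩)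

theorem agree_eq_empty (h : ¬ Collide x₁ x₂) (h' : ¬ (0 < (x₁ 0).2 ∧ 0 < (x₂ 0).2)) :
    agree (fun b => (x₁ b).2) (fun b => (x₂ b).2) = ∅ := by
  rw [Set.eq_empty_iff_forall_notMem]
  intro b hb
  have : b = 0 := agree_of_not_collide h hb
  subst this
  exact h' hb

theorem opU_of_agree (h : agree (fun b => (x₁ b).2) (fun b => (x₂ b).2) = {0}) (a : F)
    [Decidable (a = 0)] : (opU x₁ x₂ a).2 = if a = 0 then 1 else 0 := by
  simp only [opU, mix, h]
  by_cases ha : a = 0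
  · simp [ha]
  · have : ¬ (0 : F) = a := fun h => ha h.symm
    simp [ha, this]

theorem sum_opU_of_agree (h : agree (fun b => (x₁ b).2) (fun b => (x₂ b).2) = {0}) :
    ∑ a, (opU x₁ x₂ a).2 = 1 ∧ ∑ a, (opU x₁ x₂ a).2 ^ 2 = 1 := by
  classical
  simp [opU_of_agree h]

theorem opU_of_agree_eq_empty (h : agree (fun b => (x₁ b).2) (fun b => (x₂ b).2) = ∅) (a : F) :
    (opU x₁ x₂ a).2 = ((x₁ a).2 * (1 - ∑ b, (x₂ b).2) + (x₂ a).2 * (1 - ∑ b, (x₁ b).2)) /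
      (1 - (∑ b, (x₁ b).2) * ∑ b, (x₂ b).2) := by
  simp only [opU, mix, h, if_true]

theorem sum_opU_of_agree_eq_empty (h : agree (fun b => (x₁ b).2) (fun b => (x₂ b).2) = ∅) :
    ∑ a, (opU x₁ x₂ a).2 = Law.mixW (∑ a, (x₁ a).2) (∑ a, (x₂ a).2) :=
  sum_mix_of_agree_eq_empty h

/-- Without a common candidate the two estimators have disjoint supports, so the cross terms vanish.
-/
theorem sum_sq_opU_of_agree_eq_empty (h₁ : ∀ a, 0 ≤ (x₁ a).2) (h₂ : ∀ a, 0 ≤ (x₂ a).2)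
    (h : agree (fun b => (x₁ b).2) (fun b => (x₂ b).2) = ∅) :
    ∑ a, (opU x₁ x₂ a).2 ^ 2 = Law.mixB (∑ a, (x₁ a).2) (∑ a, (x₁ a).2 ^ 2)
      (∑ a, (x₂ a).2) (∑ a, (x₂ a).2 ^ 2) := by
  simp only [opU_of_agree_eq_empty h, div_pow]
  have e : ∀ r s : ℝ, (∑ a, (x₁ a).2 ^ 2) * r + (∑ a, (x₂ a).2 ^ 2) * s =
      ∑ a, ((x₁ a).2 ^ 2 * r + (x₂ a).2 ^ 2 * s) := by
    intro r s
    rw [Finset.sum_add_distrib, Finset.sum_mul, Finset.sum_mul]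
  rw [← Finset.sum_div, Law.mixB, e]
  congr 1
  refine Finset.sum_congr rfl fun a _ => ?_
  have : (x₁ a).2 * (x₂ a).2 = 0 := by
    by_contra hne
    have : a ∈ agree (fun b => (x₁ b).2) (fun b => (x₂ b).2) :=
      ⟨(h₁ a).lt_of_ne' (left_ne_zero_of_mul hne), (h₂ a).lt_of_ne' (right_ne_zero_of_mul hne)⟩
    rw [h] at this
    exact this
  linear_combination 2 * (1 - ∑ b, (x₂ b).2) * (1 - ∑ b, (x₁ b).2) * this

end Cases

/-! ### Both steps preserve convergence to the limiting law. -/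

section Steps

variable {F : ℕ → Type} [∀ m, Field (F m)] [∀ m, Fintype (F m)]

namespace Approach

variable {C : ∀ m, Chan (F m)} {L : Law} (S : Approach C L)

open Classical in
/-- The types of the outcomes after a `V`-step. -/
noncomputable def tpV (m : ℕ) (ω : (C m).A × (C m).A) : Option (L.T × L.T) :=
  if Collide ((C m).vec ω.1) ((C m).vec ω.2) then none
  else (S.tp m ω.1).bind fun t₁ => (S.tp m ω.2).map fun t₂ => (t₁, t₂)

open Classical in
/-- The types of the outcomes after a `U`-step. -/
noncomputable def tpU (m : ℕ) (ω : (C m).A × (C m).A) : Option ((L.T × L.T) ⊕ (L.T × L.T)) :=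
  if Collide ((C m).vec ω.1) ((C m).vec ω.2) then none
  else (S.tp m ω.1).bind fun t₁ => (S.tp m ω.2).map fun t₂ =>
    if 0 < ((C m).vec ω.1 0).2 ∧ 0 < ((C m).vec ω.2 0).2 then Sum.inl (t₁, t₂)
    else Sum.inr (t₁, t₂)

theorem tpV_eq_some {m : ℕ} {ω : (C m).A × (C m).A} {t : L.T × L.T} : S.tpV m ω = some t ↔
    ¬ Collide ((C m).vec ω.1) ((C m).vec ω.2) ∧ S.tp m ω.1 = some t.1 ∧ S.tp m ω.2 = some t.2 := by
  rw [tpV]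
  split_ifs with h
  · simp [h]
  · rcases h1 : S.tp m ω.1 with _ | t₁ <;> rcases h2 : S.tp m ω.2 with _ | t₂ <;>
      simp [h, Prod.ext_iff]

theorem tpU_eq_inl {m : ℕ} {ω : (C m).A × (C m).A} {t : L.T × L.T} :
    S.tpU m ω = some (Sum.inl t) ↔ ¬ Collide ((C m).vec ω.1) ((C m).vec ω.2) ∧
      (S.tp m ω.1 = some t.1 ∧ S.tp m ω.2 = some t.2) ∧
      0 < ((C m).vec ω.1 0).2 ∧ 0 < ((C m).vec ω.2 0).2 := by
  rw [tpU]
  split_ifs with h h'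
  · simp [h]
  · rcases h1 : S.tp m ω.1 with _ | t₁ <;> rcases h2 : S.tp m ω.2 with _ | t₂ <;>
      simp [h, h', Prod.ext_iff]
  · rcases h1 : S.tp m ω.1 with _ | t₁ <;> rcases h2 : S.tp m ω.2 with _ | t₂ <;>
      simp [h']

theorem tpU_eq_inr {m : ℕ} {ω : (C m).A × (C m).A} {t : L.T × L.T} :
    S.tpU m ω = some (Sum.inr t) ↔ ¬ Collide ((C m).vec ω.1) ((C m).vec ω.2) ∧
      (S.tp m ω.1 = some t.1 ∧ S.tp m ω.2 = some t.2) ∧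
      ¬ (0 < ((C m).vec ω.1 0).2 ∧ 0 < ((C m).vec ω.2 0).2) := by
  rw [tpU]
  split_ifs with h h'
  · simp [h]
  · rcases h1 : S.tp m ω.1 with _ | t₁ <;> rcases h2 : S.tp m ω.2 with _ | t₂ <;>
      simp [h']
  · rcases h1 : S.tp m ω.1 with _ | t₁ <;> rcases h2 : S.tp m ω.2 with _ | t₂ <;>
      simp [h, h', Prod.ext_iff]

/-- The three statistics of an outcome. -/
noncomputable def one (m : ℕ) (t : L.T) : (C m).A → ℝ := part (S.tp m) t fun _ => 1

noncomputable def cnd (m : ℕ) (t : L.T) : (C m).A → ℝ :=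
  part (S.tp m) t fun ω => cand ((C m).vec ω) 0

noncomputable def val (m : ℕ) (t : L.T) : (C m).A → ℝ :=
  part (S.tp m) t fun ω => ((C m).vec ω 0).2

theorem isStat_one (t : L.T) : IsStat (fun m => S.one m t) (L.P t) where
  nonneg _ ω := part_nonneg (fun _ => zero_le_one) ω
  le_one _ ω := part_le_one (fun _ => le_rfl) ω
  tendsto := S.tendsto_one t

theorem isStat_cnd (t : L.T) : IsStat (fun m => S.cnd m t) (L.P t * L.W t) where
  nonneg _ ω := part_nonneg (fun _ => cand_nonneg _ _) ω
  le_one _ ω := part_le_one (fun _ => cand_le_one _ _) ω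
  tendsto := S.tendsto_cand t

theorem isStat_val (t : L.T) : IsStat (fun m => S.val m t) (L.P t * L.B t) where
  nonneg m ω := part_nonneg (fun ω => (C m).snd_nonneg ω 0) ω
  le_one m ω := part_le_one (fun ω => (C m).snd_le_one ω 0) ω
  tendsto := S.tendsto_snd t

theorem part_tpV_one (m : ℕ) (t : L.T × L.T) (ω : (C m).A × (C m).A)
    (h : ¬ Collide ((C m).vec ω.1) ((C m).vec ω.2)) :
    S.one m t.1 ω.1 * S.one m t.2 ω.2 = part (S.tpV m) t (fun _ => 1) ω := by
  by_cases ht : S.tp m ω.1 = some t.1 ∧ S.tp m ω.2 = some t.2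
  · rw [part_pos (S.tpV_eq_some.2 ⟨h, ht⟩), one, one, part_pos ht.1, part_pos ht.2]
    exact (one_mul 1)
  · rw [part_neg fun hn => ht (S.tpV_eq_some.1 hn).2]
    exact part_mul_part_eq_zero ht

theorem part_tpV_cand (m : ℕ) (t : L.T × L.T) (ω : (C m).A × (C m).A)
    (h : ¬ Collide ((C m).vec ω.1) ((C m).vec ω.2)) :
    S.cnd m t.1 ω.1 * S.cnd m t.2 ω.2 = part (S.tpV m) t (fun ω => cand ((C m).V.vec ω) 0) ω := by
  by_cases ht : S.tp m ω.1 = some t.1 ∧ S.tp m ω.2 = some t.2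
  · rw [part_pos (S.tpV_eq_some.2 ⟨h, ht⟩), cnd, cnd, part_pos ht.1, part_pos ht.2]
    exact (cand_opV_zero ((C m).snd_nonneg ω.1) ((C m).snd_nonneg ω.2) h).symm
  · rw [part_neg fun hn => ht (S.tpV_eq_some.1 hn).2]
    exact part_mul_part_eq_zero ht

theorem part_tpV_val (m : ℕ) (t : L.T × L.T) (ω : (C m).A × (C m).A)
    (h : ¬ Collide ((C m).vec ω.1) ((C m).vec ω.2)) :
    S.val m t.1 ω.1 * S.val m t.2 ω.2 = part (S.tpV m) t (fun ω => ((C m).V.vec ω 0).2) ω := by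
  by_cases ht : S.tp m ω.1 = some t.1 ∧ S.tp m ω.2 = some t.2
  · rw [part_pos (S.tpV_eq_some.2 ⟨h, ht⟩), val, val, part_pos ht.1, part_pos ht.2]
    exact (opV_zero_of_not_collide ((C m).snd_nonneg ω.1) ((C m).snd_nonneg ω.2) h).symm
  · rw [part_neg fun hn => ht (S.tpV_eq_some.1 hn).2]
    exact part_mul_part_eq_zero ht

theorem pairMean_eq_sum (m : ℕ) {T : Type} (tp : (C m).A × (C m).A → Option T)
    (htp : ∀ ω, Collide ((C m).vec ω.1) ((C m).vec ω.2) → tp ω = none) (t : T)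
    (f g : (C m).A × (C m).A → ℝ)
    (h : ∀ ω, ¬ Collide ((C m).vec ω.1) ((C m).vec ω.2) → g ω = part tp t f ω) :
    pairMean C m g = ∑ ω : (C m).A × (C m).A, (C m).μ ω.1 * (C m).μ ω.2 * part tp t f ω := by
  refine Finset.sum_congr rfl fun ω _ => congrArg _ ?_
  split_ifs with hc
  · simp [part, htp ω hc]
  · exact h ω hc

theorem tpV_eq_none (m : ℕ) (ω : (C m).A × (C m).A)
    (h : Collide ((C m).vec ω.1) ((C m).vec ω.2)) : S.tpV m ω = none := if_pos h

theorem tpU_eq_none (m : ℕ) (ω : (C m).A × (C m).A)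
    (h : Collide ((C m).vec ω.1) ((C m).vec ω.2)) : S.tpU m ω = none := if_pos h

/-- Convergence of estimators is preserved by the `V`-step. -/
noncomputable def V (hF : Tendsto (fun m => Fintype.card (F m)) atTop atTop) :
    Approach (fun m => (C m).V) L.V where
  tp := S.tpV
  K := S.K * S.K
  K_nonneg := mul_nonneg S.K_nonneg S.K_nonneg
  cand_le m ω := by
    refine (Finset.sum_le_sum fun a _ => cand_opV_le ((C m).snd_nonneg ω.1)
      ((C m).snd_nonneg ω.2) a).trans ?_
    rw [sum_sum_corr]
    exact mul_le_mul (S.cand_le m _) (S.cand_le m _)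
      (Finset.sum_nonneg fun _ _ => cand_nonneg _ _) S.K_nonneg
  W_eq m ω t ht := by
    obtain ⟨-, h1, h2⟩ := S.tpV_eq_some.1 ht
    change _ = L.W t.1 * L.W t.2
    rw [← S.W_eq m _ _ h1, ← S.W_eq m _ _ h2, ← sum_sum_corr]
    rfl
  B_eq m ω t ht := by
    obtain ⟨h, h1, h2⟩ := S.tpV_eq_some.1 ht
    change _ = L.B t.1 * L.B t.2
    rw [← S.B_eq m _ _ h1, ← S.B_eq m _ _ h2]
    exact sum_sq_opV_of_not_collide ((C m).snd_nonneg ω.1) ((C m).snd_nonneg ω.2) h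
  tendsto_one t := (S.tendsto_pairMean hF (S.isStat_one t.1) (S.isStat_one t.2)).congr fun m =>
    pairMean_eq_sum m (S.tpV m) (S.tpV_eq_none m) t _ _ (S.part_tpV_one m t)
  tendsto_cand t := by
    have h := (S.tendsto_pairMean hF (S.isStat_cnd t.1) (S.isStat_cnd t.2)).congr fun m =>
      pairMean_eq_sum m (S.tpV m) (S.tpV_eq_none m) t _ _ (S.part_tpV_cand m t)
    rw [mul_mul_mul_comm] at h
    exact h
  tendsto_snd t := by
    have h := (S.tendsto_pairMean hF (S.isStat_val t.1) (S.isStat_val t.2)).congr fun m =>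
      pairMean_eq_sum m (S.tpV m) (S.tpV_eq_none m) t _ _ (S.part_tpV_val m t)
    rw [mul_mul_mul_comm] at h
    exact h

/-- Outside of collisions the type is `Sum.inl` exactly when `0` is a candidate of both estimators,
which the product of the two indicators detects. The symbol sent is then the only common candidate
and is believed. -/
theorem part_tpU_inl (m : ℕ) (t : L.T × L.T) (f : (C m).A × (C m).A → ℝ)
    (hf : ∀ ω, agree (fun b => ((C m).vec ω.1 b).2) (fun b => ((C m).vec ω.2 b).2) = {0} →
      f ω = 1) (ω : (C m).A × (C m).A) (h : ¬ Collide ((C m).vec ω.1) ((C m).vec ω.2)) :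
    S.cnd m t.1 ω.1 * S.cnd m t.2 ω.2 = part (S.tpU m) (Sum.inl t) f ω := by
  by_cases ht : S.tp m ω.1 = some t.1 ∧ S.tp m ω.2 = some t.2
  · rw [cnd, cnd, part_pos ht.1, part_pos ht.2]
    by_cases h' : 0 < ((C m).vec ω.1 0).2 ∧ 0 < ((C m).vec ω.2 0).2
    · rw [part_pos (S.tpU_eq_inl.2 ⟨h, ht, h'⟩), hf ω (agree_eq_singleton h h'.1 h'.2)]
      simp [cand, h'.1, h'.2]
    · rw [part_neg fun hn => h' (S.tpU_eq_inl.1 hn).2.2]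
      rcases not_and_or.1 h' with h' | h' <;> simp [cand, h']
  · rw [part_neg fun hn => ht (S.tpU_eq_inl.1 hn).2.1]
    exact part_mul_part_eq_zero ht

theorem part_tpU_inr_one (m : ℕ) (t : L.T × L.T) (ω : (C m).A × (C m).A)
    (h : ¬ Collide ((C m).vec ω.1) ((C m).vec ω.2)) :
    S.one m t.1 ω.1 * S.one m t.2 ω.2 - S.cnd m t.1 ω.1 * S.cnd m t.2 ω.2 =
      part (S.tpU m) (Sum.inr t) (fun _ => 1) ω := by
  by_cases ht : S.tp m ω.1 = some t.1 ∧ S.tp m ω.2 = some t.2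
  · rw [cnd, cnd, one, one, part_pos ht.1, part_pos ht.2, part_pos ht.1, part_pos ht.2]
    by_cases h' : 0 < ((C m).vec ω.1 0).2 ∧ 0 < ((C m).vec ω.2 0).2
    · rw [part_neg fun hn => (S.tpU_eq_inr.1 hn).2.2 h']
      simp [cand, h'.1, h'.2]
    · rw [part_pos (S.tpU_eq_inr.2 ⟨h, ht, h'⟩)]
      rcases not_and_or.1 h' with h' | h' <;> simp [cand, h']
  · rw [part_neg fun hn => ht (S.tpU_eq_inr.1 hn).2.1]
    rw [one, one, cnd, cnd, part_mul_part_eq_zero ht, part_mul_part_eq_zero ht, sub_zero]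

/-- The factor by which the weight of a candidate is multiplied in a mixture with a list of
candidates of weight `w'`. -/
noncomputable def fac (w w' : ℝ) : ℝ := (1 - w') / (1 - w * w')

open Classical in
/-- The indicator of the positivity of `fac`. -/
noncomputable def posFac (w w' : ℝ) : ℝ := if 0 < fac w w' then 1 else 0

/-- The factor `fac` can vanish only if `w' = 1`, and then `1 - w'` vanishes as well. So a candidate
discarded by the mixture plays no role in the limit. -/
theorem posFac_mul {w w' : ℝ} (h0 : 0 ≤ w) (h1 : w ≤ 1) (h1' : w' ≤ 1)
    (h : 1 - w * w' ≠ 0) : posFac w w' * (1 - w') = 1 - w' := by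
  rcases h1'.eq_or_lt with e | e
  · rw [e, sub_self, mul_zero]
  · have h2 : 0 < 1 - w * w' := by
      refine lt_of_le_of_ne ?_ h.symm
      nlinarith
    have hf : 0 < fac w w' := div_pos (by linarith) h2
    rw [posFac, if_pos hf, one_mul]

theorem opU_zero {m : ℕ} {t : L.T × L.T} {ω : (C m).A × (C m).A}
    (ht : S.tp m ω.1 = some t.1 ∧ S.tp m ω.2 = some t.2)
    (h : ¬ Collide ((C m).vec ω.1) ((C m).vec ω.2))
    (h' : ¬ (0 < ((C m).vec ω.1 0).2 ∧ 0 < ((C m).vec ω.2 0).2)) :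
    ((C m).U.vec ω 0).2 = fac (L.W t.1) (L.W t.2) * ((C m).vec ω.1 0).2 +
      fac (L.W t.2) (L.W t.1) * ((C m).vec ω.2 0).2 := by
  refine (opU_of_agree_eq_empty (agree_eq_empty h h') 0).trans ?_
  rw [S.W_eq m _ _ ht.1, S.W_eq m _ _ ht.2, fac, fac, mul_comm (L.W t.2) (L.W t.1)]
  ring

/-- When `0` is not a common candidate, at most one of the two estimators is non-zero at `0`. The
difference of `one` and `cnd` for the other outcome is the indicator that its estimator vanishes at
`0`. -/
theorem part_tpU_inr_val (m : ℕ) (t : L.T × L.T) (ω : (C m).A × (C m).A)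
    (h : ¬ Collide ((C m).vec ω.1) ((C m).vec ω.2)) :
    fac (L.W t.1) (L.W t.2) *
        (S.val m t.1 ω.1 * S.one m t.2 ω.2 - S.val m t.1 ω.1 * S.cnd m t.2 ω.2) +
      fac (L.W t.2) (L.W t.1) *
        (S.one m t.1 ω.1 * S.val m t.2 ω.2 - S.cnd m t.1 ω.1 * S.val m t.2 ω.2) =
      part (S.tpU m) (Sum.inr t) (fun ω => ((C m).U.vec ω 0).2) ω := by
  by_cases ht : S.tp m ω.1 = some t.1 ∧ S.tp m ω.2 = some t.2
  · simp only [cnd, one, val, part_pos ht.1, part_pos ht.2]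
    by_cases h' : 0 < ((C m).vec ω.1 0).2 ∧ 0 < ((C m).vec ω.2 0).2
    · rw [part_neg fun hn => (S.tpU_eq_inr.1 hn).2.2 h']
      simp [cand, h'.1, h'.2]
    · rw [part_pos (S.tpU_eq_inr.2 ⟨h, ht, h'⟩), S.opU_zero ht h h']
      rcases not_and_or.1 h' with h' | h'
      · have h0 := le_antisymm (not_lt.1 h') ((C m).snd_nonneg _ _)
        simp [cand, h0]
      · have h0 := le_antisymm (not_lt.1 h') ((C m).snd_nonneg _ _)
        simp [cand, h0]
  · rw [part_neg fun hn => ht (S.tpU_eq_inr.1 hn).2.1]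
    simp only [one, cnd, val, part_mul_part_eq_zero ht, sub_zero, mul_zero, add_zero]

theorem part_tpU_inr_cand (m : ℕ) (t : L.T × L.T) (ω : (C m).A × (C m).A)
    (h : ¬ Collide ((C m).vec ω.1) ((C m).vec ω.2)) :
    posFac (L.W t.1) (L.W t.2) *
        (S.cnd m t.1 ω.1 * S.one m t.2 ω.2 - S.cnd m t.1 ω.1 * S.cnd m t.2 ω.2) +
      posFac (L.W t.2) (L.W t.1) *
        (S.one m t.1 ω.1 * S.cnd m t.2 ω.2 - S.cnd m t.1 ω.1 * S.cnd m t.2 ω.2) =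
      part (S.tpU m) (Sum.inr t) (fun ω => cand ((C m).U.vec ω) 0) ω := by
  by_cases ht : S.tp m ω.1 = some t.1 ∧ S.tp m ω.2 = some t.2
  · simp only [cnd, one, part_pos ht.1, part_pos ht.2]
    by_cases h' : 0 < ((C m).vec ω.1 0).2 ∧ 0 < ((C m).vec ω.2 0).2
    · rw [part_neg fun hn => (S.tpU_eq_inr.1 hn).2.2 h']
      simp [cand, h'.1, h'.2]
    · rw [part_pos (S.tpU_eq_inr.2 ⟨h, ht, h'⟩)]
      have hU := S.opU_zero ht h h'
      by_cases g1 : 0 < ((C m).vec ω.1 0).2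
      · have g2 := le_antisymm (not_lt.1 fun g => h' ⟨g1, g⟩) ((C m).snd_nonneg ω.2 0)
        simp [cand, posFac, hU, g2, g1, mul_pos_iff_of_pos_right]
      · have h0 := le_antisymm (not_lt.1 g1) ((C m).snd_nonneg _ _)
        by_cases g2 : 0 < ((C m).vec ω.2 0).2
        · simp [cand, posFac, hU, g2, h0, mul_pos_iff_of_pos_right]
        · have g3 := le_antisymm (not_lt.1 g2) ((C m).snd_nonneg _ _)
          simp [cand, hU, h0, g3]
  · rw [part_neg fun hn => ht (S.tpU_eq_inr.1 hn).2.1]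
    simp only [one, cnd, part_mul_part_eq_zero ht, sub_zero, mul_zero, add_zero]

theorem tendsto_combination (S : Approach C L)
    (hF : Tendsto (fun m => Fintype.card (F m)) atTop atTop)
    {X₁ Y₁ Y₂ Z₁ Z₂ X₂ : ∀ m, (C m).A → ℝ} {x₁ y₁ y₂ z₁ z₂ x₂ : ℝ}
    (hX₁ : IsStat X₁ x₁) (hY₁ : IsStat Y₁ y₁) (hY₂ : IsStat Y₂ y₂) (hZ₁ : IsStat Z₁ z₁)
    (hZ₂ : IsStat Z₂ z₂) (hX₂ : IsStat X₂ x₂) (r s : ℝ) :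
    Tendsto (fun m => pairMean C m fun ω =>
      r * (X₁ m ω.1 * Y₂ m ω.2 - X₁ m ω.1 * Z₂ m ω.2) +
        s * (Y₁ m ω.1 * X₂ m ω.2 - Z₁ m ω.1 * X₂ m ω.2)) atTop
      (𝓝 (r * (x₁ * y₂ - x₁ * z₂) + s * (y₁ * x₂ - z₁ * x₂))) := by
  simp only [pairMean_add, pairMean_const_mul, pairMean_sub]
  exact (((S.tendsto_pairMean hF hX₁ hY₂).sub (S.tendsto_pairMean hF hX₁ hZ₂)).const_mul r).add
    (((S.tendsto_pairMean hF hY₁ hX₂).sub (S.tendsto_pairMean hF hZ₁ hX₂)).const_mul s)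

theorem fac_mixW (P P' : ℝ) {w w' : ℝ} (h0 : 0 ≤ w) (h1 : w ≤ 1) (h0' : 0 ≤ w') (h1' : w' ≤ 1) :
    posFac w w' * (P * w * P' - P * w * (P' * w')) +
      posFac w' w * (P * (P' * w') - P * w * (P' * w')) =
      P * P' * (1 - w * w') * Law.mixW w w' := by
  -- In the degenerate case `w = w' = 1` the denominators vanish and both sides are `0`.
  by_cases h : 1 - w * w' = 0
  · have h2 : 1 - w' * w = 0 := by rw [mul_comm]; exact h
    simp [posFac, fac, h, h2]
  · have e1 := posFac_mul h0 h1 h1' h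
    have e2 := posFac_mul h0' h1' h1 (by rwa [mul_comm w' w])
    rw [Law.mixW, mul_assoc (P * P'), mul_div_cancel₀ _ h]
    linear_combination (P * w * P') * e1 + (P * P' * w') * e2

theorem fac_mixB (P P' w w' b b' : ℝ) :
    fac w w' * (P * b * P' - P * b * (P' * w')) +
      fac w' w * (P * (P' * b') - P * w * (P' * b')) =
      P * P' * (1 - w * w') * Law.mixB w b w' b' := by
  rw [fac, fac, Law.mixB, mul_comm w' w]
  by_cases h : 1 - w * w' = 0
  · simp [h]
  · field_simp

/-- Convergence of estimators is preserved by the `U`-step. -/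
noncomputable def U (hF : Tendsto (fun m => Fintype.card (F m)) atTop atTop) :
    Approach (fun m => (C m).U) L.U where
  tp := S.tpU
  K := S.K + S.K
  K_nonneg := add_nonneg S.K_nonneg S.K_nonneg
  cand_le m ω := by
    refine (Finset.sum_le_sum fun a _ => cand_opU_le ((C m).snd_nonneg ω.1)
      ((C m).snd_nonneg ω.2) a).trans ?_
    rw [Finset.sum_add_distrib]
    exact add_le_add (S.cand_le m _) (S.cand_le m _)
  W_eq m ω t ht := by
    rcases t with t | t
    · obtain ⟨h, ht, h'⟩ := S.tpU_eq_inl.1 ht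
      exact (sum_opU_of_agree (agree_eq_singleton h h'.1 h'.2)).1
    · obtain ⟨h, ht, h'⟩ := S.tpU_eq_inr.1 ht
      change _ = Law.mixW (L.W t.1) (L.W t.2)
      rw [← S.W_eq m _ _ ht.1, ← S.W_eq m _ _ ht.2]
      exact sum_opU_of_agree_eq_empty (agree_eq_empty h h')
  B_eq m ω t ht := by
    rcases t with t | t
    · obtain ⟨h, ht, h'⟩ := S.tpU_eq_inl.1 ht
      exact (sum_opU_of_agree (agree_eq_singleton h h'.1 h'.2)).2
    · obtain ⟨h, ht, h'⟩ := S.tpU_eq_inr.1 ht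
      change _ = Law.mixB (L.W t.1) (L.B t.1) (L.W t.2) (L.B t.2)
      rw [← S.W_eq m _ _ ht.1, ← S.W_eq m _ _ ht.2, ← S.B_eq m _ _ ht.1, ← S.B_eq m _ _ ht.2]
      exact sum_sq_opU_of_agree_eq_empty ((C m).snd_nonneg ω.1) ((C m).snd_nonneg ω.2)
        (agree_eq_empty h h')
  tendsto_one t := by
    rcases t with t | t
    · have h := (S.tendsto_pairMean hF (S.isStat_cnd t.1) (S.isStat_cnd t.2)).congr fun m =>
        pairMean_eq_sum m (S.tpU m) (S.tpU_eq_none m) (Sum.inl t) _ _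
          (S.part_tpU_inl m t (fun _ => 1) fun _ _ => rfl)
      rw [mul_mul_mul_comm] at h
      exact h
    · have h := ((S.tendsto_pairMean hF (S.isStat_one t.1) (S.isStat_one t.2)).sub
        (S.tendsto_pairMean hF (S.isStat_cnd t.1) (S.isStat_cnd t.2))).congr fun m =>
        (pairMean_sub m _ _).symm.trans (pairMean_eq_sum m (S.tpU m) (S.tpU_eq_none m)
          (Sum.inr t) _ _ (S.part_tpU_inr_one m t))
      rw [mul_mul_mul_comm, ← mul_one_sub] at h
      exact h
  tendsto_cand t := by
    rcases t with t | t
    · have h := (S.tendsto_pairMean hF (S.isStat_cnd t.1) (S.isStat_cnd t.2)).congr fun m =>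
        pairMean_eq_sum m (S.tpU m) (S.tpU_eq_none m) (Sum.inl t) _ _
          (S.part_tpU_inl m t (fun ω => cand ((C m).U.vec ω) 0) fun ω hω => by
            classical
            have := opU_of_agree hω 0
            simp [cand, Chan.U, this])
      rw [mul_mul_mul_comm, ← mul_one (L.P t.1 * L.P t.2 * _)] at h
      exact h
    · have h := (S.tendsto_combination hF (S.isStat_cnd t.1) (S.isStat_one t.1) (S.isStat_one t.2)
        (S.isStat_cnd t.1) (S.isStat_cnd t.2) (S.isStat_cnd t.2) _ _).congr fun m =>
        pairMean_eq_sum m (S.tpU m) (S.tpU_eq_none m) (Sum.inr t) _ _ (S.part_tpU_inr_cand m t)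
      rw [fac_mixW _ _ (L.W_nonneg _) (L.W_le_one _) (L.W_nonneg _) (L.W_le_one _)] at h
      exact h
  tendsto_snd t := by
    rcases t with t | t
    · have h := (S.tendsto_pairMean hF (S.isStat_cnd t.1) (S.isStat_cnd t.2)).congr fun m =>
        pairMean_eq_sum m (S.tpU m) (S.tpU_eq_none m) (Sum.inl t) _ _
          (S.part_tpU_inl m t (fun ω => ((C m).U.vec ω 0).2) fun ω hω => by
            classical
            have := opU_of_agree hω 0
            simp [Chan.U, this])
      rw [mul_mul_mul_comm, ← mul_one (L.P t.1 * L.P t.2 * _)] at h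
      exact h
    · have h := (S.tendsto_combination hF (S.isStat_val t.1) (S.isStat_one t.1) (S.isStat_one t.2)
        (S.isStat_cnd t.1) (S.isStat_cnd t.2) (S.isStat_val t.2) _ _).congr fun m =>
        pairMean_eq_sum m (S.tpU m) (S.tpU_eq_none m) (Sum.inr t) _ _ (S.part_tpU_inr_val m t)
      rw [fac_mixB] at h
      exact h

/-- Convergence of estimators is preserved by all steps. -/
theorem nonempty_steps (hF : Tendsto (fun m => Fintype.card (F m)) atTop atTop) (l : List Bool) :
    ∀ (C : ∀ m, Chan (F m)) (L : Law), Approach C L →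
      Nonempty (Approach (fun m => (C m).steps l) (L.steps l)) := by
  induction l with
  | nil => intro C L S; exact ⟨S⟩
  | cons b l ih =>
    intro C L S
    cases b
    · exact ih _ _ (S.U hF)
    · exact ih _ _ (S.V hF)

end Approach

end Steps

/-! ### The estimator of the symmetric channel. -/

section Base

/-- The law of the estimator of the symmetric channel. -/
noncomputable def Law.base (p : ℝ) (hp : p ∈ Set.Icc (0 : ℝ) 1) : Law where
  T := Unit
  inst := inferInstance
  P _ := 1
  W _ := 1 - p
  B _ := (1 - p) ^ 2
  sum_P := by simp
  W_nonneg _ := by linarith [hp.2]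
  W_le_one _ := by linarith [hp.1]

theorem part_some_unit {A : Type} (t : Unit) (f : A → ℝ) (ω : A) :
    part (fun _ => some ()) t f ω = f ω :=
  part_pos rfl

section SymChan

variable {K : Type} [Field K] [Fintype K]

theorem symChan_mean (p : ℝ) (f : K → ℝ) (hf : ∀ y, y ≠ 0 → f y = 0) :
    ∑ y : K, noise p y * f y = (1 - p) * f 0 := by
  rw [Finset.sum_eq_single 0]
  · simp [noise]
  · intro y _ hy
    rw [hf y hy, mul_zero]
  · simp

variable (p : ℝ) (hp : p ∈ Set.Icc (0 : ℝ) 1) (y : K)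

open Classical in
theorem symChan_vec_snd (a : K) :
    ((symChan K p hp).vec y a).2 = if y - a = 0 then 1 - p else 0 := rfl

theorem sum_cand_symChan_le : ∑ a, cand ((symChan K p hp).vec y) a ≤ 1 := by
  classical
  refine (Finset.sum_le_sum (g := fun a : K => if a = y then (1 : ℝ) else 0)
    fun a _ => ?_).trans ?_
  · by_cases h : a = y
    · rw [if_pos h]; exact cand_le_one _ _
    · have : ¬ y - a = 0 := fun h' => h (sub_eq_zero.1 h').symm
      simp [cand, symChan_vec_snd, this, h]
  · simp

theorem sum_symChan_snd : ∑ a, ((symChan K p hp).vec y a).2 = 1 - p := by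
  classical
  simp [symChan_vec_snd, sub_eq_zero]

theorem sum_sq_symChan_snd : ∑ a, ((symChan K p hp).vec y a).2 ^ 2 = (1 - p) ^ 2 := by
  classical
  simp [symChan_vec_snd, sub_eq_zero, ite_pow]

theorem sum_noise_mul_cand : ∑ y : K, noise p y * cand ((symChan K p hp).vec y) 0 = 1 - p := by
  refine (symChan_mean p (fun y : K => cand ((symChan K p hp).vec y) 0)
    fun y hy => by simp [cand, symChan_vec_snd, hy]).trans ?_
  rcases (sub_nonneg.2 hp.2).eq_or_lt with h | h
  · simp [← h]
  · have : p < 1 := by linarith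
    simp [cand, symChan_vec_snd, this]

theorem sum_noise_mul_snd :
    ∑ y : K, noise p y * ((symChan K p hp).vec y 0).2 = (1 - p) ^ 2 := by
  refine (symChan_mean p (fun y : K => ((symChan K p hp).vec y 0).2)
    fun y hy => by simp [symChan_vec_snd, hy]).trans ?_
  simp [symChan_vec_snd, sq]

end SymChan

variable {F : ℕ → Type} [∀ m, Field (F m)] [∀ m, Fintype (F m)]

/-- The estimators of the symmetric channels converge. -/
noncomputable def Approach.base (p : ℝ) (hp : p ∈ Set.Icc (0 : ℝ) 1) :
    Approach (fun m => symChan (F m) p hp) (Law.base p hp) where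
  tp _ _ := some ()
  K := 1
  K_nonneg := zero_le_one
  cand_le m y := sum_cand_symChan_le (K := F m) p hp y
  W_eq m y t _ := sum_symChan_snd (K := F m) p hp y
  B_eq m y t _ := sum_sq_symChan_snd (K := F m) p hp y
  tendsto_one t := by
    refine tendsto_const_nhds.congr fun m => ?_
    refine (symChan (F m) p hp).sum_μ.symm.trans (Finset.sum_congr rfl fun ω _ => ?_)
    exact ((congrArg ((symChan (F m) p hp).μ ω * ·) (part_some_unit t _ ω)).trans (mul_one _)).symm
  tendsto_cand t := by
    refine tendsto_const_nhds.congr fun m => ?_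
    refine (one_mul _).trans <| (sum_noise_mul_cand (K := F m) p hp).symm.trans
      (Finset.sum_congr rfl fun ω _ => ?_)
    exact (congrArg ((symChan (F m) p hp).μ ω * ·) (part_some_unit t
      (fun ω => cand ((symChan (F m) p hp).vec ω) 0) ω)).symm
  tendsto_snd t := by
    refine tendsto_const_nhds.congr fun m => ?_
    refine (one_mul _).trans <| (sum_noise_mul_snd (K := F m) p hp).symm.trans
      (Finset.sum_congr rfl fun ω _ => ?_)
    exact (congrArg ((symChan (F m) p hp).μ ω * ·) (part_some_unit t
      (fun ω => ((symChan (F m) p hp).vec ω 0).2) ω)).symm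

end Base

/-! ### Exact values of the recursion. -/

namespace Law

variable {L : Law} {α x y : ℝ}

/-- A law with the value `(1, 1)` of probability `α` and the value `(x, y)` of probability
`1 - α`. -/
def TwoPoint (L : Law) (α x y : ℝ) : Prop :=
  ∀ φ : ℝ → ℝ → ℝ, L.mean φ = α * φ 1 1 + (1 - α) * φ x y

theorem twoPoint_base (p : ℝ) (hp : p ∈ Set.Icc (0 : ℝ) 1) :
    TwoPoint (base p hp) 0 (1 - p) ((1 - p) ^ 2) := fun φ => by
  change ∑ _ : Unit, 1 * φ (1 - p) ((1 - p) ^ 2) = _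
  simp

theorem TwoPoint.V (h : TwoPoint L 0 x y) : TwoPoint L.V 0 (x ^ 2) (y ^ 2) := fun φ => by
  rw [mean_V, h, h, h]
  simp [sq]

/-- The contribution of a pair of values to the mean after the `U`-step. -/
noncomputable def pairU (φ : ℝ → ℝ → ℝ) (w b w' b' : ℝ) : ℝ :=
  w * w' * φ 1 1 + (1 - w * w') * φ (mixW w w') (mixB w b w' b')

/-- A symbol known with certainty stays known. For `w = 1` the mixed values are `0 / 0`, but their
coefficient is `0`. -/
theorem pairU_one_left (φ : ℝ → ℝ → ℝ) (w b : ℝ) : pairU φ 1 1 w b = φ 1 1 := by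
  rw [pairU, mixW, mixB]
  by_cases h : 1 - w = 0
  · have : w = 1 := by linarith
    simp [this]
  · have h1 : (1 + w - 2 * 1 * w) / (1 - 1 * w) = 1 := by
      rw [div_eq_one_iff_eq (by simpa using h)]; ring
    have h2 : (1 * (1 - w) ^ 2 + b * (1 - 1) ^ 2) / (1 - 1 * w) ^ 2 = 1 := by
      rw [div_eq_one_iff_eq (pow_ne_zero 2 (by simpa using h))]; ring
    rw [h1, h2]
    ring

theorem pairU_one_right (φ : ℝ → ℝ → ℝ) (w b : ℝ) : pairU φ w b 1 1 = φ 1 1 := by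
  rw [← pairU_one_left φ w b, pairU, pairU, mixW, mixW, mixB, mixB]
  ring_nf

theorem pairU_self (φ : ℝ → ℝ → ℝ) (hx : 0 ≤ x) :
    pairU φ x y x y = x ^ 2 * φ 1 1 + (1 - x ^ 2) * φ (2 * x / (1 + x)) (2 * y / (1 + x) ^ 2) := by
  rw [pairU, mixW, mixB, ← sq]
  by_cases h : 1 - x = 0
  · have : x = 1 := by linarith
    simp [this]
  · have h1 : 1 + x ≠ 0 := by positivity
    have h2 : 1 - x ^ 2 ≠ 0 := by
      rw [show 1 - x ^ 2 = (1 - x) * (1 + x) by ring]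
      exact mul_ne_zero h h1
    have e1 : (x + x - 2 * x * x) / (1 - x ^ 2) = 2 * x / (1 + x) := by
      rw [div_eq_div_iff h2 h1]; ring
    have e2 : (y * (1 - x) ^ 2 + y * (1 - x) ^ 2) / (1 - x ^ 2) ^ 2 = 2 * y / (1 + x) ^ 2 := by
      rw [div_eq_div_iff (pow_ne_zero 2 h2) (pow_ne_zero 2 h1)]; ring
    rw [e1, e2]

/-- The value `(1, 1)` is absorbing. Two values `(x, y)` lead to it with probability `x ^ 2` and
otherwise to a single new value, so repeated `U`-steps stay within two-point laws. -/
theorem TwoPoint.U (h : TwoPoint L α x y) (hx : 0 ≤ x) :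
    TwoPoint L.U (1 - (1 - α) ^ 2 * (1 - x ^ 2)) (2 * x / (1 + x)) (2 * y / (1 + x) ^ 2) :=
  fun φ => by
    have e : L.U.mean φ = L.mean fun w b => L.mean fun w' b' => pairU φ w b w' b' := L.mean_U φ
    rw [e, h, h, h, pairU_one_left, pairU_one_left, pairU_one_right, pairU_self φ hx]
    ring

/-- The mean of the sum of the squares of the weights. -/
def meanB (L : Law) : ℝ := L.mean fun _ b => b

theorem TwoPoint.meanB (h : TwoPoint L α x y) : L.meanB = α + (1 - α) * y := by
  rw [Law.meanB, h, mul_one]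

theorem meanB_V (L : Law) : L.V.meanB = L.meanB ^ 2 := by
  rw [meanB, mean_V]
  simp only [mean, meanB, sq]
  rw [Finset.sum_mul]
  refine Finset.sum_congr rfl fun t _ => ?_
  rw [Finset.mul_sum, Finset.mul_sum]
  refine Finset.sum_congr rfl fun t' _ => ?_
  ring

theorem pairU_snd_self (hx : 0 ≤ x) :
    pairU (fun _ b => b) x y x y = x ^ 2 + (1 - x) * (2 * y) / (1 + x) := by
  have : 1 + x ≠ 0 := by positivity
  rw [pairU_self _ hx]
  field_simp
  ring

theorem pairU_snd_sq (hx : 0 ≤ x) :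
    pairU (fun _ b => b) x y (x ^ 2) (y ^ 2) =
      x ^ 3 + (1 - x) * (y * (1 + x) ^ 2 + y ^ 2) / (1 + x + x ^ 2) := by
  rw [pairU, mixB]
  have h1 : 1 + x + x ^ 2 ≠ 0 := by positivity
  by_cases h : 1 - x = 0
  · have : x = 1 := by linarith
    simp [this]
  · have h2 : 1 - x * x ^ 2 ≠ 0 := by
      rw [show 1 - x * x ^ 2 = (1 - x) * (1 + x + x ^ 2) by ring]
      exact mul_ne_zero h h1
    have e : (1 - x * x ^ 2) * ((y * (1 - x ^ 2) ^ 2 + y ^ 2 * (1 - x) ^ 2) / (1 - x * x ^ 2) ^ 2)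
        = (1 - x) * (y * (1 + x) ^ 2 + y ^ 2) / (1 + x + x ^ 2) := by
      rw [← mul_div_assoc, div_eq_div_iff (pow_ne_zero 2 h2) h1]
      ring
    rw [e]
    ring

theorem pairU_comm (φ : ℝ → ℝ → ℝ) (w b w' b' : ℝ) : pairU φ w b w' b' = pairU φ w' b' w b := by
  rw [pairU, pairU, mixW, mixW, mixB, mixB]
  ring_nf

/-- The law after `V` has three values, `(1, 1)`, `(x, y)` and `(x ^ 2, y ^ 2)`, with probabilities
`α ^ 2`, `2 α (1 - α)` and `(1 - α) ^ 2`. The four summands are the pairs containing `(1, 1)`, then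
the pairs of equal or of different remaining values. Up to depth three only the word `U`, `V`, `U`
needs this. -/
theorem TwoPoint.meanB_V_U (h : TwoPoint L α x y) (hx : 0 ≤ x) :
    L.V.U.meanB = 1 - (1 - α ^ 2) ^ 2 +
      4 * α ^ 2 * (1 - α) ^ 2 * (x ^ 2 + (1 - x) * (2 * y) / (1 + x)) +
      4 * α * (1 - α) ^ 3 *
        (x ^ 3 + (1 - x) * (y * (1 + x) ^ 2 + y ^ 2) / (1 + x + x ^ 2)) +
      (1 - α) ^ 4 * (x ^ 4 + (1 - x ^ 2) * (2 * y ^ 2) / (1 + x ^ 2)) := by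
  have hV : ∀ φ : ℝ → ℝ → ℝ, L.V.mean φ = α ^ 2 * φ 1 1 + 2 * α * (1 - α) * φ x y +
      (1 - α) ^ 2 * φ (x ^ 2) (y ^ 2) := fun φ => by
    rw [mean_V, h, h, h]
    simp only [one_mul, mul_one, ← sq]
    ring_nf
  have e : L.V.U.meanB =
      L.V.mean fun w b => L.V.mean fun w' b' => pairU (fun _ b => b) w b w' b' := L.V.mean_U _
  rw [e, hV, hV, hV, hV]
  simp only [pairU_one_left, pairU_one_right]
  rw [pairU_comm _ (x ^ 2), pairU_snd_self hx, pairU_snd_sq hx, pairU_snd_self (sq_nonneg x)]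
  ring

section Values

variable {w : ℝ}

theorem TwoPoint.meanB_U (h : TwoPoint L 0 w (w ^ 2)) (hw : 0 ≤ w) :
    L.U.meanB = w ^ 2 + (1 - w) * (2 * w ^ 2) / (1 + w) := by
  have : 1 + w ≠ 0 := by positivity
  rw [(h.U hw).meanB]
  field_simp
  ring

/-- Four observations, each correct with probability `w`: the symbol is known unless at most one is
correct, which has probability `(1 - w) ^ 3 * (1 + 3 * w)`. In that case there remain four
candidates of weight `w / (1 + 3 * w)`. Three `U`-steps give the same picture with eight
observations. -/
theorem TwoPoint.meanB_U_U (h : TwoPoint L 0 w (w ^ 2)) (hw : 0 ≤ w) :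
    L.U.U.meanB = 1 - (1 - w) ^ 3 * (1 + 3 * w) +
      4 * w ^ 2 * (1 - w) ^ 3 / (1 + 3 * w) := by
  have h1 : 1 + w ≠ 0 := by positivity
  have h2 : 1 + 3 * w ≠ 0 := by positivity
  have e : 1 + 2 * w / (1 + w) = (1 + 3 * w) / (1 + w) := by field_simp; ring
  rw [((h.U hw).U (by positivity)).meanB, e]
  field_simp
  ring

theorem TwoPoint.meanB_U_U_U (h : TwoPoint L 0 w (w ^ 2)) (hw : 0 ≤ w) :
    L.U.U.U.meanB = 1 - (1 - w) ^ 7 * (1 + 7 * w) +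
      8 * w ^ 2 * (1 - w) ^ 7 / (1 + 7 * w) := by
  have h1 : 1 + w ≠ 0 := by positivity
  have h2 : 1 + 3 * w ≠ 0 := by positivity
  have h3 : 1 + 7 * w ≠ 0 := by positivity
  have e : 1 + 2 * w / (1 + w) = (1 + 3 * w) / (1 + w) := by field_simp; ring
  have e2 : 2 * (2 * w / (1 + w)) / ((1 + 3 * w) / (1 + w)) = 4 * w / (1 + 3 * w) := by
    field_simp; ring
  have e3 : 1 + 4 * w / (1 + 3 * w) = (1 + 7 * w) / (1 + 3 * w) := by field_simp; ring
  have e4 : 2 * (2 * w ^ 2 / (1 + w) ^ 2) / ((1 + 3 * w) / (1 + w)) ^ 2 =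
      4 * w ^ 2 / (1 + 3 * w) ^ 2 := by field_simp; ring
  rw [(((h.U hw).U (by positivity)).U (by positivity)).meanB, e, e2, e3, e4]
  field_simp
  ring

theorem TwoPoint.meanB_U_V_U (h : TwoPoint L 0 w (w ^ 2)) (hw : 0 ≤ w) :
    L.U.V.U.meanB = 1 - (1 - w ^ 4) ^ 2 +
      4 * w ^ 4 * (1 - w) ^ 2 * (4 * w ^ 2 + 4 * w ^ 2 * (1 - w) / (1 + 3 * w)) +
      4 * w ^ 2 * (1 - w) ^ 3 * (8 * w ^ 3 +
        2 * w ^ 2 * (1 - w) * ((1 + 3 * w) ^ 2 + 2 * w ^ 2) / (1 + 4 * w + 7 * w ^ 2)) +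
      (1 - w) ^ 4 * (16 * w ^ 4 +
        8 * w ^ 4 * (1 - w) * (1 + 3 * w) / (1 + 2 * w + 5 * w ^ 2)) := by
  have h1 : 1 + w ≠ 0 := by positivity
  have h2 : 1 + 3 * w ≠ 0 := by positivity
  have h3 : 1 + 4 * w + 7 * w ^ 2 ≠ 0 := by positivity
  have h4 : 1 + 2 * w + 5 * w ^ 2 ≠ 0 := by positivity
  have e : 1 + 2 * w / (1 + w) = (1 + 3 * w) / (1 + w) := by field_simp; ring
  have e1 : 1 - 2 * w / (1 + w) = (1 - w) / (1 + w) := by field_simp; ring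
  have e2 : (1 + 3 * w) / (1 + w) + (2 * w / (1 + w)) ^ 2 =
      (1 + 4 * w + 7 * w ^ 2) / (1 + w) ^ 2 := by field_simp; ring
  have e3 : 1 + (2 * w / (1 + w)) ^ 2 = (1 + 2 * w + 5 * w ^ 2) / (1 + w) ^ 2 := by
    field_simp; ring
  have e4 : 1 - (1 - 0) ^ 2 * (1 - w ^ 2) = w ^ 2 := by ring
  rw [(h.U hw).meanB_V_U (by positivity), e, e1, e2, e3, e4]
  field_simp
  ring

end Values

end Law

/-! ### The sums over the leaves as rational functions of `p`. -/

open Law in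
theorem leafSum_depthTwo {p : ℝ} (hp : p ∈ Set.Icc (0 : ℝ) 1) :
    leafSum (fun l => ((base p hp).steps l).meanB) 2 [] = 2 ^ 2 * capacityDepth2 p := by
  have hw : 0 ≤ 1 - p := by linarith [hp.2]
  have h := twoPoint_base p hp
  generalize base p hp = L at h ⊢
  change (L.U.U.meanB + L.U.V.meanB) + (L.V.U.meanB + L.V.V.meanB) = _
  -- In the variable `w = 1 - p` every denominator is, up to sign, a polynomial in `w` with
  -- nonnegative coefficients and constant term `1`, hence non-zero for `w ≥ 0`.
  obtain ⟨w, rfl⟩ : ∃ w, p = 1 - w := ⟨1 - p, by ring⟩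
  rw [sub_sub_cancel] at h hw
  have hV : TwoPoint L.V 0 (w ^ 2) ((w ^ 2) ^ 2) := h.V
  rw [h.meanB_U_U hw, meanB_V, h.meanB_U hw, hV.meanB_U (by positivity), meanB_V, meanB_V,
    h.meanB, capacityDepth2]
  have e1 : 2 - (1 - w) = 1 + w := by ring
  have e2 : (1 - w) ^ 2 - 2 * (1 - w) + 2 = 1 + w ^ 2 := by ring
  have e3 : 3 * (1 - w) - 4 = -(1 + 3 * w) := by ring
  have h1 : 1 + w ≠ 0 := by positivity
  have h2 : 1 + w ^ 2 ≠ 0 := by positivity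
  have h3 : 1 + 3 * w ≠ 0 := by positivity
  rw [e1, e2, e3, polyQ]
  field_simp
  ring

open Law in
theorem leafSum_depthThree {p : ℝ} (hp : p ∈ Set.Icc (0 : ℝ) 1) :
    leafSum (fun l => ((base p hp).steps l).meanB) 3 [] = 2 ^ 3 * capacityDepth3 p := by
  have hw : 0 ≤ 1 - p := by linarith [hp.2]
  have h := twoPoint_base p hp
  generalize base p hp = L at h ⊢
  change ((L.U.U.U.meanB + L.U.U.V.meanB) + (L.U.V.U.meanB + L.U.V.V.meanB)) +
    ((L.V.U.U.meanB + L.V.U.V.meanB) + (L.V.V.U.meanB + L.V.V.V.meanB)) = _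
  obtain ⟨w, rfl⟩ : ∃ w, p = 1 - w := ⟨1 - p, by ring⟩
  rw [sub_sub_cancel] at h hw
  have hV : TwoPoint L.V 0 (w ^ 2) ((w ^ 2) ^ 2) := h.V
  have hVV : TwoPoint L.V.V 0 ((w ^ 2) ^ 2) (((w ^ 2) ^ 2) ^ 2) := hV.V
  -- A final `V`-step squares the mean, so only words ending in `U` and the original law need an
  -- explicit value.
  simp only [meanB_V]
  rw [h.meanB_U_U_U hw, h.meanB_U_U hw, h.meanB_U_V_U hw, h.meanB_U hw,
    hV.meanB_U_U (by positivity), hV.meanB_U (by positivity), hVV.meanB_U (by positivity),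
    h.meanB, capacityDepth3, polyT1, polyT2, polyT3]
  have e1 : 2 - (1 - w) = 1 + w := by ring
  have e2 : (1 - w) ^ 2 - 2 * (1 - w) + 2 = 1 + w ^ 2 := by ring
  have e3 : 3 * (1 - w) - 4 = -(1 + 3 * w) := by ring
  have e4 : 7 * (1 - w) - 8 = -(1 + 7 * w) := by ring
  have e5 : 3 * (1 - w) ^ 2 - 6 * (1 - w) + 4 = 1 + 3 * w ^ 2 := by ring
  have e6 : (1 - w) ^ 4 - 4 * (1 - w) ^ 3 + 6 * (1 - w) ^ 2 - 4 * (1 - w) + 2 = 1 + w ^ 4 := by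
    ring
  have e7 : 7 * (1 - w) ^ 2 - 18 * (1 - w) + 12 = 1 + 4 * w + 7 * w ^ 2 := by ring
  have e8 : 5 * (1 - w) ^ 2 - 12 * (1 - w) + 8 = 1 + 2 * w + 5 * w ^ 2 := by ring
  have h1 : 1 + w ≠ 0 := by positivity
  have h2 : 1 + w ^ 2 ≠ 0 := by positivity
  have h3 : 1 + 3 * w ≠ 0 := by positivity
  have h4 : 1 + 7 * w ≠ 0 := by positivity
  have h5 : 1 + 3 * w ^ 2 ≠ 0 := by positivity
  have h6 : 1 + w ^ 4 ≠ 0 := by positivity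
  have h7 : 1 + 4 * w + 7 * w ^ 2 ≠ 0 := by positivity
  have h8 : 1 + 2 * w + 5 * w ^ 2 ≠ 0 := by positivity
  have e9 : (w ^ 2) ^ 2 = w ^ 4 := by ring
  rw [e1, e2, e3, e4, e5, e6, e7, e8, e9, polyS]
  field_simp
  ring

/-! ### Choice of the parameters and conclusion. -/

theorem Chan.mean_le_one {K : Type} [Field K] [Fintype K] (C : Chan K) : C.mean ≤ 1 := by
  rw [Chan.mean, ← C.sum_μ]
  exact Finset.sum_le_sum fun ω _ => mul_le_of_le_one_right (C.μ_nonneg ω) (C.fst_le_one ω 0)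

/-- The dimensions of the constituent codes of length `n`, for constituent channels of quality
`E`. -/
noncomputable def dims (E : List Bool → ℝ) (ε : ℝ) (n : ℕ) (x : List Bool) : ℕ :=
  ⌊(n : ℝ) * (E x - 5 * ε)⌋₊

/-- Rounding down costs less than one dimension per leaf, that is a rate less than `1 / n`. -/
theorem le_rate_dims {K : Type} [Field K] {n : ℕ} (pts : Fin n ↪ K)
    (E : List Bool → ℝ) {ε R : ℝ} {l : ℕ} (hn : 0 < n)
    (hk : ∀ x : List Bool, x.length = l → dims E ε n x ≤ n)
    (hR : 2 ^ l * (R + 5 * ε + 1 / n) ≤ leafSum E l []) :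
    R ≤ rate (iteratedUV (fun x => rsCode pts (dims E ε n x)) l []) := by
  have hn' : (0 : ℝ) < n := by exact_mod_cast hn
  have h2 : (0 : ℝ) < 2 ^ l := by positivity
  rw [rate_iteratedUV pts _ l hk, le_div_iff₀ (by positivity)]
  refine le_trans ?_ (leafSum_le (f := fun x => E x * n - (5 * ε * n + 1)) l []
    fun x _ => ?_)
  · rw [leafSum_mul_sub]
    have h := mul_le_mul_of_nonneg_right hR hn'.le
    have e : 2 ^ l * (R + 5 * ε + 1 / n) * (n : ℝ) = R * (2 ^ l * n) + 2 ^ l * (5 * ε * n + 1) := by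
      field_simp
      ring
    linarith
  · have := Nat.lt_floor_add_one ((n : ℝ) * (E ([] ++ x) - 5 * ε))
    rw [dims]
    linarith

/-- The choice `η = 1 / n ^ 2` makes the term `n * η` equal to `1 / n`. The field is so large that
the contribution of the wrong codewords is also at most `1 / n`. -/
theorem exists_errorProb_le {K : Type} [Field K] [Fintype K] {p : ℝ} (hp : p ∈ Set.Icc (0 : ℝ) 1)
    (E : List Bool → ℝ) {ε : ℝ} (hε : 0 < ε) (hε1 : ε ≤ 1) {n l : ℕ} (hn : 1 ≤ n)
    (hnε : 1 ≤ 2 * ε * n) (hE : ∀ x : List Bool, x.length = l →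
      E x - ε ≤ ((symChan K p hp).steps x).mean)
    (hq : (8 / (ε * (1 / (n : ℝ) ^ 2))) ^ n / Fintype.card K ≤ 1 / n) (pts : Fin n ↪ K) :
    ∃ s : List Bool → ℕ, errorProb p pts (dims E ε n) s l ≤
      2 ^ l * (2 / (ε ^ 2 * n) + 2 / n) := by
  have hn' : (1 : ℝ) ≤ n := by exact_mod_cast hn
  have hs : ∀ x : List Bool, ∃ s : ℕ, x.length = l → ∀ c ∈ rsCode pts (dims E ε n x),
      leafFail pts (dims E ε n x) s ((symChan K p hp).steps x) c ≤
        2 / (ε ^ 2 * n) + 2 / n := by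
    intro x
    by_cases hx : x.length = l
    · have hm := ((symChan K p hp).steps x).mean_le_one
      have hEx := hE x hx
      -- Of the margin `5 * ε` in `dims`, one `ε` pays for the distance between the actual mean and
      -- its limit, and `4 * ε` remain for decoding. If `E x < 5 * ε`, the floor in `ℕ` gives
      -- dimension `0`.
      have hk : dims E ε n x = 0 ∨
          (dims E ε n x : ℝ) ≤ n * (((symChan K p hp).steps x).mean - 4 * ε) := by
        rcases le_total 0 ((n : ℝ) * (E x - 5 * ε)) with h | h
        · refine Or.inr ((Nat.floor_le h).trans (mul_le_mul_of_nonneg_left ?_ n.cast_nonneg))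
          linarith
        · exact Or.inl (Nat.floor_of_nonpos h)
      have hkn : dims E ε n x < n := by
        rcases hk with h | h
        · omega
        · have : (n : ℝ) * (((symChan K p hp).steps x).mean - 4 * ε) < n := by nlinarith
          exact_mod_cast h.trans_lt this
      obtain ⟨s, h⟩ := (eventually_leafFail_le ((symChan K p hp).steps x) pts (η := 1 / (n : ℝ) ^ 2)
        hε hε1 (by positivity) (div_le_one_of_le₀ (one_le_pow₀ hn') (by positivity)) hnε hkn
        hk).exists
      refine ⟨s, fun _ c hc => (h c hc).trans ?_⟩
      have e : (n : ℝ) * (1 / (n : ℝ) ^ 2) = 1 / n := by field_simp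
      have e2 : (2 : ℝ) / n = 1 / n + 1 / n := by ring
      rw [e, e2]
      linarith
    · exact ⟨0, fun h => (hx h).elim⟩
  choose s hs using hs
  exact ⟨s, errorProb_le hp pts _ s l fun x hx => hs x hx⟩

theorem dims_le {K : Type} [Field K] [Fintype K] {p : ℝ} (hp : p ∈ Set.Icc (0 : ℝ) 1)
    (E : List Bool → ℝ) {ε : ℝ} (hε : 0 < ε) {x : List Bool}
    (hE : E x - ε ≤ ((symChan K p hp).steps x).mean) (n : ℕ) : dims E ε n x ≤ n := by
  have hm := ((symChan K p hp).steps x).mean_le_one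
  refine Nat.floor_le_of_le (mul_le_of_le_one_right n.cast_nonneg ?_)
  linarith

/-- An iterated construction over constituent codes of rates close to the limiting qualities of the
constituent channels has a probability of error tending to `0`. -/
theorem achievable_of_lt {p : ℝ} (hp : p ∈ Set.Icc (0 : ℝ) 1) {R : ℝ} {l : ℕ}
    (h : 2 ^ l * R < leafSum (fun x => ((Law.base p hp).steps x).meanB) l []) :
    Achievable l p R := by
  set E : List Bool → ℝ := fun x => ((Law.base p hp).steps x).meanB
  have h2 : (0 : ℝ) < 2 ^ l := by positivity
  obtain ⟨Δ, hΔ, hΔR⟩ : ∃ Δ : ℝ, 0 < Δ ∧ 2 ^ l * (R + Δ) = leafSum E l [] :=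
    ⟨leafSum E l [] / 2 ^ l - R, by rw [sub_pos, lt_div_iff₀ h2]; linarith, by field_simp; ring⟩
  -- The gap `Δ` is shared between the margin, `5 * ε ≤ Δ / 2`, and the rounding, `1 / n ≤ Δ / 2`.
  -- The latter holds once `n ≥ 2 / Δ`.
  obtain ⟨ε, hε, hε1, hεΔ⟩ : ∃ ε : ℝ, 0 < ε ∧ ε ≤ 1 ∧ 10 * ε ≤ Δ :=
    ⟨min 1 (Δ / 10), by positivity, min_le_left _ _, by linarith [min_le_right 1 (Δ / 10)]⟩
  obtain ⟨N, hN⟩ := exists_nat_ge (max 1 (max (1 / (2 * ε)) (2 / Δ)))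
  have hfact : ∀ j, Fact (Nat.nth Nat.Prime j).Prime := fun j => ⟨Nat.prime_nth_prime j⟩
  let F : ℕ → Type := fun j => ZMod (Nat.nth Nat.Prime j)
  let _ : ∀ j, Field (F j) := fun j => ZMod.instField _
  let _ : ∀ j, Fintype (F j) := fun j => ZMod.fintype _
  have hcard : StrictMono fun j => Fintype.card (F j) := by
    have : (fun j => Fintype.card (F j)) = Nat.nth Nat.Prime := funext fun j => ZMod.card _
    rw [this]
    exact Nat.nth_strictMono Nat.infinite_setOfPred_prime
  have hF := hcard.tendsto_atTop
  have hE : ∀ᶠ j in atTop, ∀ x ∈ {x : List Bool | x.length = l},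
      E x - ε ≤ ((symChan (F j) p hp).steps x).mean := by
    refine (eventually_all_finite (List.finite_length_eq Bool l)).2 fun x _ => ?_
    obtain ⟨S⟩ := Approach.nonempty_steps hF x _ _ (Approach.base (F := F) p hp)
    exact S.eventually_le_mean hε
  have hq : ∀ (n : ℕ), 1 ≤ n → ∀ᶠ j in atTop,
      (8 / (ε * (1 / (n : ℝ) ^ 2))) ^ n / Fintype.card (F j) ≤ 1 / n := fun n hn =>
    (tendsto_const_nhds.div_atTop (tendsto_natCast_atTop_atTop.comp hF)).eventually_le_const
      (by positivity)
  have hNn : ∀ i : ℕ, (N : ℝ) ≤ ((i + N : ℕ) : ℝ) := fun i => by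
    exact_mod_cast Nat.le_add_left N i
  have hN1 : ∀ i : ℕ, 1 ≤ i + N := fun i => by
    exact_mod_cast (le_max_left _ _).trans (hN.trans (hNn i))
  have key : ∀ i : ℕ, ∀ᶠ j in atTop, (∀ x : List Bool, x.length = l → dims E ε (i + N) x ≤ i + N) ∧
      ∃ (pts : Fin (i + N) ↪ F j) (s : List Bool → ℕ),
        errorProb p pts (dims E ε (i + N)) s l ≤
          2 ^ l * (2 / (ε ^ 2 * (i + N : ℕ)) + 2 / (i + N : ℕ)) := fun i => by
    filter_upwards [hE, hq (i + N) (hN1 i), hF.eventually_ge_atTop (i + N)] with j hEj hqj hcj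
    obtain ⟨pts⟩ : Nonempty (Fin (i + N) ↪ F j) :=
      Function.Embedding.nonempty_of_card_le (by rwa [Fintype.card_fin])
    have hnε : 1 ≤ 2 * ε * (i + N : ℕ) := by
      have := ((le_max_left _ _).trans (le_max_right _ _)).trans (hN.trans (hNn i))
      rwa [div_le_iff₀' (by positivity)] at this
    exact ⟨fun x hx => dims_le hp E hε (hEj x hx) _, pts,
      exists_errorProb_le hp E hε hε1 (hN1 i) hnε hEj hqj pts⟩
  -- For each length all sufficiently large prime fields are suitable, so the fields can be chosen
  -- with strictly increasing cardinalities.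
  obtain ⟨φ, hφ, hk⟩ := extraction_forall_of_eventually key
  choose hk pts s hs using hk
  refine ⟨fun i => F (φ i), fun _ => inferInstance, fun _ => inferInstance, fun i => i + N, pts,
    fun i => dims E ε (i + N), s, fun i j hij => Nat.add_lt_add_right hij N, hcard.comp hφ, hk,
    fun i => le_rate_dims (pts i) E (hN1 i) (hk i) ?_, ?_⟩
  · rw [← hΔR]
    have h3 := ((le_max_right _ _).trans (le_max_right _ _)).trans (hN.trans (hNn i))
    have h4 : (0 : ℝ) < (i + N : ℕ) := by exact_mod_cast hN1 i
    have h5 : 1 / ((i + N : ℕ) : ℝ) ≤ Δ / 2 := by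
      rw [div_le_div_iff₀ h4 two_pos]
      rw [div_le_iff₀ hΔ] at h3
      linarith
    refine mul_le_mul_of_nonneg_left ?_ h2.le
    linarith
  · refine squeeze_zero (fun i => errorProb_nonneg hp _ _ _ _) hs ?_
    have hn : Tendsto (fun i : ℕ => ((i + N : ℕ) : ℝ)) atTop atTop :=
      tendsto_natCast_atTop_atTop.comp (tendsto_add_atTop_nat N)
    have := ((tendsto_const_nhds (x := (2 : ℝ))).div_atTop
      (hn.const_mul_atTop (sq_pos_of_pos hε))).add
      ((tendsto_const_nhds (x := (2 : ℝ))).div_atTop hn)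
    simpa using this.const_mul (2 ^ l)

end UVKV

theorem mainTheorem8 (p : ℝ) (hp : p ∈ Set.Icc (0 : ℝ) 1) (R : ℝ) :
    (R < UVKV.capacityDepth2 p → UVKV.Achievable 2 p R) ∧
    (R < UVKV.capacityDepth3 p → UVKV.Achievable 3 p R) := by
  refine ⟨fun h => UVKV.achievable_of_lt hp ?_, fun h => UVKV.achievable_of_lt hp ?_⟩
  · rw [UVKV.leafSum_depthTwo hp]
    linarith
  · rw [UVKV.leafSum_depthThree hp]
    linarith
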